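/- Let $X$ be a compact smooth 4-manifold and $E\to X$ an $SO(3)$-bundle, i.e. a smooth oriented real vector bundle of rank 3 with a smooth fibrewise inner product. Let $\pi\colon Z\to X$ be its unit sphere bundle and $V\to Z$ the vertical tangent bundle, with fibre $V_{(x,p)}=p^\perp\subset E_x$, regarded as a Hermitian line bundle with $i\cdot s=p\times s$. For a unitary connection $B$ in $V$ put $\omega_B=\frac{i}{2\pi}F_B\in\Omega^2(Z,\mathbb R)$, and let $\mathcal S$ be the set of unitary connections $B$ in $V$ for which $\omega_B$ is a symplectic form on $Z$. Let $\mathcal G_\pi$ be the group of diffeomorphisms of $Z$ which map each fibre of $\pi$ to itself and preserve the area form of each fibre; $\mathrm{Lie}(\mathcal G_\pi)$ consists of the smooth vertical vector fields $v$ on $Z$ which are divergence-free on each fibre. Such a $v$ has on each fibre a unique Hamiltonian $f_v$ of mean value zero (with respect to the area form of the unit sphere), and it is lifted to an infinitesimal bundle isometry of $V$, $\hat v=\tilde v+f_v\,\partial_\theta$, where $\tilde v$ is the horizontal lift for the Levi-Civita connection of the fibres of $Z$ and $\partial_\theta$ generates the action of $S^1$ on $V$. For $B\in\mathcal S$ let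 $B(\hat v)\colon Z\to\mathbb R$ be the function such that the $B$-vertical part of $\hat v$ is multiplication by $iB(\hat v)$. The moment map $m_\pi\colon\mathcal S\to(\mathrm{Lie}\,\mathcal G_\pi)^*$ is $$\langle m_\pi(B),v\rangle=\frac1{3!}\int_Z B(\hat v)\,\omega_B^3 ,$$ where $Z$ carries the orientation given by $\omega_B$. Let $A$ be a smooth metric connection in $E$ which is definite, i.e. its curvature satisfies $F_A(u,v)\neq0$ for all linearly independent tangent vectors $u,v$ of $X$. Let $A_V$ be the induced unitary connection in $V$: the Levi-Civita connection of the round sphere in directions tangent to the fibres of $Z$, and differentiation with respect to $A$-parallel transport in $A$-horizontal directions. Call $A$ perfect if, for local orthonormal frames $e_1,e_2,e_3$ of $\mathfrak{so}(E)$ and $F_A=\sum_i F_i\otimes e_i$, one has $F_i\wedge F_j=\delta_{ij}\,\mu$ with $\mu=\frac13\sum_k F_k\wedge F_k$. Then $A_V\in\mathcal S$, and $m_\pi(A_V)=0$ if and only if $A$ is perfect. -/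

import Mathlib

open Bundle
open scoped Manifold ContDiff

namespace DefConn

noncomputable section

/-- `ℝ³` with its Euclidean inner product, the model fibre of an `SO(3)`-bundle. -/
abbrev E3 : Type := EuclideanSpace ℝ (Fin 3)

/-- `ℝ⁴`, the model of the base manifold. -/
abbrev E4 : Type := EuclideanSpace ℝ (Fin 4)

/-! ### Exterior algebra -/

section Exterior

variable {T : Type*}

/-- The wedge product `α ∧ β` of two 2-forms, evaluated on four vectors. -/
def wedge (α β : T → T → ℝ) (v : Fin 4 → T) : ℝ :=
  (1 / 4) * ∑ σ : Equiv.Perm (Fin 4), ((Equiv.Perm.sign σ : ℤ) : ℝ) *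
    (α (v (σ 0)) (v (σ 1)) * β (v (σ 2)) (v (σ 3)))

/-- The 6-form `F ∧ F ∧ F` of a 2-form `F`, evaluated on six vectors. -/
def cube (F : T → T → ℝ) (v : Fin 6 → T) : ℝ :=
  (1 / 8) * ∑ σ : Equiv.Perm (Fin 6), ((Equiv.Perm.sign σ : ℤ) : ℝ) *
    (F (v (σ 0)) (v (σ 1)) * F (v (σ 2)) (v (σ 3)) * F (v (σ 4)) (v (σ 5)))

end Exterior

/-! ### The cross product of an oriented Euclidean 3-space -/

section Cross

variable {T : Type*} [NormedAddCommGroup T] [InnerProductSpace ℝ T]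

/-- The cross product `p × s` of an oriented three-dimensional Euclidean space: the vector with
`⟪p × s, t⟫ = vol (p, s, t)` for all `t`. -/
def crossOf (h : Module.finrank ℝ T = 3) (o : Orientation ℝ T (Fin 3)) (p s : T) : T :=
  haveI : Fact (Module.finrank ℝ T = 3) := ⟨h⟩
  haveI : FiniteDimensional ℝ T := .of_finrank_pos (by omega)
  haveI : CompleteSpace T := FiniteDimensional.complete ℝ T
  (InnerProductSpace.toDual ℝ T).symm
    (LinearMap.toContinuousLinearMap (o.volumeForm.toMultilinearMap.toLinearMap ![p, s, 0] 2))

theorem inner_crossOf (h : Module.finrank ℝ T = 3) (o : Orientation ℝ T (Fin 3)) (p s t : T) :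
    inner ℝ (crossOf h o p s) t =
      (haveI : Fact (Module.finrank ℝ T = 3) := ⟨h⟩; o.volumeForm ![p, s, t]) := by
  have : Fact (Module.finrank ℝ T = 3) := ⟨h⟩
  have : FiniteDimensional ℝ T := .of_finrank_pos (by omega)
  have : CompleteSpace T := FiniteDimensional.complete ℝ T
  have e : Function.update ![p, s, (0 : T)] 2 t = ![p, s, t] := by
    ext i; fin_cases i <;> simp [Function.update]
  simp only [crossOf, InnerProductSpace.toDual_symm_apply]
  change o.volumeForm (Function.update ![p, s, (0 : T)] 2 t) = _
  rw [e]

end Cross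

variable {X : Type*} [TopologicalSpace X] [ChartedSpace E4 X]
  {E : X → Type*} [TopologicalSpace (TotalSpace E3 E)]
  [∀ x, NormedAddCommGroup (E x)] [∀ x, InnerProductSpace ℝ (E x)]
  [FiberBundle E3 E] [VectorBundle ℝ E3 E]

/-! ### `SO(3)`-bundles, definite and perfect connections -/

/-- `L` is a smooth orthonormal frame of `E` over `U`, written as a family of isometries
`ℝ³ → E x`. -/
def IsSmoothFrame (L : ∀ x, E3 ≃ₗᵢ[ℝ] E x) (U : Set X) : Prop :=
  ∀ u : E3, ContMDiffOn (𝓡 4) ((𝓡 4).prod 𝓘(ℝ, E3)) ∞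
    (fun x ↦ (⟨x, L x u⟩ : TotalSpace E3 E)) U

/-- `o` is an orientation of the Euclidean vector bundle `E`: around every point there is a smooth
orthonormal frame which is positive for `o`. -/
def IsBundleOrientation (o : ∀ x, Orientation ℝ (E x) (Fin 3)) : Prop :=
  ∀ x₀ : X, ∃ U : Set X, IsOpen U ∧ x₀ ∈ U ∧ ∃ L : ∀ x, E3 ≃ₗᵢ[ℝ] E x, IsSmoothFrame L U ∧
    ∀ x ∈ U, ((EuclideanSpace.basisFun (Fin 3) ℝ).map (L x)).toBasis.orientation = o x

/-- The cross product on the fibres of `E`. -/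
def cross (o : ∀ x, Orientation ℝ (E x) (Fin 3)) {x : X} (p s : E x) : E x :=
  crossOf ((VectorBundle.finrank_eq ℝ E3 E x).trans (by simp)) (o x) p s

/-- The curvature `F_A(u, v) σ = ∇_u ∇_v σ - ∇_v ∇_u σ - ∇_[u, v] σ` at `x`, computed (as it may be,
being tensorial) with the canonical local extensions of `u`, `v` and `σ`. -/
def bundleCurvature [IsManifold (𝓡 4) ∞ X] (A : CovariantDerivative (𝓡 4) E3 E) (x : X)
    (u v : TangentSpace (𝓡 4) x) (σ : E x) : E x :=
  let U : ∀ y : X, TangentSpace (𝓡 4) y := FiberBundle.extend E4 u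
  let V : ∀ y : X, TangentSpace (𝓡 4) y := FiberBundle.extend E4 v
  let S : ∀ y : X, E y := FiberBundle.extend E3 σ
  A (fun y ↦ A S y (V y)) x u - A (fun y ↦ A S y (U y)) x v
    - A S x (VectorField.mlieBracket (𝓡 4) U V x)

/-- `A` is definite: its curvature is non-zero on every tangent 2-plane. -/
def IsDefinite [IsManifold (𝓡 4) ∞ X] (A : CovariantDerivative (𝓡 4) E3 E) : Prop :=
  ∀ (x : X) (u v : TangentSpace (𝓡 4) x), LinearIndependent ℝ ![u, v] →
    ∃ σ : E x, bundleCurvature A x u v σ ≠ 0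

/-- The components `F₀, F₁, F₂` of the curvature at `x` in the frame of `so(E x)` given by the
orthonormal basis `L` of `E x`: the `k`-th element of that frame is the infinitesimal rotation in
the plane of the basis vectors `k + 1` and `k + 2` (mod 3). It is orthonormal up to a common
factor for every invariant inner product on `so(E x)`. -/
def curvatureComponent [IsManifold (𝓡 4) ∞ X] (A : CovariantDerivative (𝓡 4) E3 E) (x : X)
    (L : E3 ≃ₗᵢ[ℝ] E x) (k : Fin 3) (u v : TangentSpace (𝓡 4) x) : ℝ :=
  inner ℝ (bundleCurvature A x u v (L (EuclideanSpace.single (k + 1) 1)))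
    (L (EuclideanSpace.single (k + 2) 1))

/-- `A` is perfect: `F_i ∧ F_j = δ_ij μ` with `μ = (F₀² + F₁² + F₂²) / 3`. -/
def IsPerfect [IsManifold (𝓡 4) ∞ X] (A : CovariantDerivative (𝓡 4) E3 E) : Prop :=
  ∀ (x : X) (L : E3 ≃ₗᵢ[ℝ] E x) (i j : Fin 3) (t : Fin 4 → TangentSpace (𝓡 4) x),
    wedge (curvatureComponent A x L i) (curvatureComponent A x L j) t =
      if i = j then
        (1 / 3) * ∑ k, wedge (curvatureComponent A x L k) (curvatureComponent A x L k) t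
      else 0

/-- The covariant derivative of a section `s` of `E` along a map `W → X` (the projection of `s`):
if `s = ∑ sⁱ eᵢ` in a local frame, then `D s = ∑ (d sⁱ) eᵢ + sⁱ ∇ eᵢ`; the frame used at `w` is
the one of the standard trivialization around the base point of `s w`. -/
def covAlong {W : Type*} [NormedAddCommGroup W] [NormedSpace ℝ W]
    (A : CovariantDerivative (𝓡 4) E3 E) (s : W → TotalSpace E3 E) (w : W) :
    W →L[ℝ] E (s w).proj :=
  let e := trivializationAt E3 E (s w).proj
  let dx : W →L[ℝ] TangentSpace (𝓡 4) (s w).proj :=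
    mfderiv 𝓘(ℝ, W) (𝓡 4) (fun w' ↦ (s w').proj) w
  (e.symmL ℝ (s w).proj).comp (fderiv ℝ (fun w' ↦ (e (s w')).2) w)
    + (A (FiberBundle.extend E3 (s w).2) (s w).proj).comp dx

/-! ### The sphere bundle `Z`, the vertical bundle `V → Z` and its unitary connections

A point of the unit sphere bundle `Z → X` is a pair `(x, p)` with `p ∈ E x` and `‖p‖ = 1`. The
vertical tangent bundle `V → Z` has fibre `p^⊥ ⊆ E x` at `(x, p)`; it is a Hermitian line bundle,
multiplication by `i` being `s ↦ p × s`. -/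

/-- A triple `(x, p, s)` with `p, s ∈ E x`. When `p` and `s` are orthonormal this is the unit
vector `s` of the fibre of `V` at the point `(x, p)` of `Z`, that is, a point of the unit circle
bundle of `V`. -/
structure FramePoint (E : X → Type*) where
  /-- the point of `X` -/
  pt : X
  /-- the point of the sphere over `pt` -/
  pos : E pt
  /-- the vertical tangent vector at `pos` -/
  vec : E pt

/-- `ψ` is, over the open set `U`, a smooth family of points of `Z` with a smooth family of unit
vectors of `V` at these points: a smooth map from `U` to the unit circle bundle of `V`, or a smooth
unit section of `V` along a smooth map `U → Z`. -/
def IsUnitFamily {W : Type*} [NormedAddCommGroup W] [NormedSpace ℝ W] (ψ : W → FramePoint E)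
    (U : Set W) : Prop :=
  IsOpen U ∧
  (∀ w ∈ U, ‖(ψ w).pos‖ = 1 ∧ ‖(ψ w).vec‖ = 1 ∧ inner ℝ (ψ w).pos (ψ w).vec = 0) ∧
  ContMDiffOn 𝓘(ℝ, W) ((𝓡 4).prod 𝓘(ℝ, E3)) ∞
    (fun w ↦ (⟨(ψ w).pt, (ψ w).pos⟩ : TotalSpace E3 E)) U ∧
  ContMDiffOn 𝓘(ℝ, W) ((𝓡 4).prod 𝓘(ℝ, E3)) ∞
    (fun w ↦ (⟨(ψ w).pt, (ψ w).vec⟩ : TotalSpace E3 E)) U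

/-- The gauge transformation `s ↦ exp(iα) s` of a family of unit vectors `s` of `V`. -/
def rotate (o : ∀ x, Orientation ℝ (E x) (Fin 3)) {W : Type*} (α : W → ℝ)
    (ψ : W → FramePoint E) (w : W) : FramePoint E where
  pt := (ψ w).pt
  pos := (ψ w).pos
  vec := Real.cos (α w) • (ψ w).vec + Real.sin (α w) • cross o (ψ w).pos (ψ w).vec

/-- Connection 1-forms for `V`: to a family `ψ` of unit vectors of `V` with parameters in `W`
is attached a real 1-form on `W`, to be thought of as the form `θ` with `∇ s = i θ s` for the unit
section `s` given by `ψ`. -/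
structure ConnectionForms (E : X → Type*) where
  /-- the connection form in a local unit section of `V` -/
  form : ∀ {W : Type} [NormedAddCommGroup W] [NormedSpace ℝ W],
    (W → FramePoint E) → W → W →L[ℝ] ℝ

/-- `B` is a (smooth) unitary connection in `V`: its connection forms are smooth, natural under
pull-back, and change by `dα` when the unit section is multiplied by `exp(iα)`. Equivalently, `B`
is a smooth `S¹`-invariant 1-form on the unit circle bundle of `V` which is `1` on the generator
of the circle action. -/
structure IsUnitaryConnection (o : ∀ x, Orientation ℝ (E x) (Fin 3)) (B : ConnectionForms E) :
    Prop where
  smooth : ∀ {W : Type} [NormedAddCommGroup W] [NormedSpace ℝ W] [FiniteDimensional ℝ W]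
    (ψ : W → FramePoint E) (U : Set W), IsUnitFamily ψ U → ContDiffOn ℝ ∞ (B.form ψ) U
  pullback : ∀ {W W' : Type} [NormedAddCommGroup W] [NormedSpace ℝ W] [FiniteDimensional ℝ W]
    [NormedAddCommGroup W'] [NormedSpace ℝ W'] [FiniteDimensional ℝ W']
    (ψ : W → FramePoint E) (U : Set W) (ψ' : W' → FramePoint E) (U' : Set W') (g : W' → W),
    IsUnitFamily ψ U → IsUnitFamily ψ' U' → ContDiffOn ℝ ∞ g U' → Set.MapsTo g U' U →
    (∀ w ∈ U', ψ' w = ψ (g w)) →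
    ∀ w ∈ U', B.form ψ' w = (B.form ψ (g w)).comp (fderiv ℝ g w)
  gauge : ∀ {W : Type} [NormedAddCommGroup W] [NormedSpace ℝ W] [FiniteDimensional ℝ W]
    (ψ : W → FramePoint E) (U : Set W) (α : W → ℝ),
    IsUnitFamily ψ U → ContDiffOn ℝ ∞ α U →
    ∀ w ∈ U, B.form (rotate o α ψ) w = B.form ψ w + fderiv ℝ α w

/-- The real 2-form `ω_B = (i / 2π) F_B`, pulled back to the parameter space of `ψ`. Since
`F_B = i dθ`, this is `-(1 / 2π) dθ`. It depends only on the family of points of `Z` underlying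
`ψ`. -/
def curvatureForm (B : ConnectionForms E) {W : Type} [NormedAddCommGroup W] [NormedSpace ℝ W]
    (ψ : W → FramePoint E) (w u v : W) : ℝ :=
  -(1 / (2 * Real.pi)) * (fderiv ℝ (B.form ψ) w u v - fderiv ℝ (B.form ψ) w v u)

/-- `ω_B` is non-degenerate on `Z`, tested in local parametrizations of the 6-manifold `Z`. -/
def IsNondegenerate (B : ConnectionForms E) : Prop :=
  ∀ {W : Type} [NormedAddCommGroup W] [NormedSpace ℝ W] [FiniteDimensional ℝ W]
    (ψ : W → FramePoint E) (U : Set W), Module.finrank ℝ W = 6 → IsUnitFamily ψ U →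
    ∀ w ∈ U,
    Function.Injective (mfderiv 𝓘(ℝ, W) ((𝓡 4).prod 𝓘(ℝ, E3))
      (fun w' ↦ (⟨(ψ w').pt, (ψ w').pos⟩ : TotalSpace E3 E)) w) →
    ∀ u : W, (∀ v : W, curvatureForm B ψ w u v = 0) → u = 0

/-- The space `𝒮` of all unitary connections `B` in `V` for which `ω_B = (i / 2π) F_B` is a
symplectic form on `Z` (it is automatically closed). -/
def symplecticConnections (o : ∀ x, Orientation ℝ (E x) (Fin 3)) : Set (ConnectionForms E) :=
  {B | IsUnitaryConnection o B ∧ IsNondegenerate B}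

/-- The connection `A_V` in `V` induced by `A`. The covariant derivative of a section `s` of `V`
is the `V`-component of its covariant derivative `D_A s` as a section of (the pull-back of) `E`.
In vertical directions `D_A` is the flat derivative in the Euclidean space `E x`, so this is the
Levi-Civita connection of the round sphere; along horizontal paths it is the derivative of `s` in
the trivialization by `A`-parallel transport. The connection form in a unit section `s` of `V` is
`⟪D_A s, i s⟫` with `i s = p × s`. -/
def inducedConnection (o : ∀ x, Orientation ℝ (E x) (Fin 3))
    (A : CovariantDerivative (𝓡 4) E3 E) : ConnectionForms E where
  form ψ w := (innerSL ℝ (cross o (ψ w).pos (ψ w).vec)).comp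
    (covAlong A (fun w' ↦ (⟨(ψ w').pt, (ψ w').vec⟩ : TotalSpace E3 E)) w)

/-! ### The Lie algebra of fibrewise area-preserving maps of `Z` and its lift to `V` -/

/-- The Lie algebra of the group `𝒢_π` of diffeomorphisms of `Z` which map each fibre of `Z → X` to
itself and preserve its area form: smooth vertical vector fields on `Z` whose restriction to each
fibre is divergence free. (The divergence of a tangent field on the unit sphere is the trace of
the derivative of its extension by radial invariance.) -/
structure LieGpi (E : X → Type*) [TopologicalSpace (TotalSpace E3 E)]
    [∀ x, NormedAddCommGroup (E x)] [∀ x, InnerProductSpace ℝ (E x)]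
    [FiberBundle E3 E] [VectorBundle ℝ E3 E] where
  /-- the vector field; only its values at unit vectors matter -/
  field : ∀ x, E x → E x
  tangent : ∀ (x : X) (p : E x), ‖p‖ = 1 → inner ℝ p (field x p) = 0
  smooth : ContMDiffOn ((𝓡 4).prod 𝓘(ℝ, E3)) ((𝓡 4).prod 𝓘(ℝ, E3)) ∞
    (fun z : TotalSpace E3 E ↦ (⟨z.1, field z.1 z.2⟩ : TotalSpace E3 E)) {z | ‖z.2‖ = 1}
  divFree : ∀ (x : X) (p : E x), ‖p‖ = 1 →
    LinearMap.trace ℝ (E x)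
      (fderiv ℝ (fun y : E x ↦ field x (‖y‖⁻¹ • y)) p : E x →ₗ[ℝ] E x) = 0

/-- `f` is a Hamiltonian, of mean value zero, of the tangent vector field `v` on the unit sphere
of `E x`: `df = ι_v (area form)`, the area form at `p` being `(v, t) ↦ vol (p, v, t)`. -/
def IsFibreHamiltonian (o : ∀ x, Orientation ℝ (E x) (Fin 3)) (x : X) (v : E x → E x)
    (f : E x → ℝ) : Prop :=
  (∀ p : E x, ‖p‖ = 1 → DifferentiableAt ℝ (fun y : E x ↦ f (‖y‖⁻¹ • y)) p ∧
    ∀ t : E x, inner ℝ p t = 0 →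
      fderiv ℝ (fun y : E x ↦ f (‖y‖⁻¹ • y)) p t = inner ℝ (cross o p (v p)) t) ∧
  ∀ L : E3 ≃ₗᵢ[ℝ] E x,
    ∫ p : Metric.sphere (0 : E3) 1, f (L p) ∂(MeasureTheory.volume : MeasureTheory.Measure E3).toSphere
      = 0

open Classical in
/-- The mean-value-zero Hamiltonian of a divergence-free vector field `v` on the unit sphere of
`E x`; it exists, and is unique on the sphere, as the sphere is simply connected. -/
def fibreHamiltonian (o : ∀ x, Orientation ℝ (E x) (Fin 3)) (x : X) (v : E x → E x) : E x → ℝ :=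
  if h : ∃ f, IsFibreHamiltonian o x v f then h.choose else 0

/-- A vector field on the unit circle bundle of `V` which is tangent to the fibres of the circle
bundle over `X`: at `(x, p, s)` it is given by the velocities of `p` and of `s` in `E x`. -/
abbrev FibreField (E : X → Type*) : Type _ := ∀ q : FramePoint E, E q.pt × E q.pt

/-- The infinitesimal bundle isometry of `V` lifting `v ∈ Lie(𝒢_π)`: the horizontal lift of `v` for
the Levi-Civita connections of the fibres, plus `f ∂/∂θ` with `f` the fibrewise Hamiltonian of `v`
of mean value zero, where `∂/∂θ`, the generator of the circle action, is `s ↦ i s`. -/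
def lift (o : ∀ x, Orientation ℝ (E x) (Fin 3)) (v : LieGpi E) : FibreField E := fun q ↦
  (v.field q.pt q.pos,
    -(inner ℝ q.vec (v.field q.pt q.pos)) • q.pos
      + fibreHamiltonian o q.pt (v.field q.pt) q.pos • cross o q.pos q.vec)

/-! ### The moment map -/

/-- The orthonormal pair obtained from the linearly independent pair `(u, a)` in `E x` by the
Gram-Schmidt process. -/
def orthonormalize (x : X) (u a : E x) : FramePoint E where
  pt := x
  pos := ‖u‖⁻¹ • u
  vec :=
    let p : E x := ‖u‖⁻¹ • u
    let b : E x := a - (inner ℝ p a : ℝ) • p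
    ‖b‖⁻¹ • b

/-- The function `B(η)` on `Z`: the value of the connection `B`, as a 1-form on the unit circle
bundle of `V`, on the field `η`, so that the vertical part of `η` at `(x, p)` is multiplication by
`i B(η)`. It is computed at one unit vector `s` of the fibre of `V` at `(x, p)` (all of them give
the same value when `η` is circle-invariant), on a path with velocity `η`. -/
def pairing (B : ConnectionForms E) (η : FibreField E) (x : X) (p : E x) : ℝ :=
  let s : E x := Classical.epsilon fun s ↦ ‖s‖ = 1 ∧ inner ℝ p s = 0
  B.form (fun t : ℝ ↦ orthonormalize x (p + t • (η ⟨x, p, s⟩).1) (s + t • (η ⟨x, p, s⟩).2)) 0 1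

/-- The volume density `|ω_B³|` on `Z` in the chart `φ` of `X` and the orthonormal frame `L` of `E`,
which identify `(y, p) ∈ ℝ⁴ × S²` with `(φ⁻¹ y, L p) ∈ Z`, relative to Lebesgue measure on `ℝ⁴`
times the area measure of `S²`: the absolute value of `ω_B³` on the standard basis of `ℝ⁴` and an
orthonormal basis `a, b` of the tangent plane of `S²` at `p`. -/
def density (B : ConnectionForms E) (φ : OpenPartialHomeomorph X E4)
    (L : ∀ x, E3 ≃ₗᵢ[ℝ] E x) (y : E4) (p : E3) : ℝ :=
  let ab : E3 × E3 := Classical.epsilon fun c ↦ ‖c.1‖ = 1 ∧ ‖c.2‖ = 1 ∧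
    inner ℝ p c.1 = 0 ∧ inner ℝ p c.2 = 0 ∧ inner ℝ c.1 c.2 = 0
  let ψ : E4 × E3 → FramePoint E := fun w ↦
    orthonormalize (φ.symm w.1) (L (φ.symm w.1) w.2) (L (φ.symm w.1) ab.1)
  |cube (curvatureForm B ψ (y, p))
    ![(EuclideanSpace.single 0 1, 0), (EuclideanSpace.single 1 1, 0),
      (EuclideanSpace.single 2 1, 0), (EuclideanSpace.single 3 1, 0), (0, ab.1), (0, ab.2)]|

/-- A finite family of charts of `X` with smooth orthonormal frames of `E` over their domains, and
a subordinate smooth partition of unity. -/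
structure TrivializingCover (E : X → Type*) [TopologicalSpace (TotalSpace E3 E)]
    [∀ x, NormedAddCommGroup (E x)] [∀ x, InnerProductSpace ℝ (E x)]
    [FiberBundle E3 E] [VectorBundle ℝ E3 E] where
  /-- the number of charts -/
  n : ℕ
  /-- the charts -/
  chart : Fin n → OpenPartialHomeomorph X E4
  chart_mem : ∀ i, chart i ∈ IsManifold.maximalAtlas (𝓡 4) ∞ X
  /-- the orthonormal frames -/
  frame : Fin n → ∀ x, E3 ≃ₗᵢ[ℝ] E x
  frame_smooth : ∀ i, IsSmoothFrame (frame i) (chart i).source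
  /-- the partition of unity -/
  rho : SmoothPartitionOfUnity (Fin n) (𝓡 4) X
  subordinate : rho.IsSubordinate fun i ↦ (chart i).source

open Classical in
/-- The integral `∫_Z f ω_B³` for the orientation of `Z` defined by `ω_B`, computed by means of a
partition of unity (it does not depend on the choices). -/
def integralZ (B : ConnectionForms E) (f : ∀ x, E x → ℝ) : ℝ :=
  if h : Nonempty (TrivializingCover E) then
    let C := h.some
    ∑ i, ∫ y in (C.chart i).target,
      ∫ p : Metric.sphere (0 : E3) 1,
        C.rho i ((C.chart i).symm y) *
          f ((C.chart i).symm y) (C.frame i ((C.chart i).symm y) p) *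
          density B (C.chart i) (C.frame i) y p
        ∂(MeasureTheory.volume : MeasureTheory.Measure E3).toSphere
  else 0

/-- The moment map `⟨m(B), η⟩ = (1 / 3!) ∫_Z B(η) ω_B³`, on infinitesimal bundle isometries `η` of
`V` which are tangent to the fibres over `X`. -/
def momentMap (B : ConnectionForms E) (η : FibreField E) : ℝ :=
  (1 / (Nat.factorial 3 : ℝ)) * integralZ B (pairing B η)

/-- The moment map `m_π` for the action of `Lie(𝒢_π)`: the functional on `Lie(𝒢_π)` obtained by
composing `m(B)` with the lift of `Lie(𝒢_π)` to infinitesimal bundle isometries of `V`. -/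
def momentMapPi (o : ∀ x, Orientation ℝ (E x) (Fin 3)) (B : ConnectionForms E) : LieGpi E → ℝ :=
  fun v ↦ momentMap B (lift o v)

end

end DefConn

/-!
The induced connection is symplectic because its curvature can be computed explicitly. In a local
orthonormal frame of `E` the curvature of `A` is a 2-form `β` with values in `ℝ³ ≅ so(3)`
(`exists_curvature_vector`), and at a point `p` of the sphere
`2π ω = (area form of the fibre on the vertical parts) - ⟪β, p⟫`
(`curvatureForm_inducedConnection`). Definiteness of `A` says exactly that all the 2-forms `⟪β, p⟫`
on the four-dimensional base are non-degenerate (`curvature_nondegenerate`), so `ω` is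
non-degenerate.

For the moment map, the value of `A_V` on the lift of a vector field `v` is the Hamiltonian `f_v`
(`pairing_lift`), since the horizontal lift for the Levi-Civita connection contributes nothing. The
formula for `ω` gives `ω³ = const · (area form) ∧ ⟪β, p⟫²` (`density_inducedConnection`). Hence the
contribution of the fibre over `x` to `⟨m_π(A_V), v⟩` is the integral over the unit sphere of
`f_v(p) |B_x(p, p)|`, where `B_x(a, b) = ⟪β, a⟫ ∧ ⟪β, b⟫` is a symmetric bilinear form on `ℝ³` with
values in the line of 4-forms (`curvWedge`); it is definite, because `⟪β, p⟫` is non-degenerate.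

If `A` is perfect, then `B_x` is a multiple of the inner product, so this is a constant times the
mean value of `f_v`, which vanishes (`momentMapPi_eq_zero_of_isPerfect`). Conversely, for a local
frame and a bump function `χ` the function `χ p₀ p₁` is the Hamiltonian of an explicit field
(`testField`), and the integral of `p₀ p₁ |B(p, p)|` over the sphere is a positive multiple of
`± B(e₀, e₁)`, where `±` is the sign of `B` (`integral_mul_abs_quadratic`). If the moment map
vanishes, concentrating `χ` near a point shows that `B_x(e₀, e₁) = 0`
(`compWedge_eq_zero_of_momentMapPi_eq_zero`). As every orthonormal pair of vectors of `E x` occurs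
as `e₀, e₁` in some frame, `B_x` vanishes on all orthogonal pairs, and is therefore a multiple of
the inner product: `A` is perfect (`isPerfect_of_momentMapPi_eq_zero`).
-/

namespace DefConn

set_option linter.unusedSectionVars false

/-! ### Alternating sums -/

/-- The signed sum of `Φ` over all orders of the vectors `v`. -/
noncomputable def altSum {T : Type*} {n : ℕ} (Φ : (Fin n → T) → ℝ) (v : Fin n → T) : ℝ :=
  ∑ σ : Equiv.Perm (Fin n), ((Equiv.Perm.sign σ : ℤ) : ℝ) * Φ (fun i ↦ v (σ i))

/-- Expansion of an alternating sum along its first argument: the vector `v i` comes first, and the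
remaining ones are those of `v` with `v 0` put in the place of `v i`. -/
theorem altSum_succ {T : Type*} {n : ℕ} (Φ : (Fin (n + 1) → T) → ℝ) (v : Fin (n + 1) → T) :
    altSum Φ v = ∑ i, (if i = 0 then 1 else -1) *
      altSum (fun w ↦ Φ (Fin.cons (v i) w)) (fun k ↦ v (Equiv.swap 0 i k.succ)) := by
  rw [altSum, ← Equiv.sum_comp Equiv.Perm.decomposeFin.symm, Fintype.sum_prod_type]
  refine Finset.sum_congr rfl fun i _ ↦ ?_
  rw [altSum, Finset.mul_sum]
  refine Finset.sum_congr rfl fun τ _ ↦ ?_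
  have h : (fun k ↦ v (Equiv.Perm.decomposeFin.symm (i, τ) k)) =
      Fin.cons (v i) (fun k ↦ v (Equiv.swap 0 i (τ k).succ)) := by
    funext k
    refine Fin.cases ?_ (fun k ↦ ?_) k
    · simp
    · simp [Equiv.Perm.decomposeFin_symm_apply_succ]
  rw [h, Equiv.Perm.decomposeFin.symm_sign]
  split_ifs <;> simp

theorem altSum_zero {T : Type*} (Φ : (Fin 0 → T) → ℝ) (v : Fin 0 → T) :
    altSum Φ v = Φ ![] := by
  simp [altSum, Subsingleton.elim _ ![]]

theorem altSum_const_mul {T : Type*} {n : ℕ} (c : ℝ) (Φ : (Fin n → T) → ℝ) (v : Fin n → T) :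
    altSum (fun w ↦ c * Φ w) v = c * altSum Φ v := by
  simp only [altSum, Finset.mul_sum]
  exact Finset.sum_congr rfl fun _ _ ↦ by ring

theorem altSum_two {T : Type*} (Φ : (Fin 2 → T) → ℝ) (v : Fin 2 → T) :
    altSum Φ v = Φ ![v 0, v 1] - Φ ![v 1, v 0] := by
  simp only [altSum_succ, Fin.sum_univ_succ, altSum_zero]
  have : Equiv.swap (0 : Fin 2) 1 1 = 0 := by decide
  simp [this]
  rfl

theorem altSum_three {T : Type*} (Φ : (Fin 3 → T) → ℝ) (a b c : T) :
    altSum Φ ![a, b, c] =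
      altSum (fun w ↦ Φ ![a, w 0, w 1]) ![b, c]
      - altSum (fun w ↦ Φ ![b, w 0, w 1]) ![a, c]
      - altSum (fun w ↦ Φ ![c, w 0, w 1]) ![b, a] := by
  have hc (x : T) (w : Fin 2 → T) : (Fin.cons x w : Fin 3 → T) = ![x, w 0, w 1] := by
    ext i; fin_cases i <;> rfl
  have h0 : (fun k : Fin 2 ↦ ![a, b, c] (Equiv.swap 0 0 k.succ)) = ![b, c] := by
    ext i; fin_cases i <;> rfl
  have h1 : (fun k : Fin 2 ↦ ![a, b, c] (Equiv.swap 0 1 k.succ)) = ![a, c] := by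
    ext i; fin_cases i <;> rfl
  have h2 : (fun k : Fin 2 ↦ ![a, b, c] (Equiv.swap 0 2 k.succ)) = ![b, a] := by
    ext i; fin_cases i <;> rfl
  rw [altSum_succ, Fin.sum_univ_three]
  simp only [h0, h1, h2, hc]
  simp
  ring

theorem altSum_four {T : Type*} (Φ : (Fin 4 → T) → ℝ) (a b c d : T) :
    altSum Φ ![a, b, c, d] =
      altSum (fun w ↦ Φ ![a, w 0, w 1, w 2]) ![b, c, d]
      - altSum (fun w ↦ Φ ![b, w 0, w 1, w 2]) ![a, c, d]
      - altSum (fun w ↦ Φ ![c, w 0, w 1, w 2]) ![b, a, d]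
      - altSum (fun w ↦ Φ ![d, w 0, w 1, w 2]) ![b, c, a] := by
  have hc (x : T) (w : Fin 3 → T) : (Fin.cons x w : Fin 4 → T) = ![x, w 0, w 1, w 2] := by
    ext i; fin_cases i <;> rfl
  have h0 : (fun k : Fin 3 ↦ ![a, b, c, d] (Equiv.swap 0 0 k.succ)) = ![b, c, d] := by
    ext i; fin_cases i <;> rfl
  have h1 : (fun k : Fin 3 ↦ ![a, b, c, d] (Equiv.swap 0 1 k.succ)) = ![a, c, d] := by
    ext i; fin_cases i <;> rfl
  have h2 : (fun k : Fin 3 ↦ ![a, b, c, d] (Equiv.swap 0 2 k.succ)) = ![b, a, d] := by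
    ext i; fin_cases i <;> rfl
  have h3 : (fun k : Fin 3 ↦ ![a, b, c, d] (Equiv.swap 0 3 k.succ)) = ![b, c, a] := by
    ext i; fin_cases i <;> rfl
  rw [altSum_succ, Fin.sum_univ_four]
  simp only [h0, h1, h2, h3, hc]
  simp
  ring

theorem altSum_five {T : Type*} (Φ : (Fin 5 → T) → ℝ) (a b c d e : T) :
    altSum Φ ![a, b, c, d, e] =
      altSum (fun w ↦ Φ ![a, w 0, w 1, w 2, w 3]) ![b, c, d, e]
      - altSum (fun w ↦ Φ ![b, w 0, w 1, w 2, w 3]) ![a, c, d, e]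
      - altSum (fun w ↦ Φ ![c, w 0, w 1, w 2, w 3]) ![b, a, d, e]
      - altSum (fun w ↦ Φ ![d, w 0, w 1, w 2, w 3]) ![b, c, a, e]
      - altSum (fun w ↦ Φ ![e, w 0, w 1, w 2, w 3]) ![b, c, d, a] := by
  have hc (x : T) (w : Fin 4 → T) : (Fin.cons x w : Fin 5 → T) = ![x, w 0, w 1, w 2, w 3] := by
    ext i; fin_cases i <;> rfl
  have h0 : (fun k : Fin 4 ↦ ![a, b, c, d, e] (Equiv.swap 0 0 k.succ)) = ![b, c, d, e] := by
    ext i; fin_cases i <;> rfl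
  have h1 : (fun k : Fin 4 ↦ ![a, b, c, d, e] (Equiv.swap 0 1 k.succ)) = ![a, c, d, e] := by
    ext i; fin_cases i <;> rfl
  have h2 : (fun k : Fin 4 ↦ ![a, b, c, d, e] (Equiv.swap 0 2 k.succ)) = ![b, a, d, e] := by
    ext i; fin_cases i <;> rfl
  have h3 : (fun k : Fin 4 ↦ ![a, b, c, d, e] (Equiv.swap 0 3 k.succ)) = ![b, c, a, e] := by
    ext i; fin_cases i <;> rfl
  have h4 : (fun k : Fin 4 ↦ ![a, b, c, d, e] (Equiv.swap 0 4 k.succ)) = ![b, c, d, a] := by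
    ext i; fin_cases i <;> rfl
  rw [altSum_succ, Fin.sum_univ_five]
  simp only [h0, h1, h2, h3, h4, hc]
  simp
  ring

theorem altSum_six {T : Type*} (Φ : (Fin 6 → T) → ℝ) (a b c d e f : T) :
    altSum Φ ![a, b, c, d, e, f] =
      altSum (fun w ↦ Φ ![a, w 0, w 1, w 2, w 3, w 4]) ![b, c, d, e, f]
      - altSum (fun w ↦ Φ ![b, w 0, w 1, w 2, w 3, w 4]) ![a, c, d, e, f]
      - altSum (fun w ↦ Φ ![c, w 0, w 1, w 2, w 3, w 4]) ![b, a, d, e, f]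
      - altSum (fun w ↦ Φ ![d, w 0, w 1, w 2, w 3, w 4]) ![b, c, a, e, f]
      - altSum (fun w ↦ Φ ![e, w 0, w 1, w 2, w 3, w 4]) ![b, c, d, a, f]
      - altSum (fun w ↦ Φ ![f, w 0, w 1, w 2, w 3, w 4]) ![b, c, d, e, a] := by
  have hc (x : T) (w : Fin 5 → T) : (Fin.cons x w : Fin 6 → T) = ![x, w 0, w 1, w 2, w 3, w 4] := by
    ext i; fin_cases i <;> rfl
  have h0 : (fun k : Fin 5 ↦ ![a, b, c, d, e, f] (Equiv.swap 0 0 k.succ)) = ![b, c, d, e, f] := by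
    ext i; fin_cases i <;> rfl
  have h1 : (fun k : Fin 5 ↦ ![a, b, c, d, e, f] (Equiv.swap 0 1 k.succ)) = ![a, c, d, e, f] := by
    ext i; fin_cases i <;> rfl
  have h2 : (fun k : Fin 5 ↦ ![a, b, c, d, e, f] (Equiv.swap 0 2 k.succ)) = ![b, a, d, e, f] := by
    ext i; fin_cases i <;> rfl
  have h3 : (fun k : Fin 5 ↦ ![a, b, c, d, e, f] (Equiv.swap 0 3 k.succ)) = ![b, c, a, e, f] := by
    ext i; fin_cases i <;> rfl
  have h4 : (fun k : Fin 5 ↦ ![a, b, c, d, e, f] (Equiv.swap 0 4 k.succ)) = ![b, c, d, a, f] := by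
    ext i; fin_cases i <;> rfl
  have h5 : (fun k : Fin 5 ↦ ![a, b, c, d, e, f] (Equiv.swap 0 5 k.succ)) = ![b, c, d, e, a] := by
    ext i; fin_cases i <;> rfl
  rw [altSum_succ, Fin.sum_univ_six]
  simp only [h0, h1, h2, h3, h4, h5, hc]
  simp
  ring

theorem wedge_eq {T : Type*} (α β : T → T → ℝ) (hα : ∀ u v, α u v = -α v u)
    (hβ : ∀ u v, β u v = -β v u) (a b c d : T) :
    wedge α β ![a, b, c, d] = α a b * β c d - α a c * β b d + α a d * β b c
      + α b c * β a d - α b d * β a c + α c d * β a b := by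
  have h : wedge α β ![a, b, c, d] =
      (1 / 4) * altSum (fun w ↦ α (w 0) (w 1) * β (w 2) (w 3)) ![a, b, c, d] := rfl
  rw [h]
  simp only [altSum_four, altSum_three, altSum_two, Matrix.cons_val]
  simp only [hα b a, hα c a, hα d a, hα c b, hα d b, hα d c,
    hβ b a, hβ c a, hβ d a, hβ c b, hβ d b, hβ d c]
  ring

/-- The 6-form `F³` is six times the sum over the fifteen perfect matchings of six vectors. -/
theorem cube_eq {T : Type*} (F : T → T → ℝ) (hF : ∀ u v, F u v = -F v u) (a b c d e f : T) :
    cube F ![a, b, c, d, e, f] =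
      6 * (F a b * F c d * F e f - F a b * F c e * F d f + F a b * F c f * F d e
        - F a c * F b d * F e f + F a c * F b e * F d f - F a c * F b f * F d e
        + F a d * F b c * F e f - F a d * F b e * F c f + F a d * F b f * F c e
        - F a e * F b c * F d f + F a e * F b d * F c f - F a e * F b f * F c d
        + F a f * F b c * F d e - F a f * F b d * F c e + F a f * F b e * F c d) := by
  have h : cube F ![a, b, c, d, e, f] = (1 / 8) * altSum
      (fun w ↦ F (w 0) (w 1) * F (w 2) (w 3) * F (w 4) (w 5)) ![a, b, c, d, e, f] := rfl
  have h4 (r : ℝ) (p q s t : T) : altSum (fun w : Fin 4 → T ↦ r * F (w 0) (w 1) * F (w 2) (w 3))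
      ![p, q, s, t] = r * (8 * (F p q * F s t - F p s * F q t + F p t * F q s)) := by
    have h' := wedge_eq F F hF hF p q s t
    have h'' : altSum (fun w : Fin 4 → T ↦ r * F (w 0) (w 1) * F (w 2) (w 3)) ![p, q, s, t] =
        r * (4 * wedge F F ![p, q, s, t]) := by
      simp only [mul_assoc]
      rw [altSum_const_mul]
      simp only [wedge, altSum]
      ring
    rw [h'', h']
    ring
  rw [h]
  simp only [altSum_six, altSum_five, Matrix.cons_val, h4]
  simp only [hF b a, hF c a, hF d a, hF e a, hF f a, hF c b, hF d b, hF e b, hF f b, hF d c,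
    hF e c, hF f c, hF e d, hF f d, hF f e]
  ring

/-! ### The cross product in coordinates -/

/-- The cross product of `ℝ³` in coordinates. -/
noncomputable def crossE (p s : E3) : E3 :=
  !₂[p 1 * s 2 - p 2 * s 1, p 2 * s 0 - p 0 * s 2, p 0 * s 1 - p 1 * s 0]

theorem inner_E3 (p s : E3) : inner ℝ p s = p 0 * s 0 + p 1 * s 1 + p 2 * s 2 := by
  simp [PiLp.inner_apply, Fin.sum_univ_three, mul_comm]

@[simp] theorem crossE_apply_zero (p s : E3) : crossE p s 0 = p 1 * s 2 - p 2 * s 1 := rfl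
@[simp] theorem crossE_apply_one (p s : E3) : crossE p s 1 = p 2 * s 0 - p 0 * s 2 := rfl
@[simp] theorem crossE_apply_two (p s : E3) : crossE p s 2 = p 0 * s 1 - p 1 * s 0 := rfl

theorem ext_E3 {p s : E3} (h0 : p 0 = s 0) (h1 : p 1 = s 1) (h2 : p 2 = s 2) : p = s := by
  ext i; fin_cases i <;> assumption

theorem inner_crossE_left (p s : E3) : inner ℝ (crossE p s) p = 0 := by
  simp [inner_E3]; ring

theorem inner_crossE_right (p s : E3) : inner ℝ (crossE p s) s = 0 := by
  simp [inner_E3]; ring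

theorem inner_crossE_crossE (a b c d : E3) : inner ℝ (crossE a b) (crossE c d) =
    inner ℝ a c * inner ℝ b d - inner ℝ a d * inner ℝ b c := by
  simp [inner_E3]; ring

theorem norm_crossE {p s : E3} (hp : ‖p‖ = 1) (hs : ‖s‖ = 1) (h : inner ℝ p s = 0) :
    ‖crossE p s‖ = 1 := by
  have := inner_crossE_crossE p s p s
  rw [real_inner_self_eq_norm_sq, real_inner_self_eq_norm_sq, real_inner_self_eq_norm_sq, hp, hs,
    h] at this
  nlinarith [norm_nonneg (crossE p s)]

/-- Parseval's identity in the orthonormal frame `p, s, p × s`. -/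
theorem inner_eq_of_orthonormal {p s : E3} (hp : ‖p‖ = 1) (hs : ‖s‖ = 1) (h : inner ℝ p s = 0)
    (x y : E3) : inner ℝ x y = inner ℝ x p * inner ℝ y p + inner ℝ x s * inner ℝ y s
      + inner ℝ x (crossE p s) * inner ℝ y (crossE p s) := by
  have hp' : p 0 * p 0 + p 1 * p 1 + p 2 * p 2 = 1 := by
    rw [← inner_E3, real_inner_self_eq_norm_sq, hp]; norm_num
  have hs' : s 0 * s 0 + s 1 * s 1 + s 2 * s 2 = 1 := by
    rw [← inner_E3, real_inner_self_eq_norm_sq, hs]; norm_num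
  have hq := norm_crossE hp hs h
  let v : Fin 3 → E3 := ![p, s, crossE p s]
  have hv : Orthonormal ℝ v := by
    rw [orthonormal_iff_ite]
    intro i j
    have e1 := inner_crossE_left p s
    have e2 := inner_crossE_right p s
    have e3 : inner ℝ p (crossE p s) = 0 := by rw [real_inner_comm]; exact e1
    have e4 : inner ℝ s (crossE p s) = 0 := by rw [real_inner_comm]; exact e2
    have h' : inner ℝ s p = 0 := by rw [real_inner_comm]; exact h
    fin_cases i <;> fin_cases j <;>
      simp [v, hp, hs, hq, h, h', e1, e2, e3, e4]
  let b : OrthonormalBasis (Fin 3) ℝ E3 := OrthonormalBasis.mk hv (by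
    rw [hv.linearIndependent.span_eq_top_of_card_eq_finrank' (by simp)])
  rw [← b.sum_inner_mul_inner x y, Fin.sum_univ_three]
  simp [b, v, real_inner_comm]

/-- An isometry `ℝ³ → T` intertwines the cross products up to the sign `ε` by which it changes
the orientation. -/
theorem exists_cross_sign {T : Type*} [NormedAddCommGroup T] [InnerProductSpace ℝ T]
    (h : Module.finrank ℝ T = 3) (o : Orientation ℝ T (Fin 3)) (L : E3 ≃ₗᵢ[ℝ] T) :
    ∃ ε : ℝ, ε * ε = 1 ∧
      (((EuclideanSpace.basisFun (Fin 3) ℝ).map L).toBasis.orientation = o → ε = 1) ∧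
      ∀ p s : E3, crossOf h o (L p) (L s) = ε • L (crossE p s) := by
  have : Fact (Module.finrank ℝ T = 3) := ⟨h⟩
  set b := (EuclideanSpace.basisFun (Fin 3) ℝ).map L with hb
  have hdet (p s t : E3) : b.toBasis.det ![L p, L s, L t] = inner ℝ (crossE p s) t := by
    rw [Module.Basis.det_apply, Matrix.det_fin_three]
    have e (i j : Fin 3) : b.toBasis.toMatrix ![L p, L s, L t] i j = (![p, s, t] j : E3) i := by
      rw [Module.Basis.toMatrix_apply]
      fin_cases j <;> simp [hb]
    simp only [e, inner_E3]
    simp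
    ring
  have key (ε : ℝ) (hε : ∀ v, o.volumeForm v = ε * b.toBasis.det v) (p s : E3) :
      crossOf h o (L p) (L s) = ε • L (crossE p s) := by
    refine ext_inner_right ℝ fun t ↦ ?_
    obtain ⟨t, rfl⟩ := L.surjective t
    rw [inner_crossOf, hε, hdet, inner_smul_left, L.inner_map_map]
    simp
  by_cases ho : b.toBasis.orientation = o
  · refine ⟨1, by norm_num, fun _ ↦ rfl, key 1 fun v ↦ ?_⟩
    rw [o.volumeForm_robust b ho, one_mul]
  · refine ⟨-1, by norm_num, fun h ↦ absurd h ho, key (-1) fun v ↦ ?_⟩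
    rw [o.volumeForm_robust_neg b ho]
    simp

/-- A skew endomorphism of `ℝ³` is the cross product with a vector. -/
theorem eq_crossE_of_skew (R : E3 →L[ℝ] E3) (hR : ∀ a b, inner ℝ (R a) b = -inner ℝ a (R b)) :
    ∃ f : E3, (∀ k : Fin 3, f k =
      inner ℝ (R (EuclideanSpace.single (k + 1) 1)) (EuclideanSpace.single (k + 2) 1)) ∧
      ∀ a, R a = crossE f a := by
  have hsum (a : E3) : a = a 0 • EuclideanSpace.single (0 : Fin 3) (1 : ℝ)
      + a 1 • EuclideanSpace.single (1 : Fin 3) (1 : ℝ)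
      + a 2 • EuclideanSpace.single (2 : Fin 3) (1 : ℝ) := by
    apply ext_E3 <;> simp
  have hent (i j : Fin 3) : R (EuclideanSpace.single i 1) j =
      -R (EuclideanSpace.single j 1) i := by
    have := hR (EuclideanSpace.single i 1) (EuclideanSpace.single j 1)
    simpa [EuclideanSpace.inner_single_left, EuclideanSpace.inner_single_right]
      using this
  refine ⟨WithLp.toLp 2 fun k ↦ inner ℝ (R (EuclideanSpace.single (k + 1) 1))
    (EuclideanSpace.single (k + 2) 1), fun k ↦ rfl, fun a ↦ ?_⟩
  have e00 : R (EuclideanSpace.single 0 1) 0 = 0 := by linarith [hent 0 0]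
  have e11 : R (EuclideanSpace.single 1 1) 1 = 0 := by linarith [hent 1 1]
  have e22 : R (EuclideanSpace.single 2 1) 2 = 0 := by linarith [hent 2 2]
  have t1 : (1 + 1 : Fin 3) = 2 := rfl
  have t2 : (2 + 1 : Fin 3) = 0 := rfl
  have t3 : (1 + 2 : Fin 3) = 0 := rfl
  have t4 : (2 + 2 : Fin 3) = 1 := rfl
  conv_lhs => rw [hsum a]
  apply ext_E3 <;> simp [EuclideanSpace.inner_single_right, t1, t2, t3, t4]
  · linear_combination a 0 * e00 + a 1 * hent 0 1
  · linear_combination a 1 * e11 + a 2 * hent 1 2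
  · linear_combination a 2 * e22 + a 0 * hent 2 0

/-! ### Exterior algebra of 2-forms -/

/-- The top power of `r (m ∧ n - B)` on six vectors of which the last two are annihilated by `B`: only
the terms with exactly one factor `m ∧ n` survive. -/
theorem cube_sub {T : Type*} (F B : T → T → ℝ) (m n : T → ℝ) (r : ℝ)
    (hF : ∀ u v, F u v = r * (m u * n v - m v * n u - B u v)) (hB : ∀ u v, B u v = -B v u)
    (a b c d e f : T) (he : ∀ u, B u e = 0) (hf : ∀ u, B u f = 0) :
    cube F ![a, b, c, d, e, f] = 3 * r ^ 3 * (m e * n f - m f * n e) * wedge B B ![a, b, c, d] := by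
  have hF' (u v) : F u v = -F v u := by rw [hF, hF, hB u v]; ring
  rw [cube_eq F hF', wedge_eq B B hB hB]
  simp only [hF, he, hf]
  ring

/-- The multilinear map whose alternatization is four times the wedge product. -/
noncomputable def wedgeAux {T : Type*} [AddCommGroup T] [Module ℝ T] (α β : T →ₗ[ℝ] T →ₗ[ℝ] ℝ) :
    MultilinearMap ℝ (fun _ : Fin 4 ↦ T) ℝ where
  toFun v := α (v 0) (v 1) * β (v 2) (v 3)
  map_update_add' {inst} v i x y := by
    obtain rfl := Subsingleton.elim inst (instDecidableEqFin 4)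
    fin_cases i <;> simp [Function.update] <;> ring
  map_update_smul' {inst} v i x y := by
    obtain rfl := Subsingleton.elim inst (instDecidableEqFin 4)
    fin_cases i <;> simp [Function.update] <;> ring

/-- In dimension four, `α ∧ β` is determined by its value on a basis. -/
theorem wedge_eq_det_mul {T : Type*} [AddCommGroup T] [Module ℝ T] (α β : T →ₗ[ℝ] T →ₗ[ℝ] ℝ)
    (b : Module.Basis (Fin 4) ℝ T) (t : Fin 4 → T) :
    wedge (fun u v ↦ α u v) (fun u v ↦ β u v) t =
      b.det t * wedge (fun u v ↦ α u v) (fun u v ↦ β u v) b := by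
  have h (t : Fin 4 → T) : wedge (fun u v ↦ α u v) (fun u v ↦ β u v) t =
      (1 / 4) * MultilinearMap.alternatization (wedgeAux α β) t := by
    simp only [wedge, MultilinearMap.alternatization_apply, MultilinearMap.domDomCongr_apply]
    congr 1
    refine Finset.sum_congr rfl fun σ _ ↦ ?_
    simp [wedgeAux, Units.smul_def]
  rw [h, h]
  conv_lhs => rw [AlternatingMap.eq_smul_basis_det b
    (MultilinearMap.alternatization (wedgeAux α β))]
  simp
  ring

/-- A 2-form on a four-dimensional space with vanishing square is degenerate. -/
theorem exists_ne_zero_of_wedge_self_eq_zero {T : Type*} [AddCommGroup T] [Module ℝ T]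
    (β : T →ₗ[ℝ] T →ₗ[ℝ] ℝ) (hβ : ∀ u v, β u v = -β v u) (b : Module.Basis (Fin 4) ℝ T)
    (h : wedge (fun u v ↦ β u v) (fun u v ↦ β u v) b = 0) :
    ∃ u ≠ 0, ∀ v, β u v = 0 := by
  have hb : (b : Fin 4 → T) = ![b 0, b 1, b 2, b 3] := by
    ext i; fin_cases i <;> rfl
  rw [hb, wedge_eq _ _ hβ hβ] at h
  have hd (i : Fin 4) : β (b i) (b i) = 0 := by linarith [hβ (b i) (b i)]
  -- the Pfaffian of the Gram matrix is half the square of the form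
  have hdet : (Matrix.of fun i j ↦ β (b i) (b j)).det = 0 := by
    simp only [Matrix.det_succ_row_zero, Fin.sum_univ_succ]
    simp [Fin.succAbove, hd]
    rw [hβ (b 1) (b 0), hβ (b 2) (b 0), hβ (b 3) (b 0), hβ (b 2) (b 1), hβ (b 3) (b 1),
      hβ (b 3) (b 2)]
    linear_combination (1 / 4) * (2 * (β (b 0) (b 1) * β (b 2) (b 3) - β (b 0) (b 2) * β (b 1) (b 3)
      + β (b 0) (b 3) * β (b 1) (b 2))) * h
  obtain ⟨v, hv0, hv⟩ := Matrix.exists_vecMul_eq_zero_iff.mpr hdet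
  refine ⟨∑ i, v i • b i, ?_, ?_⟩
  · intro h0
    apply hv0
    funext i
    exact Fintype.linearIndependent_iff.mp b.linearIndependent v h0 i
  · have key (j : Fin 4) : β (∑ i, v i • b i) (b j) = 0 := by
      have := congrFun hv j
      simpa [Matrix.vecMul, dotProduct] using this
    intro w
    have : β (∑ i, v i • b i) = 0 := b.ext fun j ↦ by simpa using key j
    simp [this]

/-- A bilinear form whose off-diagonal entries vanish in all orthonormal frames is a
multiple of the inner product. -/
theorem eq_mul_inner_of_orthonormal (B : E3 →ₗ[ℝ] E3 →ₗ[ℝ] ℝ)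
    (h : ∀ a b : E3, ‖a‖ = 1 → ‖b‖ = 1 → inner ℝ a b = 0 → B a b = 0) (x y : E3) :
    B x y = (1 / 3) * (∑ k : Fin 3, B (EuclideanSpace.single k 1) (EuclideanSpace.single k 1))
      * inner ℝ x y := by
  have hne (i j : Fin 3) (hij : i ≠ j) :
      B (EuclideanSpace.single i 1) (EuclideanSpace.single j 1) = 0 :=
    h _ _ (by simp) (by simp) (by simp [EuclideanSpace.inner_single_left, hij])
  have heq (i j : Fin 3) : B (EuclideanSpace.single i 1) (EuclideanSpace.single i 1) =
      B (EuclideanSpace.single j 1) (EuclideanSpace.single j 1) := by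
    rcases eq_or_ne i j with rfl | hij
    · rfl
    -- compare with the frame rotated by 45 degrees
    set e : E3 := EuclideanSpace.single i 1
    set f : E3 := EuclideanSpace.single j 1
    have he : inner ℝ e e = (1 : ℝ) := by simp [e]
    have hf : inner ℝ f f = (1 : ℝ) := by simp [f]
    have hef : inner ℝ e f = (0 : ℝ) := by simp [e, f, EuclideanSpace.inner_single_left, hij]
    have hfe : inner ℝ f e = (0 : ℝ) := by rw [real_inner_comm]; exact hef
    have hs : (√2)⁻¹ * (√2)⁻¹ = (1 / 2 : ℝ) := by
      rw [← mul_inv, Real.mul_self_sqrt (by norm_num)]; norm_num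
    have hn (z : E3) (hz : inner ℝ z z = (1 : ℝ)) : ‖z‖ = 1 := by
      rw [real_inner_self_eq_norm_sq] at hz
      nlinarith [norm_nonneg z]
    have := h ((√2)⁻¹ • (e + f)) ((√2)⁻¹ • (e - f))
      (hn _ (by
        simp only [inner_smul_left, inner_smul_right, inner_add_left, inner_add_right, he, hf, hef,
          hfe, conj_trivial]
        linear_combination 2 * hs))
      (hn _ (by
        simp only [inner_smul_left, inner_smul_right, inner_sub_left, inner_sub_right, he, hf, hef,
          hfe, conj_trivial]
        linear_combination 2 * hs))
      (by
        simp only [inner_smul_left, inner_smul_right, inner_add_left, inner_sub_right, he, hf, hef,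
          hfe, conj_trivial]
        ring)
    simp only [map_smul, map_add, map_sub, LinearMap.smul_apply, LinearMap.add_apply,
      smul_eq_mul, hne i j hij, hne j i hij.symm, e, f] at this
    have h2 : ((√2)⁻¹ * (√2)⁻¹) * (B e e - B f f) = 0 := by
      linear_combination this
    rw [hs] at h2
    linarith
  have hsum (a : E3) : a = a 0 • EuclideanSpace.single (0 : Fin 3) (1 : ℝ)
      + a 1 • EuclideanSpace.single (1 : Fin 3) (1 : ℝ)
      + a 2 • EuclideanSpace.single (2 : Fin 3) (1 : ℝ) := by
    apply ext_E3 <;> simp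
  rw [inner_E3, Fin.sum_univ_three]
  conv_lhs => rw [hsum x, hsum y]
  simp only [map_smul, map_add, LinearMap.smul_apply, LinearMap.add_apply, smul_eq_mul,
    hne 0 1 (by decide), hne 0 2 (by decide), hne 1 2 (by decide), hne 1 0 (by decide),
    hne 2 0 (by decide), hne 2 1 (by decide), heq 1 0, heq 2 0]
  ring

/-! ### Local orthonormal frames -/

section Frame

open Filter Topology

variable {X : Type*} [TopologicalSpace X] [ChartedSpace E4 X] [IsManifold (𝓡 4) ∞ X]
  {E : X → Type*} [TopologicalSpace (TotalSpace E3 E)]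
  [∀ x, NormedAddCommGroup (E x)] [∀ x, InnerProductSpace ℝ (E x)]
  [FiberBundle E3 E] [VectorBundle ℝ E3 E]
  [ContMDiffVectorBundle ∞ E3 E (𝓡 4)] [IsContMDiffRiemannianBundle (𝓡 4) ∞ E3 E]
  {L : ∀ x, E3 ≃ₗᵢ[ℝ] E x} {U : Set X}

theorem sum_smul_single (u : E3) :
    ∑ j, u j • (EuclideanSpace.single j (1 : ℝ) : E3) = u := by
  apply ext_E3 <;> simp [Fin.sum_univ_three]

theorem map_eq_sum_single {F : Type*} [AddCommGroup F] [Module ℝ F] (T : E3 →ₗ[ℝ] F) (u : E3) :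
    T u = ∑ j, u j • T (EuclideanSpace.single j (1 : ℝ)) := by
  conv_lhs => rw [← sum_smul_single u]
  simp

theorem IsSmoothFrame.contMDiffAt (hL : IsSmoothFrame L U) (hU : IsOpen U) {x : X} (hx : x ∈ U)
    (u : E3) : ContMDiffAt (𝓡 4) ((𝓡 4).prod 𝓘(ℝ, E3)) ∞
      (fun y ↦ (⟨y, L y u⟩ : TotalSpace E3 E)) x :=
  (hL u).contMDiffAt (hU.mem_nhds hx)

theorem IsSmoothFrame.mdifferentiableAt (hL : IsSmoothFrame L U) (hU : IsOpen U) {x : X}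
    (hx : x ∈ U) (u : E3) : MDifferentiableAt (𝓡 4) ((𝓡 4).prod 𝓘(ℝ, E3))
      (fun y ↦ (⟨y, L y u⟩ : TotalSpace E3 E)) x :=
  (hL.contMDiffAt hU hx u).mdifferentiableAt (by simp)

section Manifold

variable {EM : Type*} [NormedAddCommGroup EM] [NormedSpace ℝ EM] {HM : Type*} [TopologicalSpace HM]
  {IM : ModelWithCorners ℝ EM HM} {M : Type*} [TopologicalSpace M] [ChartedSpace HM M]

theorem contMDiffAt_fun_smul {F : Type*} [NormedAddCommGroup F] [NormedSpace ℝ F] {r : M → ℝ}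
    {g : M → F} {m : M} (hr : ContMDiffAt IM 𝓘(ℝ, ℝ) ∞ r m) (hg : ContMDiffAt IM 𝓘(ℝ, F) ∞ g m) :
    ContMDiffAt IM 𝓘(ℝ, F) ∞ (fun y ↦ r y • g y) m :=
  hr.smul hg

theorem IsSmoothFrame.trivialization_comp (hL : IsSmoothFrame L U) (hU : IsOpen U) {f : M → X}
    {m : M} (hf : ContMDiffAt IM (𝓡 4) ∞ f m) (hm : f m ∈ U) (u : E3) (x₀ : X)
    (hx₀ : f m ∈ (trivializationAt E3 E x₀).baseSet) :
    ContMDiffAt IM 𝓘(ℝ, E3) ∞ (fun y ↦ (trivializationAt E3 E x₀ ⟨f y, L (f y) u⟩).2) m := by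
  have h1 := (hL.contMDiffAt hU hm u)
  rw [(trivializationAt E3 E x₀).contMDiffAt_section_iff hx₀] at h1
  exact h1.comp m hf

/-- A family of vectors with smooth components in a smooth frame is smooth. -/
theorem IsSmoothFrame.contMDiffAt_comp (hL : IsSmoothFrame L U) (hU : IsOpen U) {f : M → X}
    {σ : M → E3} {m : M} (hf : ContMDiffAt IM (𝓡 4) ∞ f m) (hm : f m ∈ U)
    (hσ : ContMDiffAt IM 𝓘(ℝ, E3) ∞ σ m) :
    ContMDiffAt IM ((𝓡 4).prod 𝓘(ℝ, E3)) ∞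
      (fun y ↦ (⟨f y, L (f y) (σ y)⟩ : TotalSpace E3 E)) m := by
  rw [contMDiffAt_totalSpace]
  refine ⟨hf, ?_⟩
  have hb : ∀ᶠ y in 𝓝 m, f y ∈ (trivializationAt E3 E (f m)).baseSet :=
    hf.continuousAt.eventually ((trivializationAt E3 E (f m)).open_baseSet.mem_nhds
      (FiberBundle.mem_baseSet_trivializationAt' (f m)))
  have hs : ContMDiffAt IM 𝓘(ℝ, E3) ∞ (fun y ↦ ∑ j, σ y j •
      (trivializationAt E3 E (f m) ⟨f y, L (f y) (EuclideanSpace.single j 1)⟩).2) m := by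
    refine ContMDiffAt.sum fun j _ ↦ contMDiffAt_fun_smul ?_ ?_
    · exact ((EuclideanSpace.proj j : E3 →L[ℝ] ℝ).contDiff.contMDiff.contMDiffAt).comp m hσ
    · exact hL.trivialization_comp hU hf hm _ _ (FiberBundle.mem_baseSet_trivializationAt' (f m))
  refine hs.congr_of_eventuallyEq ?_
  filter_upwards [hb] with y hy
  have := map_eq_sum_single (((trivializationAt E3 E (f m)).linearMapAt ℝ (f y)) ∘ₗ
    (L (f y)).toLinearEquiv.toLinearMap) (σ y)
  simpa [Trivialization.linearMapAt_apply, hy] using this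

/-- The components of a smooth family of vectors in a smooth frame are smooth. -/
theorem IsSmoothFrame.contMDiffAt_symm (hL : IsSmoothFrame L U) (hU : IsOpen U)
    {f : M → X} {s : ∀ m, E (f m)} {m : M} (hm : f m ∈ U)
    (hs : ContMDiffAt IM ((𝓡 4).prod 𝓘(ℝ, E3)) ∞ (fun y ↦ (⟨f y, s y⟩ : TotalSpace E3 E)) m) :
    ContMDiffAt IM 𝓘(ℝ, E3) ∞ (fun y ↦ (L (f y)).symm (s y)) m := by
  have hf : ContMDiffAt IM (𝓡 4) ∞ f m := (contMDiffAt_totalSpace.mp hs).1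
  have hs' : ContMDiffAt IM 𝓘(ℝ, E3) ∞ (fun y ↦ ∑ j,
      (inner ℝ (L (f y) (EuclideanSpace.single j 1)) (s y) : ℝ) •
        (EuclideanSpace.single j (1 : ℝ) : E3)) m := by
    refine ContMDiffAt.sum fun j _ ↦ contMDiffAt_fun_smul ?_ contMDiffAt_const
    exact ContMDiffAt.inner_bundle (b := f) ((hL.contMDiffAt hU hm _).comp m hf) hs
  refine hs'.congr_of_eventuallyEq (Eventually.of_forall fun y ↦ ?_)
  simp only
  rw [← sum_smul_single ((L (f y)).symm (s y))]
  refine Finset.sum_congr rfl fun j _ ↦ ?_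
  congr 1
  rw [LinearIsometryEquiv.inner_map_eq_flip, EuclideanSpace.inner_single_left]
  simp

end Manifold

/-- The connection matrix of `A` in the frame `L`: the endomorphism of `ℝ³` with columns
`L⁻¹ (∇ᵥ Lⱼ)`. -/
noncomputable def connMat (A : CovariantDerivative (𝓡 4) E3 E) (L : ∀ x, E3 ≃ₗᵢ[ℝ] E x) (x : X) :
    TangentSpace (𝓡 4) x →L[ℝ] E3 →L[ℝ] E3 :=
  ∑ j, (ContinuousLinearMap.smulRightL ℝ E3 E3 (EuclideanSpace.proj j)).comp
    (((L x).symm.toContinuousLinearEquiv : E x →L[ℝ] E3).comp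
      (A (fun y ↦ L y (EuclideanSpace.single j 1)) x))

theorem connMat_apply (A : CovariantDerivative (𝓡 4) E3 E) (x : X) (v : TangentSpace (𝓡 4) x)
    (u : E3) : L x (connMat A L x v u) =
      ∑ j, u j • A (fun y ↦ L y (EuclideanSpace.single j 1)) x v := by
  simp [connMat]

/-- In a smooth frame the covariant derivative is `d` plus the connection matrix. -/
theorem IsSmoothFrame.covariantDerivative_eq (A : CovariantDerivative (𝓡 4) E3 E)
    (hL : IsSmoothFrame L U) (hU : IsOpen U) {x : X} (hx : x ∈ U) {τ : X → E3}
    (hτ : MDifferentiableAt (𝓡 4) 𝓘(ℝ, E3) τ x) {S : ∀ y, E y}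
    (hS : ∀ᶠ y in 𝓝 x, S y = L y (τ y)) (v : TangentSpace (𝓡 4) x) :
    A S x v = L x (mvfderiv (𝓡 4) τ x v + connMat A L x v (τ x)) := by
  have hA := A.isCovariantDerivativeOnUniv
  let e (j : Fin 3) : ∀ y, E y := fun y ↦ L y (EuclideanSpace.single j 1)
  have he (j) : MDifferentiableAt (𝓡 4) ((𝓡 4).prod 𝓘(ℝ, E3))
      (fun y ↦ (⟨y, e j y⟩ : TotalSpace E3 E)) x := hL.mdifferentiableAt hU hx _
  let t (j : Fin 3) : X → ℝ := fun y ↦ τ y j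
  have ht (j) : HasMFDerivAt (𝓡 4) 𝓘(ℝ, ℝ) (t j) x
      ((EuclideanSpace.proj j : E3 →L[ℝ] ℝ).comp (mvfderiv (𝓡 4) τ x)) :=
    ((EuclideanSpace.proj j : E3 →L[ℝ] ℝ).hasMFDerivAt (x := τ x)).comp x hτ.hasMFDerivAt
  have hte (j) : MDifferentiableAt (𝓡 4) ((𝓡 4).prod 𝓘(ℝ, E3))
      (fun y ↦ (⟨y, (t j • e j) y⟩ : TotalSpace E3 E)) x :=
    (ht j).mdifferentiableAt.smul_section (he j)
  have h01 := mdifferentiableAt_add_section (hte 0) (hte 1)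
  have h012 := mdifferentiableAt_add_section h01 (hte 2)
  have hS' : ∀ᶠ y in 𝓝 x, (t 0 • e 0 + t 1 • e 1 + t 2 • e 2) y = S y := by
    filter_upwards [hS] with y hy
    rw [hy]
    have := map_eq_sum_single (L y).toLinearEquiv.toLinearMap (τ y)
    rw [Fin.sum_univ_three] at this
    exact this.symm
  have hSd : MDifferentiableAt (𝓡 4) ((𝓡 4).prod 𝓘(ℝ, E3))
      (fun y ↦ (⟨y, S y⟩ : TotalSpace E3 E)) x :=
    h012.congr_of_eventuallyEq (hS'.mono fun y hy ↦
      congrArg (fun z ↦ (⟨y, z⟩ : TotalSpace E3 E)) hy.symm)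
  rw [← hA.congr_of_eventuallyEq h012 hSd univ_mem hS', hA.add h01 (hte 2),
    hA.add (hte 0) (hte 1), hA.leibniz (he 0) (ht 0).mdifferentiableAt,
    hA.leibniz (he 1) (ht 1).mdifferentiableAt, hA.leibniz (he 2) (ht 2).mdifferentiableAt,
    map_add, connMat_apply]
  have hd (j) : mvfderiv (𝓡 4) (t j) x v = mvfderiv (𝓡 4) τ x v j := by
    simp only [mvfderiv, (ht j).mfderiv]
    rfl
  have h3 := map_eq_sum_single (L x).toLinearEquiv.toLinearMap (mvfderiv (𝓡 4) τ x v)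
  rw [Fin.sum_univ_three] at h3
  have h3' : L x (mvfderiv (𝓡 4) τ x v) = _ := h3
  rw [h3', Fin.sum_univ_three]
  simp only [add_apply, smul_apply,
    ContinuousLinearMap.smulRight_apply, hd]
  change _ = mvfderiv (𝓡 4) τ x v 0 • e 0 x + mvfderiv (𝓡 4) τ x v 1 • e 1 x
    + mvfderiv (𝓡 4) τ x v 2 • e 2 x + (t 0 x • A (e 0) x v + t 1 x • A (e 1) x v
    + t 2 x • A (e 2) x v)
  abel

/-- The connection matrix of a metric connection is skew. -/
theorem IsSmoothFrame.inner_connMat (A : CovariantDerivative (𝓡 4) E3 E) (hA : A.IsMetricCompatible)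
    (hL : IsSmoothFrame L U) (hU : IsOpen U) {x : X} (hx : x ∈ U) (v : TangentSpace (𝓡 4) x)
    (a b : E3) : inner ℝ (connMat A L x v a) b = -inner ℝ a (connMat A L x v b) := by
  have h (a : E3) : A (fun y ↦ L y a) x v = L x (connMat A L x v a) := by
    rw [hL.covariantDerivative_eq A hU hx (τ := fun _ ↦ a) mdifferentiableAt_const
      (Eventually.of_forall fun _ ↦ rfl), mvfderiv_const]
    simp
  have := hA.mvfderiv_inner_eq (fun y ↦ FiberBundle.extend E4 v y) (hL.mdifferentiableAt hU hx a)
    (hL.mdifferentiableAt hU hx b)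
  simp only [FiberBundle.extend_apply_self, h, LinearIsometryEquiv.inner_map_map] at this
  rw [mvfderiv_const, zero_apply] at this
  linarith

/-- The covariant derivative along a map, in a smooth frame. -/
theorem IsSmoothFrame.covAlong_eq (A : CovariantDerivative (𝓡 4) E3 E)
    (hL : IsSmoothFrame L U) (hU : IsOpen U) {W : Type*} [NormedAddCommGroup W] [NormedSpace ℝ W]
    {f : W → X} {s : ∀ w, E (f w)} {w : W} (hw : f w ∈ U)
    (hf : MDifferentiableAt 𝓘(ℝ, W) (𝓡 4) f w)
    (hs : DifferentiableAt ℝ (fun w' ↦ (L (f w')).symm (s w')) w) (u : W) :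
    covAlong A (fun w' ↦ (⟨f w', s w'⟩ : TotalSpace E3 E)) w u =
      L (f w) (fderiv ℝ (fun w' ↦ (L (f w')).symm (s w')) w u
        + connMat A L (f w) (mfderiv 𝓘(ℝ, W) (𝓡 4) f w u) ((L (f w)).symm (s w))) := by
  set x := f w with hx
  set e := trivializationAt E3 E x with he
  have hxe : x ∈ e.baseSet := FiberBundle.mem_baseSet_trivializationAt' x
  set σ : W → E3 := fun w' ↦ (L (f w')).symm (s w') with hσ
  let g (j : Fin 3) : X → E3 := fun y ↦ (e ⟨y, L y (EuclideanSpace.single j 1)⟩).2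
  have hg (j) : MDifferentiableAt (𝓡 4) 𝓘(ℝ, E3) (g j) x :=
    (hL.trivialization_comp hU (f := id) contMDiffAt_id hw _ x hxe).mdifferentiableAt (by simp)
  -- the trivialization in the frame
  have hexp (y : X) (hy : y ∈ e.baseSet) (t : E y) :
      (e ⟨y, t⟩).2 = ∑ j, (L y).symm t j • g j y := by
    have := map_eq_sum_single ((e.linearMapAt ℝ y) ∘ₗ (L y).toLinearEquiv.toLinearMap)
      ((L y).symm t)
    simpa [Trivialization.linearMapAt_apply, hy, g] using this
  let dx : W →L[ℝ] TangentSpace (𝓡 4) x := mfderiv 𝓘(ℝ, W) (𝓡 4) f w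
  let dg (j : Fin 3) : TangentSpace (𝓡 4) x →L[ℝ] E3 := mvfderiv (𝓡 4) (g j) x
  have hgf (j) : HasFDerivAt (fun w' ↦ g j (f w')) ((dg j).comp dx) w :=
    ((hg j).hasMFDerivAt.comp w hf.hasMFDerivAt).hasFDerivAt
  have hσj (j : Fin 3) : HasFDerivAt (fun w' ↦ σ w' j)
      ((EuclideanSpace.proj j : E3 →L[ℝ] ℝ).comp (fderiv ℝ σ w)) w :=
    (EuclideanSpace.proj j : E3 →L[ℝ] ℝ).hasFDerivAt.comp w hs.hasFDerivAt
  have hD : fderiv ℝ (fun w' ↦ (e ⟨f w', s w'⟩).2) w u =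
      ∑ j, (σ w j • dg j (dx u) + fderiv ℝ σ w u j • g j x) := by
    have h1 : HasFDerivAt (fun w' ↦ ∑ j, σ w' j • g j (f w'))
      (∑ j, (σ w j • ((dg j).comp dx) +
        ((EuclideanSpace.proj j : E3 →L[ℝ] ℝ).comp (fderiv ℝ σ w)).smulRight (g j x))) w :=
      HasFDerivAt.fun_sum fun j _ ↦ (hσj j).smul (hgf j)
    have h2 : (fun w' ↦ (e ⟨f w', s w'⟩).2) =ᶠ[𝓝 w] fun w' ↦ ∑ j, σ w' j • g j (f w') := by
      filter_upwards [hf.continuousAt.eventually (e.open_baseSet.mem_nhds hxe)] with w' hw'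
      exact hexp _ hw' _
    rw [(h1.congr_of_eventuallyEq h2).fderiv]
    simp
  -- the canonical extension has constant components in the trivialization
  set S : ∀ y, E y := FiberBundle.extend E3 (s w) with hS
  let τ : X → E3 := fun y ↦ (L y).symm (S y)
  have hτ : MDifferentiableAt (𝓡 4) 𝓘(ℝ, E3) τ x :=
    (hL.contMDiffAt_symm hU (f := id) (s := S) hw
      (FiberBundle.contMDiffAt_extend (𝓡 4) E3 (s w))).mdifferentiableAt (by simp)
  have hτx : τ x = σ w := by
    simp only [τ, hS, hσ]
    rw [FiberBundle.extend_apply_self]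
  have hτj (j : Fin 3) : HasMFDerivAt (𝓡 4) 𝓘(ℝ, ℝ) (fun y ↦ τ y j) x
      ((EuclideanSpace.proj j : E3 →L[ℝ] ℝ).comp (mvfderiv (𝓡 4) τ x)) :=
    ((EuclideanSpace.proj j : E3 →L[ℝ] ℝ).hasMFDerivAt (x := τ x)).comp x hτ.hasMFDerivAt
  have hconst (v : TangentSpace (𝓡 4) x) : ∑ j, (τ x j • dg j v +
      (mvfderiv (𝓡 4) τ x v j) • g j x) = 0 := by
    have h1 : mvfderiv (𝓡 4) (fun y ↦ ∑ j, τ y j • g j y) x = 0 := by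
      have : (fun y ↦ ∑ j, τ y j • g j y) =ᶠ[𝓝 x] fun _ ↦ (e ⟨x, s w⟩).2 := by
        filter_upwards [e.open_baseSet.mem_nhds hxe] with y hy
        rw [← hexp y hy (S y)]
        simp only [hS, FiberBundle.extend]
        rw [← he, e.apply_mk_symm hy]
      rw [mvfderiv, this.mfderiv_eq, mfderiv_const]
      exact ContinuousLinearMap.comp_zero _
    have h2 : mvfderiv (𝓡 4) (fun y ↦ ∑ j, τ y j • g j y) x v = ∑ j, (τ x j • dg j v +
        (mvfderiv (𝓡 4) τ x v j) • g j x) := by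
      have hm (j) : MDifferentiableAt (𝓡 4) 𝓘(ℝ, E3) (fun y ↦ τ y j • g j y) x :=
        (hτj j).mdifferentiableAt.smul (hg j)
      have hm' : MDifferentiableAt (𝓡 4) 𝓘(ℝ, E3) (fun y ↦ τ y 0 • g 0 y + τ y 1 • g 1 y) x :=
        (hm 0).add (hm 1)
      have hd (j) : mvfderiv (𝓡 4) (fun y ↦ τ y j) x v = mvfderiv (𝓡 4) τ x v j := by
        simp only [mvfderiv, (hτj j).mfderiv]
        rfl
      have hp (j) : mvfderiv (𝓡 4) (fun y ↦ τ y j • g j y) x v =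
          τ x j • dg j v + (mvfderiv (𝓡 4) τ x v j) • g j x := by
        rw [mvfderiv_fun_smul (hτj j).mdifferentiableAt (hg j), ← hd j]
        rfl
      simp only [Fin.sum_univ_three]
      rw [mvfderiv_fun_add hm' (hm 2), mvfderiv_fun_add (hm 0) (hm 1), ← hp, ← hp, ← hp]
      rfl
    rw [← h2, h1]
    rfl
  have hA : A S x (dx u) = L x (mvfderiv (𝓡 4) τ x (dx u) + connMat A L x (dx u) (τ x)) :=
    hL.covariantDerivative_eq A hU hw hτ (S := S) (Eventually.of_forall fun y ↦ by simp [τ]) (dx u)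
  have hc : covAlong A (fun w' ↦ (⟨f w', s w'⟩ : TotalSpace E3 E)) w u =
      e.symmL ℝ x (fderiv ℝ (fun w' ↦ (e ⟨f w', s w'⟩).2) w u) + A S x (dx u) := rfl
  have hgx (j) : e.symmL ℝ x (g j x) = L x (EuclideanSpace.single j 1) := by
    rw [e.symmL_apply hxe]
    exact e.symm_apply_apply_mk hxe _
  have h0 := congrArg (e.symmL ℝ x) (hconst (dx u))
  have hL3 (a : E3) : L x a = ∑ j, a j • L x (EuclideanSpace.single j 1) :=
    map_eq_sum_single (L x).toLinearEquiv.toLinearMap a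
  change _ = L x (fderiv ℝ σ w u + connMat A L x (dx u) (σ w))
  rw [hc, hA, hD, hτx, map_add (L x), map_add (L x), hL3 (fderiv ℝ σ w u),
    hL3 (mvfderiv (𝓡 4) τ x (dx u))]
  simp only [map_sum, map_add, map_smul, map_zero, hgx, hτx, Finset.sum_add_distrib] at h0 ⊢
  rw [← sub_eq_zero, ← h0]
  abel

/-! ### Smoothness of the connection matrix -/

section T2

variable [T2Space X]

/-- The covariant derivatives of the vectors of a local frame are smooth: the frame is cut off to a
global section with the same germ. -/
theorem IsSmoothFrame.contMDiffAt_covariantDerivative (A : CovariantDerivative (𝓡 4) E3 E)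
    [A.ContMDiffCovariantDerivative ∞] (hL : IsSmoothFrame L U) (hU : IsOpen U) {x : X}
    (hx : x ∈ U) (u : E3) :
    ContMDiffAt (𝓡 4) ((𝓡 4).prod 𝓘(ℝ, E4 →L[ℝ] E3)) ∞
      (fun y ↦ (⟨y, A (fun y ↦ L y u) y⟩ :
        TotalSpace (E4 →L[ℝ] E3) fun y ↦ TangentSpace (𝓡 4) y →L[ℝ] E y)) x := by
  obtain ⟨f, -, hf⟩ := (SmoothBumpFunction.nhds_basis_tsupport (I := 𝓡 4) x).mem_iff.mp
    (hU.mem_nhds hx)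
  have hS : ContMDiff (𝓡 4) ((𝓡 4).prod 𝓘(ℝ, E3)) ∞
      (fun y ↦ (⟨y, ((f : X → ℝ) • fun y ↦ L y u) y⟩ : TotalSpace E3 E)) :=
    ContMDiffOn.smul_section_of_tsupport f.contMDiff.contMDiffOn hU hf (hL u)
  have hA := (CovariantDerivative.ContMDiffCovariantDerivative.contMDiff (cov := A)
    (k := ∞)).contMDiff
    (σ := (f : X → ℝ) • fun y ↦ L y u) (by simpa using hS.contMDiffOn)
  refine (hA.contMDiffAt univ_mem).congr_of_eventuallyEq ?_
  filter_upwards [eventually_eventually_nhds.mpr f.eventuallyEq_one, hU.mem_nhds hx] with y hy hyU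
  refine congrArg (fun z ↦ (⟨y, z⟩ :
        TotalSpace (E4 →L[ℝ] E3) fun y ↦ TangentSpace (𝓡 4) y →L[ℝ] E y)) ?_
  refine A.isCovariantDerivativeOnUniv.congr_of_eventuallyEq (hL.mdifferentiableAt hU hyU u)
    (hS.mdifferentiable (by simp) y) univ_mem ?_
  filter_upwards [hy] with z hz
  simp [hz]

/-- The pull-back along `f : W → X` of the matrix of connection forms of `A` in the frame `L`. -/
noncomputable def pullMat (A : CovariantDerivative (𝓡 4) E3 E) (L : ∀ x, E3 ≃ₗᵢ[ℝ] E x)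
    {W : Type*} [NormedAddCommGroup W] [NormedSpace ℝ W] (f : W → X) (w : W) :
    W →L[ℝ] E3 →L[ℝ] E3 :=
  (connMat A L (f w)).comp (mfderiv 𝓘(ℝ, W) (𝓡 4) f w)

theorem IsSmoothFrame.contDiffOn_pullMat (A : CovariantDerivative (𝓡 4) E3 E)
    [A.ContMDiffCovariantDerivative ∞] (hL : IsSmoothFrame L U) (hU : IsOpen U)
    {W : Type*} [NormedAddCommGroup W] [NormedSpace ℝ W] [FiniteDimensional ℝ W] {f : W → X}
    {V : Set W} (hV : IsOpen V) (hf : ContMDiffOn 𝓘(ℝ, W) (𝓡 4) ∞ f V) (hfU : Set.MapsTo f V U) :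
    ContDiffOn ℝ ∞ (pullMat A L f) V := by
  rw [contDiffOn_clm_apply]
  intro u
  rw [contDiffOn_clm_apply]
  intro a w hw
  have hfw : ContMDiffAt 𝓘(ℝ, W) (𝓡 4) ∞ f w := hf.contMDiffAt (hV.mem_nhds hw)
  have hv : ContMDiffAt 𝓘(ℝ, W) (𝓘(ℝ, W).prod 𝓘(ℝ, W)) ∞
      (fun w' : W ↦ (⟨w', u⟩ : TangentBundle 𝓘(ℝ, W) W)) w :=
    contMDiffAt_vectorSpace_iff_contDiffAt.mpr contDiffAt_const
  have hdf : ContMDiffAt 𝓘(ℝ, W) ((𝓡 4).prod 𝓘(ℝ, E4)) ∞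
      (fun w' : W ↦ (⟨f w', mfderiv 𝓘(ℝ, W) (𝓡 4) f w' u⟩ : TangentBundle (𝓡 4) X)) w :=
    ContMDiffAt.clm_apply_of_inCoordinates (hfw.mfderiv_const (m := ∞) (by simp)) hv hfw
  have hAj (j : Fin 3) : ContMDiffAt 𝓘(ℝ, W) ((𝓡 4).prod 𝓘(ℝ, E3)) ∞
      (fun w' : W ↦ (⟨f w', A (fun y ↦ L y (EuclideanSpace.single j 1)) (f w')
        (mfderiv 𝓘(ℝ, W) (𝓡 4) f w' u)⟩ : TotalSpace E3 E)) w :=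
    ContMDiffAt.clm_bundle_apply (b := f)
      ((hL.contMDiffAt_covariantDerivative A hU (hfU hw) _).comp w hfw) hdf
  have h2 : ContMDiffAt 𝓘(ℝ, W) 𝓘(ℝ, E3) ∞ (fun w' ↦ ∑ j, a j • (L (f w')).symm
      (A (fun y ↦ L y (EuclideanSpace.single j 1)) (f w') (mfderiv 𝓘(ℝ, W) (𝓡 4) f w' u))) w :=
    ContMDiffAt.sum fun j _ ↦ contMDiffAt_fun_smul contMDiffAt_const
      (hL.contMDiffAt_symm hU (f := f) (hfU hw) (hAj j))
  refine (h2.contDiffAt.congr_of_eventuallyEq (Eventually.of_forall fun w' ↦ ?_)).contDiffWithinAt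
  apply (L (f w')).injective
  simp only [pullMat, map_sum, map_smul,
    LinearIsometryEquiv.apply_symm_apply]
  exact connMat_apply A _ _ a

end T2

end Frame

/-! ### Calculus of moving frames in `ℝ³` -/

section Calculus

open Filter Topology

variable {W : Type*} [NormedAddCommGroup W] [NormedSpace ℝ W]

theorem contDiffOn_crossE {n : WithTop ℕ∞} {p s : W → E3} {V : Set W} (hp : ContDiffOn ℝ n p V)
    (hs : ContDiffOn ℝ n s V) : ContDiffOn ℝ n (fun w ↦ crossE (p w) (s w)) V := by
  have hp' := contDiffOn_euclidean.mp hp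
  have hs' := contDiffOn_euclidean.mp hs
  rw [contDiffOn_euclidean]
  intro i
  fin_cases i
  · exact ((hp' 1).mul (hs' 2)).sub ((hp' 2).mul (hs' 1))
  · exact ((hp' 2).mul (hs' 0)).sub ((hp' 0).mul (hs' 2))
  · exact ((hp' 0).mul (hs' 1)).sub ((hp' 1).mul (hs' 0))

theorem _root_.ContDiffOn.differentiableAt_of_mem {F : Type*} [NormedAddCommGroup F]
    [NormedSpace ℝ F] {g : W → F} {V : Set W} {w : W} (hg : ContDiffOn ℝ ∞ g V) (hV : V ∈ 𝓝 w) :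
    DifferentiableAt ℝ g w :=
  (hg.contDiffAt hV).differentiableAt (by simp)

/-- The covariant derivative `d + a` for a skew matrix `a` is metric. -/
theorem inner_covDeriv_add {x y : W → E3} {w : W} {c : ℝ} (hx : DifferentiableAt ℝ x w)
    (hy : DifferentiableAt ℝ y w) (hxy : ∀ᶠ w' in 𝓝 w, inner ℝ (x w') (y w') = c)
    (a : E3 →L[ℝ] E3) (ha : ∀ b c, inner ℝ (a b) c = -inner ℝ b (a c)) (u : W) :
    inner ℝ (fderiv ℝ x w u + a (x w)) (y w) + inner ℝ (x w) (fderiv ℝ y w u + a (y w)) = 0 := by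
  have h1 : fderiv ℝ (fun w' ↦ inner ℝ (x w') (y w')) w u = 0 := by
    have : (fun w' ↦ inner ℝ (x w') (y w')) =ᶠ[𝓝 w] fun _ ↦ c := hxy
    rw [this.fderiv_eq]
    simp
  rw [fderiv_inner_apply ℝ hx hy] at h1
  rw [inner_add_left, inner_add_right, ha]
  linarith

/-- The derivative of the covariant derivative `dσ + a σ` in a fixed direction. -/
theorem differentiableAt_covDeriv {σ : W → E3} {a : W → W →L[ℝ] E3 →L[ℝ] E3} {w : W}
    (h2 : DifferentiableAt ℝ (fderiv ℝ σ) w) (ha : DifferentiableAt ℝ a w)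
    (hσ : DifferentiableAt ℝ σ w) (v : W) :
    DifferentiableAt ℝ (fun w' ↦ fderiv ℝ σ w' v + a w' v (σ w')) w ∧
      ∀ u, fderiv ℝ (fun w' ↦ fderiv ℝ σ w' v + a w' v (σ w')) w u =
        fderiv ℝ (fderiv ℝ σ) w u v + (fderiv ℝ a w u v (σ w) + a w v (fderiv ℝ σ w u)) := by
  have d1 : DifferentiableAt ℝ (fun w' ↦ fderiv ℝ σ w' v) w := h2.clm_apply (by fun_prop)
  have d2 : DifferentiableAt ℝ (fun w' ↦ a w' v) w := ha.clm_apply (by fun_prop)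
  have d3 : DifferentiableAt ℝ (fun w' ↦ a w' v (σ w')) w := d2.clm_apply hσ
  refine ⟨d1.fun_add d3, fun u ↦ ?_⟩
  rw [fderiv_fun_add d1 d3, fderiv_clm_apply h2 (differentiableAt_const v),
    fderiv_clm_apply d2 hσ, fderiv_clm_apply ha (differentiableAt_const v)]
  simp [add_comm]

/-- The exterior derivative of the connection form `⟪∇ σ, q⟫` of a moving orthonormal frame
`p, σ, q`, for the covariant derivative `∇ = d + a`. -/
theorem fderiv_connForm_sub {p σ q : W → E3} {a : W → W →L[ℝ] E3 →L[ℝ] E3} {V : Set W}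
    (hV : IsOpen V) (hp : ContDiffOn ℝ ∞ p V) (hσ : ContDiffOn ℝ ∞ σ V) (hq : ContDiffOn ℝ ∞ q V)
    (ha : ContDiffOn ℝ ∞ a V)
    (hskew : ∀ w ∈ V, ∀ u b c, inner ℝ (a w u b) c = -inner ℝ b (a w u c))
    (hpn : ∀ w ∈ V, ‖p w‖ = 1) (hσn : ∀ w ∈ V, ‖σ w‖ = 1)
    (hpσ : ∀ w ∈ V, inner ℝ (p w) (σ w) = 0) (hqe : ∀ w ∈ V, q w = crossE (p w) (σ w))
    {θ : W → W →L[ℝ] ℝ} (hθd : ContDiffOn ℝ ∞ θ V)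
    (hθ : ∀ w ∈ V, ∀ v, θ w v = inner ℝ (q w) (fderiv ℝ σ w v + a w v (σ w)))
    {w : W} (hw : w ∈ V) (u v : W) :
    fderiv ℝ θ w u v - fderiv ℝ θ w v u =
      inner ℝ (fderiv ℝ a w u v (σ w) - fderiv ℝ a w v u (σ w) + a w u (a w v (σ w))
        - a w v (a w u (σ w))) (q w)
      - (inner ℝ (σ w) (fderiv ℝ p w u + a w u (p w)) * inner ℝ (q w) (fderiv ℝ p w v + a w v (p w))
      - inner ℝ (σ w) (fderiv ℝ p w v + a w v (p w)) *
        inner ℝ (q w) (fderiv ℝ p w u + a w u (p w))) := by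
  have hVw : V ∈ 𝓝 w := hV.mem_nhds hw
  have hσ2 : ContDiffAt ℝ ∞ (fderiv ℝ σ) w :=
    (hσ.contDiffAt hVw).fderiv_right (m := ∞) (by simp)
  have hD2 : DifferentiableAt ℝ (fderiv ℝ σ) w := hσ2.differentiableAt (by simp)
  have hsymm : fderiv ℝ (fderiv ℝ σ) w u v = fderiv ℝ (fderiv ℝ σ) w v u :=
    (((hσ.contDiffAt hVw).isSymmSndFDerivAt (by
      rw [minSmoothness_of_isRCLikeNormedField]
      exact WithTop.coe_le_coe.mpr (le_top : (2 : ℕ∞) ≤ ⊤)))).eq u v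
  have key (u v : W) : fderiv ℝ θ w u v =
      inner ℝ (q w) (fderiv ℝ (fderiv ℝ σ) w u v + (fderiv ℝ a w u v (σ w)
        + a w v (fderiv ℝ σ w u)))
      + inner ℝ (fderiv ℝ q w u) (fderiv ℝ σ w v + a w v (σ w)) := by
    have e1 : fderiv ℝ θ w u v = fderiv ℝ (fun w' ↦ θ w' v) w u := by
      rw [fderiv_clm_apply (hθd.differentiableAt_of_mem hVw) (differentiableAt_const v)]
      simp
    have e2 : (fun w' ↦ θ w' v) =ᶠ[𝓝 w]
        fun w' ↦ inner ℝ (q w') (fderiv ℝ σ w' v + a w' v (σ w')) := by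
      filter_upwards [hVw] with w' hw' using hθ w' hw' v
    obtain ⟨d, e3⟩ := differentiableAt_covDeriv hD2 (ha.differentiableAt_of_mem hVw)
      (hσ.differentiableAt_of_mem hVw) v
    rw [e1, e2.fderiv_eq, fderiv_inner_apply ℝ (hq.differentiableAt_of_mem hVw) d, ← e3]
  have hev {P : W → Prop} (h : ∀ w ∈ V, P w) : ∀ᶠ w' in 𝓝 w, P w' := by
    filter_upwards [hVw] with w' hw' using h w' hw'
  have i1 (z : W) := inner_covDeriv_add (hσ.differentiableAt_of_mem hVw)
    (hσ.differentiableAt_of_mem hVw) (c := 1)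
    (hev fun w hw ↦ by rw [real_inner_self_eq_norm_sq, hσn w hw]; norm_num) (a w z)
    (hskew w hw z) z
  have i2 (z : W) := inner_covDeriv_add (hσ.differentiableAt_of_mem hVw)
    (hp.differentiableAt_of_mem hVw) (c := 0)
    (hev fun w hw ↦ by rw [real_inner_comm]; exact hpσ w hw) (a w z) (hskew w hw z) z
  have i3 (z : W) := inner_covDeriv_add (hq.differentiableAt_of_mem hVw)
    (hp.differentiableAt_of_mem hVw) (c := 0)
    (hev fun w hw ↦ by rw [hqe w hw]; exact inner_crossE_left _ _) (a w z) (hskew w hw z) z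
  have i4 (z : W) := inner_covDeriv_add (hq.differentiableAt_of_mem hVw)
    (hq.differentiableAt_of_mem hVw) (c := 1)
    (hev fun w hw ↦ by
      rw [hqe w hw, real_inner_self_eq_norm_sq, norm_crossE (hpn w hw) (hσn w hw) (hpσ w hw)]
      norm_num) (a w z) (hskew w hw z) z
  have pars (x y : E3) := inner_eq_of_orthonormal (hpn w hw) (hσn w hw) (hpσ w hw) x y
  rw [← hqe w hw] at pars
  have par (u v : W) : inner ℝ (fderiv ℝ q w u + a w u (q w)) (fderiv ℝ σ w v + a w v (σ w)) =
      inner ℝ (q w) (fderiv ℝ p w u + a w u (p w)) *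
      inner ℝ (σ w) (fderiv ℝ p w v + a w v (p w)) := by
    have j1 := i1 v
    have j2 := i2 v
    have j3 := i3 u
    have j4 := i4 u
    rw [real_inner_comm, ← two_mul, mul_eq_zero] at j1 j4
    have j1' := j1.resolve_left two_ne_zero
    have j4' := j4.resolve_left two_ne_zero
    rw [pars, real_inner_comm (σ w) (fderiv ℝ σ w v + a w v (σ w)), j1',
      real_inner_comm (q w) (fderiv ℝ q w u + a w u (q w)), j4',
      eq_neg_of_add_eq_zero_left j2, eq_neg_of_add_eq_zero_left j3]
    ring
  have p1 := par u v
  have p2 := par v u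
  rw [key u v, key v u, hsymm]
  have s1 := hskew w hw u (a w v (σ w)) (q w)
  have s2 := hskew w hw v (a w u (σ w)) (q w)
  have s3 := hskew w hw v (fderiv ℝ σ w u) (q w)
  have s4 := hskew w hw u (fderiv ℝ σ w v) (q w)
  simp only [inner_add_left, inner_add_right, inner_sub_left] at p1 p2 ⊢
  simp only [real_inner_comm] at p1 p2 s1 s2 s3 s4 ⊢
  linear_combination p1 - p2 - s1 + s2 + s3 - s4

end Calculus

section Frame

open Filter Topology

variable {X : Type*} [TopologicalSpace X] [ChartedSpace E4 X] [IsManifold (𝓡 4) ∞ X]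
  {E : X → Type*} [TopologicalSpace (TotalSpace E3 E)]
  [∀ x, NormedAddCommGroup (E x)] [∀ x, InnerProductSpace ℝ (E x)]
  [FiberBundle E3 E] [VectorBundle ℝ E3 E]
  [ContMDiffVectorBundle ∞ E3 E (𝓡 4)] [IsContMDiffRiemannianBundle (𝓡 4) ∞ E3 E]
  {L : ∀ x, E3 ≃ₗᵢ[ℝ] E x} {U : Set X}

/-! ### The connection of `V` induced by `A` -/

theorem pullMat_congr (A : CovariantDerivative (𝓡 4) E3 E) (L : ∀ x, E3 ≃ₗᵢ[ℝ] E x)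
    {W : Type*} [NormedAddCommGroup W] [NormedSpace ℝ W] {f g : W → X} {w : W}
    (h : f =ᶠ[𝓝 w] g) : pullMat A L f w = pullMat A L g w := by
  have key (x y : X) (hxy : x = y) (D : W →L[ℝ] E4) :
      (show E4 →L[ℝ] E3 →L[ℝ] E3 from connMat A L x).comp D =
        (show E4 →L[ℝ] E3 →L[ℝ] E3 from connMat A L y).comp D := by
    subst hxy; rfl
  have h' : (mfderiv 𝓘(ℝ, W) (𝓡 4) f w : W →L[ℝ] E4) = mfderiv 𝓘(ℝ, W) (𝓡 4) g w := h.mfderiv_eq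
  exact (congrArg (fun D : W →L[ℝ] E4 ↦
    (show E4 →L[ℝ] E3 →L[ℝ] E3 from connMat A L (f w)).comp D) h').trans (key _ _ h.eq_of_nhds _)

/-- Connection matrices are natural under pull-back. -/
theorem pullMat_comp (A : CovariantDerivative (𝓡 4) E3 E) (L : ∀ x, E3 ≃ₗᵢ[ℝ] E x)
    {W W' : Type*} [NormedAddCommGroup W] [NormedSpace ℝ W] [NormedAddCommGroup W']
    [NormedSpace ℝ W'] {f : W → X} {g : W' → W} {w : W'}
    (hf : MDifferentiableAt 𝓘(ℝ, W) (𝓡 4) f (g w)) (hg : DifferentiableAt ℝ g w) :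
    pullMat A L (f ∘ g) w = (pullMat A L f (g w)).comp (fderiv ℝ g w) := by
  have : HasMFDerivAt 𝓘(ℝ, W') (𝓡 4) (f ∘ g) w
      ((mfderiv 𝓘(ℝ, W) (𝓡 4) f (g w)).comp (fderiv ℝ g w)) :=
    hf.hasMFDerivAt.comp w hg.hasFDerivAt.hasMFDerivAt
  rw [pullMat, this.mfderiv]
  rfl

variable {o : ∀ x, Orientation ℝ (E x) (Fin 3)}

/-- The frame `L` is positive over `U`. -/
def IsPositiveFrame (o : ∀ x, Orientation ℝ (E x) (Fin 3)) (L : ∀ x, E3 ≃ₗᵢ[ℝ] E x)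
    (U : Set X) : Prop :=
  ∀ x ∈ U, ∀ p s : E3, cross o (L x p) (L x s) = L x (crossE p s)

theorem IsBundleOrientation.exists_isPositiveFrame (ho : IsBundleOrientation o) (x₀ : X) :
    ∃ U : Set X, IsOpen U ∧ x₀ ∈ U ∧ ∃ L : ∀ x, E3 ≃ₗᵢ[ℝ] E x, IsSmoothFrame L U ∧
      IsPositiveFrame o L U := by
  obtain ⟨U, hU, hx, L, hL, h⟩ := ho x₀
  refine ⟨U, hU, hx, L, hL, fun x hxU p s ↦ ?_⟩
  obtain ⟨ε, -, h1, h2⟩ := exists_cross_sign ((VectorBundle.finrank_eq ℝ E3 E x).trans (by simp))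
    (o x) (L x)
  rw [cross, h2, h1 (h x hxU), one_smul]

variable {W : Type} [NormedAddCommGroup W] [NormedSpace ℝ W] {ψ : W → FramePoint E} {V : Set W}

theorem IsUnitFamily.contMDiffOn_pt (hψ : IsUnitFamily ψ V) :
    ContMDiffOn 𝓘(ℝ, W) (𝓡 4) ∞ (fun w ↦ (ψ w).pt) V := fun _ hw ↦
  (contMDiffAt_totalSpace.mp (hψ.2.2.1.contMDiffAt (hψ.1.mem_nhds hw))).1.contMDiffWithinAt

theorem IsUnitFamily.isOpen_inter (hψ : IsUnitFamily ψ V) (hU : IsOpen U) :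
    IsOpen (V ∩ (fun w ↦ (ψ w).pt) ⁻¹' U) :=
  hψ.contMDiffOn_pt.continuousOn.isOpen_inter_preimage hψ.1 hU

theorem IsUnitFamily.contDiffOn_pos (hψ : IsUnitFamily ψ V) (hL : IsSmoothFrame L U)
    (hU : IsOpen U) : ContDiffOn ℝ ∞ (fun w ↦ (L (ψ w).pt).symm (ψ w).pos)
      (V ∩ (fun w ↦ (ψ w).pt) ⁻¹' U) := fun _ hw ↦
  (hL.contMDiffAt_symm hU (f := fun w ↦ (ψ w).pt) (s := fun w ↦ (ψ w).pos) hw.2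
    (hψ.2.2.1.contMDiffAt (hψ.1.mem_nhds hw.1))).contDiffAt.contDiffWithinAt

theorem IsUnitFamily.contDiffOn_vec (hψ : IsUnitFamily ψ V) (hL : IsSmoothFrame L U)
    (hU : IsOpen U) : ContDiffOn ℝ ∞ (fun w ↦ (L (ψ w).pt).symm (ψ w).vec)
      (V ∩ (fun w ↦ (ψ w).pt) ⁻¹' U) := fun _ hw ↦
  (hL.contMDiffAt_symm hU (f := fun w ↦ (ψ w).pt) (s := fun w ↦ (ψ w).vec) hw.2
    (hψ.2.2.2.contMDiffAt (hψ.1.mem_nhds hw.1))).contDiffAt.contDiffWithinAt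

theorem cross_eq (hp : IsPositiveFrame o L U) {x : X} (hx : x ∈ U) (p s : E x) :
    cross o p s = L x (crossE ((L x).symm p) ((L x).symm s)) := by
  rw [← hp x hx]; simp

/-- The connection form of the induced connection in a positive frame. -/
theorem inducedConnection_form (A : CovariantDerivative (𝓡 4) E3 E) (hL : IsSmoothFrame L U)
    (hU : IsOpen U) (hp : IsPositiveFrame o L U) {w : W} (hw : (ψ w).pt ∈ U)
    (hf : MDifferentiableAt 𝓘(ℝ, W) (𝓡 4) (fun w' ↦ (ψ w').pt) w)
    (hs : DifferentiableAt ℝ (fun w' ↦ (L (ψ w').pt).symm (ψ w').vec) w) (u : W) :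
    (inducedConnection o A).form ψ w u =
      inner ℝ (crossE ((L (ψ w).pt).symm (ψ w).pos) ((L (ψ w).pt).symm (ψ w).vec))
        (fderiv ℝ (fun w' ↦ (L (ψ w').pt).symm (ψ w').vec) w u
          + pullMat A L (fun w' ↦ (ψ w').pt) w u ((L (ψ w).pt).symm (ψ w).vec)) := by
  change inner ℝ (cross o (ψ w).pos (ψ w).vec)
    (covAlong A (fun w' ↦ (⟨(ψ w').pt, (ψ w').vec⟩ : TotalSpace E3 E)) w u) = _
  rw [hL.covAlong_eq A hU (f := fun w ↦ (ψ w).pt) (s := fun w ↦ (ψ w).vec) hw hf hs,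
    cross_eq hp hw, LinearIsometryEquiv.inner_map_map]
  rfl

/-- The connection form of a unit family is `⟪∇ σ, p × σ⟫` in a positive frame. -/
theorem IsUnitFamily.form_eq (A : CovariantDerivative (𝓡 4) E3 E) (hL : IsSmoothFrame L U)
    (hU : IsOpen U) (hp : IsPositiveFrame o L U) (hψ : IsUnitFamily ψ V) {w : W}
    (hw : w ∈ V ∩ (fun w ↦ (ψ w).pt) ⁻¹' U) (u : W) :
    (inducedConnection o A).form ψ w u =
      inner ℝ (crossE ((L (ψ w).pt).symm (ψ w).pos) ((L (ψ w).pt).symm (ψ w).vec))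
        (fderiv ℝ (fun w' ↦ (L (ψ w').pt).symm (ψ w').vec) w u
          + pullMat A L (fun w' ↦ (ψ w').pt) w u ((L (ψ w).pt).symm (ψ w).vec)) :=
  inducedConnection_form A hL hU hp hw.2
    ((hψ.contMDiffOn_pt.contMDiffAt (hψ.1.mem_nhds hw.1)).mdifferentiableAt (by simp))
    ((hψ.contDiffOn_vec hL hU).differentiableAt_of_mem ((hψ.isOpen_inter hU).mem_nhds hw)) u

theorem IsUnitFamily.contDiffOn_form [T2Space X] [FiniteDimensional ℝ W]
    (A : CovariantDerivative (𝓡 4) E3 E)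
    [A.ContMDiffCovariantDerivative ∞] (hL : IsSmoothFrame L U)
    (hU : IsOpen U) (hp : IsPositiveFrame o L U) (hψ : IsUnitFamily ψ V) :
    ContDiffOn ℝ ∞ ((inducedConnection o A).form ψ) (V ∩ (fun w ↦ (ψ w).pt) ⁻¹' U) := by
  rw [contDiffOn_clm_apply]
  intro u
  have hV := hψ.isOpen_inter hU
  have h1 := hψ.contDiffOn_vec hL hU
  have h2 : ContDiffOn ℝ ∞ (fderiv ℝ (fun w' ↦ (L (ψ w').pt).symm (ψ w').vec))
      (V ∩ (fun w ↦ (ψ w).pt) ⁻¹' U) := h1.fderiv_of_isOpen hV (by simp)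
  have h3 := hL.contDiffOn_pullMat A hU hV (hψ.contMDiffOn_pt.mono Set.inter_subset_left)
    (fun _ hw ↦ hw.2)
  refine ((contDiffOn_crossE (hψ.contDiffOn_pos hL hU) h1).inner ℝ
    ((h2.clm_apply contDiffOn_const).add
      ((h3.clm_apply (contDiffOn_const (c := u))).clm_apply h1))).congr fun w hw ↦ hψ.form_eq A hL hU hp hw u

theorem crossE_rotate {p s : E3} (hp : ‖p‖ = 1) (h : inner ℝ p s = 0) (c d : ℝ) :
    crossE p (c • s + d • crossE p s) = c • crossE p s - d • s := by
  have hp' : p 0 * p 0 + p 1 * p 1 + p 2 * p 2 = 1 := by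
    rw [← inner_E3, real_inner_self_eq_norm_sq, hp]; norm_num
  rw [inner_E3] at h
  apply ext_E3 <;> simp
  · linear_combination d * p 0 * h - d * s 0 * hp'
  · linear_combination d * p 1 * h - d * s 1 * hp'
  · linear_combination d * p 2 * h - d * s 2 * hp'

/-- The gauge law uses that `∇ σ ⟂ σ` and that `i` is parallel, both consequences of the fact that `A`
is metric. -/
theorem isUnitaryConnection_inducedConnection [T2Space X] (ho : IsBundleOrientation o)
    (A : CovariantDerivative (𝓡 4) E3 E) [A.ContMDiffCovariantDerivative ∞]
    (hA : A.IsMetricCompatible) :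
    IsUnitaryConnection o (inducedConnection o A) where
  smooth ψ V hψ w hw := by
    obtain ⟨U, hU, hxU, L, hL, hp⟩ := ho.exists_isPositiveFrame (ψ w).pt
    exact ((hψ.contDiffOn_form A hL hU hp).contDiffAt
      ((hψ.isOpen_inter hU).mem_nhds ⟨hw, hxU⟩)).contDiffWithinAt
  pullback {W W'} _ _ _ _ _ _ ψ V ψ' V' g hψ hψ' hg hgV hψg w hw := by
    obtain ⟨U, hU, hxU, L, hL, hp⟩ := ho.exists_isPositiveFrame (ψ (g w)).pt
    have hgw : g w ∈ V ∩ (fun w ↦ (ψ w).pt) ⁻¹' U := ⟨hgV hw, hxU⟩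
    have hw' : w ∈ V' ∩ (fun w ↦ (ψ' w).pt) ⁻¹' U := ⟨hw, by
      rw [Set.mem_preimage, hψg w hw]; exact hxU⟩
    have hV' : V' ∈ 𝓝 w := hψ'.1.mem_nhds hw
    ext u
    rw [hψ'.form_eq A hL hU hp hw', ContinuousLinearMap.comp_apply, hψ.form_eq A hL hU hp hgw]
    have hgd : DifferentiableAt ℝ g w := hg.differentiableAt_of_mem hV'
    have e1 : (fun w ↦ (L (ψ' w).pt).symm (ψ' w).vec) =ᶠ[𝓝 w]
        (fun w ↦ (L (ψ w).pt).symm (ψ w).vec) ∘ g := by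
      filter_upwards [hV'] with z hz
      exact congrArg (fun q : FramePoint E ↦ (L q.pt).symm q.vec) (hψg z hz)
    have e2 : (fun w ↦ (ψ' w).pt) =ᶠ[𝓝 w] (fun w ↦ (ψ w).pt) ∘ g := by
      filter_upwards [hV'] with z hz
      simp [hψg z hz]
    have e3 : fderiv ℝ (fun w ↦ (L (ψ' w).pt).symm (ψ' w).vec) w u =
        fderiv ℝ (fun w ↦ (L (ψ w).pt).symm (ψ w).vec) (g w) (fderiv ℝ g w u) := by
      rw [e1.fderiv_eq, fderiv_comp _ ((hψ.contDiffOn_vec hL hU).differentiableAt_of_mem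
        ((hψ.isOpen_inter hU).mem_nhds hgw)) hgd]
      rfl
    have e4 : pullMat A L (fun w ↦ (ψ' w).pt) w =
        (pullMat A L (fun w ↦ (ψ w).pt) (g w)).comp (fderiv ℝ g w) := by
      rw [pullMat_congr A L e2, pullMat_comp A L (f := fun w ↦ (ψ w).pt) _ hgd]
      exact (hψ.contMDiffOn_pt.contMDiffAt (hψ.1.mem_nhds hgw.1)).mdifferentiableAt (by simp)
    rw [e3, e4, ContinuousLinearMap.comp_apply]
    exact congrArg (fun z : FramePoint E ↦
      (inner ℝ (crossE ((L z.pt).symm z.pos) ((L z.pt).symm z.vec))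
      (fderiv ℝ (fun w ↦ (L (ψ w).pt).symm (ψ w).vec) (g w) (fderiv ℝ g w u)
        + pullMat A L (fun w ↦ (ψ w).pt) (g w) (fderiv ℝ g w u) ((L z.pt).symm z.vec)) : ℝ))
      (hψg w hw)
  gauge {W} _ _ _ ψ V α hψ hα w hw := by
    obtain ⟨U, hU, hxU, L, hL, hp⟩ := ho.exists_isPositiveFrame (ψ w).pt
    have hw' : w ∈ V ∩ (fun w ↦ (ψ w).pt) ⁻¹' U := ⟨hw, hxU⟩
    have hV := (hψ.isOpen_inter hU).mem_nhds hw'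
    have hps := (hψ.contDiffOn_pos hL hU).differentiableAt_of_mem hV
    have hsd := (hψ.contDiffOn_vec hL hU).differentiableAt_of_mem hV
    have hqd := (contDiffOn_crossE (hψ.contDiffOn_pos hL hU)
      (hψ.contDiffOn_vec hL hU)).differentiableAt_of_mem hV
    have hαd : DifferentiableAt ℝ α w := hα.differentiableAt_of_mem (hψ.1.mem_nhds hw)
    have hptd : MDifferentiableAt 𝓘(ℝ, W) (𝓡 4) (fun w ↦ (ψ w).pt) w :=
      (hψ.contMDiffOn_pt.contMDiffAt (hψ.1.mem_nhds hw)).mdifferentiableAt (by simp)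
    have hn (w : W) (hw : w ∈ V) : ‖(L (ψ w).pt).symm (ψ w).pos‖ = 1 ∧
        ‖(L (ψ w).pt).symm (ψ w).vec‖ = 1 ∧
        inner ℝ ((L (ψ w).pt).symm (ψ w).pos) ((L (ψ w).pt).symm (ψ w).vec) = 0 := by
      simpa using hψ.2.1 w hw
    set p : W → E3 := fun w ↦ (L (ψ w).pt).symm (ψ w).pos
    set σ : W → E3 := fun w ↦ (L (ψ w).pt).symm (ψ w).vec
    set q : W → E3 := fun w ↦ crossE (p w) (σ w)
    -- the rotated unit vector in the frame
    have hrot : (fun w ↦ (L (rotate o α ψ w).pt).symm (rotate o α ψ w).vec) =ᶠ[𝓝 w]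
        fun w ↦ Real.cos (α w) • σ w + Real.sin (α w) • q w := by
      filter_upwards [hV] with z hz
      change (L (ψ z).pt).symm (Real.cos (α z) • (ψ z).vec
        + Real.sin (α z) • cross o (ψ z).pos (ψ z).vec) = _
      rw [cross_eq hp hz.2, map_add, map_smul, map_smul, LinearIsometryEquiv.symm_apply_apply]
    have hder : HasFDerivAt (fun w ↦ Real.cos (α w) • σ w + Real.sin (α w) • q w)
        (Real.cos (α w) • fderiv ℝ σ w + (-Real.sin (α w) • fderiv ℝ α w).smulRight (σ w)
          + (Real.sin (α w) • fderiv ℝ q w + (Real.cos (α w) • fderiv ℝ α w).smulRight (q w))) w :=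
      (hαd.hasFDerivAt.cos.smul hsd.hasFDerivAt).add (hαd.hasFDerivAt.sin.smul hqd.hasFDerivAt)
    have hder' := hder.congr_of_eventuallyEq hrot
    ext u
    rw [add_apply, hψ.form_eq A hL hU hp hw',
      inducedConnection_form A hL hU hp (ψ := rotate o α ψ) hxU hptd hder'.differentiableAt,
      hder'.fderiv]
    have hrot' : (L (rotate o α ψ w).pt).symm (rotate o α ψ w).vec = _ := hrot.eq_of_nhds
    rw [hrot']
    change inner ℝ (crossE (p w) _) (_ + pullMat A L (fun w' ↦ (ψ w').pt) w u _) =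
      inner ℝ (q w) (fderiv ℝ σ w u + pullMat A L (fun w' ↦ (ψ w').pt) w u (σ w)) + _
    set a := pullMat A L (fun w' ↦ (ψ w').pt) w u
    have hskew (b c : E3) : inner ℝ (a b) c = -inner ℝ b (a c) := hL.inner_connMat A hA hU hxU _ b c
    obtain ⟨hp1, hs1, hps0⟩ := hn w hw
    rw [crossE_rotate hp1 hps0]
    have hev {P : W → Prop} (h : ∀ w ∈ V, P w) : ∀ᶠ w' in 𝓝 w, P w' := by
      filter_upwards [hψ.1.mem_nhds hw] with w' hw' using h w' hw'
    have i1 := inner_covDeriv_add hsd hsd (c := 1)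
      (hev fun w hw ↦ by rw [real_inner_self_eq_norm_sq, (hn w hw).2.1]; norm_num) a hskew u
    have i2 := inner_covDeriv_add hqd hqd (c := 1)
      (hev fun w hw ↦ by
        rw [real_inner_self_eq_norm_sq, norm_crossE (hn w hw).1 (hn w hw).2.1 (hn w hw).2.2]
        norm_num) a hskew u
    have i3 := inner_covDeriv_add hqd hsd (c := 0)
      (hev fun w hw ↦ inner_crossE_right _ _) a hskew u
    have n1 : inner ℝ (q w) (q w) = (1 : ℝ) := by
      rw [real_inner_self_eq_norm_sq, norm_crossE hp1 hs1 hps0]; norm_num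
    have n2 : inner ℝ (σ w) (σ w) = (1 : ℝ) := by
      rw [real_inner_self_eq_norm_sq, hs1]; norm_num
    have n3 : inner ℝ (q w) (σ w) = (0 : ℝ) := inner_crossE_right _ _
    have n4 : inner ℝ (σ w) (q w) = (0 : ℝ) := by rw [real_inner_comm]; exact n3
    change inner ℝ (Real.cos (α w) • q w - Real.sin (α w) • σ w) _ = _
    have hcs := Real.cos_sq_add_sin_sq (α w)
    simp only [add_apply, smul_apply, ContinuousLinearMap.smulRight_apply, map_add, map_smul,
      inner_add_left, inner_add_right, inner_sub_left, real_inner_smul_left, real_inner_smul_right,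
      n1, n2, n3, n4, smul_eq_mul] at i1 i2 i3 ⊢
    simp only [real_inner_comm] at i1 i2 i3 ⊢
    linear_combination (inner ℝ (q w) (fderiv ℝ σ w u) + inner ℝ (q w) (a (σ w))
        + fderiv ℝ α w u) * hcs
      - Real.sin (α w) ^ 2 * i3 + Real.cos (α w) * Real.sin (α w) / 2 * (i2 - i1)

/-! ### The curvature of `A` in a frame -/

theorem IsSmoothFrame.mono {U' : Set X} (hL : IsSmoothFrame L U) (h : U' ⊆ U) :
    IsSmoothFrame L U' := fun u ↦ (hL u).mono h

/-- The covariant derivative in the direction of a tangent vector of a parametrization `f`. -/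
theorem IsSmoothFrame.symm_covariantDerivative_mfderiv (A : CovariantDerivative (𝓡 4) E3 E)
    (hL : IsSmoothFrame L U) (hU : IsOpen U) {W : Type*} [NormedAddCommGroup W] [NormedSpace ℝ W]
    {f : W → X} {w : W} (hf : MDifferentiableAt 𝓘(ℝ, W) (𝓡 4) f w) (hw : f w ∈ U) {S : ∀ y, E y}
    (hS : MDifferentiableAt (𝓡 4) 𝓘(ℝ, E3) (fun y ↦ (L y).symm (S y)) (f w)) (b : W) :
    (L (f w)).symm (A S (f w) (mfderiv 𝓘(ℝ, W) (𝓡 4) f w b)) =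
      fderiv ℝ (fun w ↦ (L (f w)).symm (S (f w))) w b
        + pullMat A L f w b ((L (f w)).symm (S (f w))) := by
  rw [hL.covariantDerivative_eq A hU hw hS (Eventually.of_forall fun y ↦ by simp),
    LinearIsometryEquiv.symm_apply_apply]
  let D : W →L[ℝ] TangentSpace (𝓡 4) (f w) := mfderiv 𝓘(ℝ, W) (𝓡 4) f w
  have h : HasFDerivAt (fun w ↦ (L (f w)).symm (S (f w)))
      ((mvfderiv (𝓡 4) (fun y ↦ (L y).symm (S y)) (f w)).comp D) w :=
    (hS.hasMFDerivAt.comp w hf.hasMFDerivAt).hasFDerivAt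
  rw [h.fderiv]
  rfl

/-- The canonical extensions of tangent vectors at `x` are constant in the chart at `x`. -/
theorem extend_eq_mfderiv (x : X) (v : TangentSpace (𝓡 4) x) {z : E4}
    (hz : z ∈ (extChartAt (𝓡 4) x).target) :
    FiberBundle.extend E4 v ((extChartAt (𝓡 4) x).symm z) =
      mfderiv 𝓘(ℝ, E4) (𝓡 4) (extChartAt (𝓡 4) x).symm z
        (mfderiv (𝓡 4) 𝓘(ℝ, E4) (extChartAt (𝓡 4) x) x v) := by
  have h0 := TangentBundle.continuousLinearMapAt_trivializationAt (I := 𝓡 4) (mem_chart_source E4 x)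
  have h0' : (trivializationAt E4 (TangentSpace (𝓡 4)) x ⟨x, v⟩).2 =
      mfderiv (𝓡 4) 𝓘(ℝ, E4) (extChartAt (𝓡 4) x) x v := by
    have h1 : (trivializationAt E4 (TangentSpace (𝓡 4)) x).continuousLinearMapAt ℝ x v =
        (trivializationAt E4 (TangentSpace (𝓡 4)) x ⟨x, v⟩).2 := by
      rw [Trivialization.continuousLinearMapAt_apply, Trivialization.linearMapAt_apply,
        if_pos (FiberBundle.mem_baseSet_trivializationAt' x)]
    exact h1.symm.trans (congrArg (fun T : TangentSpace (𝓡 4) x →L[ℝ] E4 ↦ T v) h0)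
  rw [← h0']
  set φ := extChartAt (𝓡 4) x with hφ
  set a := (trivializationAt E4 (TangentSpace (𝓡 4)) x ⟨x, v⟩).2 with ha
  have hz' : φ.symm z ∈ (chartAt E4 x).source := by
    rw [← extChartAt_source (I := 𝓡 4)]; exact φ.map_target hz
  have h1 := TangentBundle.symmL_trivializationAt (I := 𝓡 4) hz'
  have h2 : (trivializationAt E4 (TangentSpace (𝓡 4)) x).symmL ℝ (φ.symm z) a =
    mfderivWithin 𝓘(ℝ, E4) (𝓡 4) φ.symm (Set.range (𝓡 4)) (φ (φ.symm z)) a := by rw [h1]; rfl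
  rw [φ.right_inv hz] at h2
  rw [ModelWithCorners.range_eq_univ, mfderivWithin_univ] at h2
  rw [← h2, Trivialization.symmL_apply]
  · rfl
  · simpa using hz'

theorem lieBracketWithin_eq_zero {F G : E4 → E4} {s : Set E4} {y a b : E4}
    (hF : F =ᶠ[𝓝 y] fun _ ↦ a) (hG : G =ᶠ[𝓝 y] fun _ ↦ b) :
    VectorField.lieBracketWithin ℝ F G s y = 0 := by
  change fderivWithin ℝ G s y (F y) - fderivWithin ℝ F s y (G y) = 0
  rw [(hF.filter_mono nhdsWithin_le_nhds).fderivWithin_eq hF.eq_of_nhds,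
    (hG.filter_mono nhdsWithin_le_nhds).fderivWithin_eq hG.eq_of_nhds]
  simp

/-- The canonical extensions of tangent vectors commute, being constant in a chart. -/
theorem mlieBracket_extend (x : X) (u v : TangentSpace (𝓡 4) x) :
    VectorField.mlieBracket (𝓡 4) (FiberBundle.extend E4 u) (FiberBundle.extend E4 v) x = 0 := by
  have key (v : TangentSpace (𝓡 4) x) : ∃ a : E4,
      (VectorField.mpullbackWithin 𝓘(ℝ, E4) (𝓡 4) (extChartAt (𝓡 4) x).symm
        (FiberBundle.extend E4 v) (Set.range (𝓡 4)) : E4 → E4) =ᶠ[𝓝 (extChartAt (𝓡 4) x x)]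
      fun _ ↦ a := by
    refine ⟨mfderiv (𝓡 4) 𝓘(ℝ, E4) (extChartAt (𝓡 4) x) x v, ?_⟩
    filter_upwards [extChartAt_target_mem_nhds (I := 𝓡 4) x] with z hz
    rw [VectorField.mpullbackWithin_apply, extend_eq_mfderiv x v hz]
    have hi := isInvertible_mfderivWithin_extChartAt_symm (I := 𝓡 4) (x := x) hz
    rw [ModelWithCorners.range_eq_univ, mfderivWithin_univ] at hi ⊢
    exact hi.inverse_apply_eq.mpr rfl
  obtain ⟨a, ha⟩ := key u
  obtain ⟨b, hb⟩ := key v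
  rw [VectorField.mlieBracket, VectorField.mlieBracketWithin_apply]
  exact (congrArg _ (lieBracketWithin_eq_zero ha hb)).trans (map_zero _)

/-- The pull-back along `f` of the matrix of curvature forms `dα + α ∧ α` of `A`. -/
noncomputable def pullCurv (A : CovariantDerivative (𝓡 4) E3 E) (L : ∀ x, E3 ≃ₗᵢ[ℝ] E x)
    {W : Type*} [NormedAddCommGroup W] [NormedSpace ℝ W] (f : W → X) (w u v : W) : E3 →L[ℝ] E3 :=
  fderiv ℝ (pullMat A L f) w u v - fderiv ℝ (pullMat A L f) w v u
    + (pullMat A L f w u).comp (pullMat A L f w v) - (pullMat A L f w v).comp (pullMat A L f w u)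

/-- The curvature in the chart at `x`, in which the canonical extensions of tangent vectors are
constant. -/
theorem bundleCurvature_chart [T2Space X] (A : CovariantDerivative (𝓡 4) E3 E)
    [A.ContMDiffCovariantDerivative ∞] (hL : IsSmoothFrame L U) (hU : IsOpen U) {x : X}
    (hx : x ∈ U) {u v : TangentSpace (𝓡 4) x} {a b : E4}
    (ha : ∀ z ∈ (extChartAt (𝓡 4) x).target, FiberBundle.extend E4 u ((extChartAt (𝓡 4) x).symm z) =
      mfderiv 𝓘(ℝ, E4) (𝓡 4) (extChartAt (𝓡 4) x).symm z a)
    (hb : ∀ z ∈ (extChartAt (𝓡 4) x).target, FiberBundle.extend E4 v ((extChartAt (𝓡 4) x).symm z) =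
      mfderiv 𝓘(ℝ, E4) (𝓡 4) (extChartAt (𝓡 4) x).symm z b) (σ : E3) :
    bundleCurvature A x u v (L x σ) =
      L x (pullCurv A L (extChartAt (𝓡 4) x).symm (extChartAt (𝓡 4) x x) a b σ) := by
  set φ := extChartAt (𝓡 4) x with hφ
  set f : E4 → X := ⇑φ.symm with hf
  set y₀ : E4 := φ x with hy₀
  have hfx : f y₀ = x := extChartAt_to_inv x
  set S : ∀ y, E y := FiberBundle.extend E3 (L x σ) with hS
  set u' : ∀ y : X, TangentSpace (𝓡 4) y := FiberBundle.extend E4 u with hu'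
  set v' : ∀ y : X, TangentSpace (𝓡 4) y := FiberBundle.extend E4 v with hv'
  obtain ⟨s, hs, hSs⟩ := FiberBundle.exists_contMDiffOn_extend (k := ∞) (𝓡 4) E3 (L x σ)
  set U' : Set X := U ∩ interior s with hU'
  have hU'o : IsOpen U' := hU.inter isOpen_interior
  have hxU' : x ∈ U' := ⟨hx, mem_interior_iff_mem_nhds.mpr hs⟩
  have hL' : IsSmoothFrame L U' := hL.mono Set.inter_subset_left
  have hSm (y) (hy : y ∈ U') : ContMDiffAt (𝓡 4) 𝓘(ℝ, E3) ∞ (fun y ↦ (L y).symm (S y)) y :=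
    hL'.contMDiffAt_symm hU'o (f := id) (s := S) hy
      (hSs.contMDiffAt (mem_interior_iff_mem_nhds.mp hy.2))
  have hfs : ContMDiffOn 𝓘(ℝ, E4) (𝓡 4) ∞ f φ.target := contMDiffOn_extChartAt_symm x
  have hto : IsOpen φ.target := isOpen_extChartAt_target x
  set V : Set E4 := φ.target ∩ f ⁻¹' U' with hV
  have hVo : IsOpen V := hfs.continuousOn.isOpen_inter_preimage hto hU'o
  have hy₀V : y₀ ∈ V := ⟨mem_extChartAt_target x, by rw [Set.mem_preimage, hfx]; exact hxU'⟩
  have hVn : V ∈ 𝓝 y₀ := hVo.mem_nhds hy₀V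
  have hfd (z) (hz : z ∈ V) : MDifferentiableAt 𝓘(ℝ, E4) (𝓡 4) f z :=
    (hfs.contMDiffAt (hto.mem_nhds hz.1)).mdifferentiableAt (by simp)
  set τ : E4 → E3 := fun z ↦ (L (f z)).symm (S (f z)) with hτ
  have hτs : ContDiffOn ℝ ∞ τ V := fun z hz ↦ ((hSm (f z) hz.2).comp z
    (hfs.contMDiffAt (hto.mem_nhds hz.1))).contDiffAt.contDiffWithinAt
  set α : E4 → E4 →L[ℝ] E3 →L[ℝ] E3 := pullMat A L f with hα
  have hαs : ContDiffOn ℝ ∞ α V :=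
    hL'.contDiffOn_pullMat A hU'o hVo (hfs.mono Set.inter_subset_left) fun _ hz ↦ hz.2
  -- the first covariant derivatives
  let h (a : E4) (z : E4) : E3 := fderiv ℝ τ z a + α z a (τ z)
  have first (v' : ∀ y : X, TangentSpace (𝓡 4) y) (a : E4)
      (ha : ∀ z ∈ φ.target, v' (f z) = mfderiv 𝓘(ℝ, E4) (𝓡 4) f z a) (z : E4) (hz : z ∈ V) :
      (L (f z)).symm (A S (f z) (v' (f z))) = h a z := by
    rw [ha z hz.1, hL'.symm_covariantDerivative_mfderiv A hU'o (hfd z hz) hz.2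
      ((hSm _ hz.2).mdifferentiableAt (by simp))]
  have d1 : DifferentiableAt ℝ (fderiv ℝ τ) y₀ :=
    (hτs.fderiv_of_isOpen hVo (m := ∞) (by simp)).differentiableAt_of_mem hVn
  have d2 := hτs.differentiableAt_of_mem hVn
  have d3 := hαs.differentiableAt_of_mem hVn
  have hd (a : E4) := differentiableAt_covDeriv d1 d3 d2 a
  -- the second covariant derivatives
  have second (u' v' : ∀ y : X, TangentSpace (𝓡 4) y) (a b : E4)
      (ha : ∀ z ∈ φ.target, u' (f z) = mfderiv 𝓘(ℝ, E4) (𝓡 4) f z a)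
      (hb : ∀ z ∈ φ.target, v' (f z) = mfderiv 𝓘(ℝ, E4) (𝓡 4) f z b) :
      (L (f y₀)).symm (A (fun y ↦ A S y (v' y)) (f y₀) (u' (f y₀))) =
        fderiv ℝ (h b) y₀ a + α y₀ a (h b y₀) := by
    have e1 : (fun z ↦ (L (f z)).symm (A S (f z) (v' (f z)))) =ᶠ[𝓝 y₀] h b := by
      filter_upwards [hVn] with z hz using first v' b hb z hz
    have e2 : MDifferentiableAt (𝓡 4) 𝓘(ℝ, E3) (fun y ↦ (L y).symm (A S y (v' y))) (f y₀) := by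
      rw [hfx]
      have h1 : MDifferentiableAt (𝓡 4) 𝓘(ℝ, E3) (h b ∘ φ) x :=
        MDifferentiableAt.comp x (hd b).1.mdifferentiableAt
          (mdifferentiableAt_extChartAt (mem_chart_source E4 x))
      refine h1.congr_of_eventuallyEq ?_
      have hc : ContinuousAt φ x := continuousAt_extChartAt x
      filter_upwards [hc.eventually hVn, extChartAt_source_mem_nhds (I := 𝓡 4) x] with y hy hys
      have := first v' b hb (φ y) hy
      rw [← Function.comp_apply (f := h b)] at this
      rw [← this]
      have hfy : f (φ y) = y := φ.left_inv hys
      exact (congrArg (fun y ↦ (L y).symm (A S y (v' y))) hfy).symm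
    rw [ha y₀ hy₀V.1, hL'.symm_covariantDerivative_mfderiv A hU'o (hfd y₀ hy₀V) hy₀V.2 e2,
      e1.fderiv_eq, e1.eq_of_nhds]
  have hsymm : fderiv ℝ (fderiv ℝ τ) y₀ a b = fderiv ℝ (fderiv ℝ τ) y₀ b a :=
    (((hτs.contDiffAt hVn).isSymmSndFDerivAt (by
      rw [minSmoothness_of_isRCLikeNormedField]
      exact WithTop.coe_le_coe.mpr (le_top : (2 : ℕ∞) ≤ ⊤)))).eq a b
  have hτy : τ y₀ = σ := by
    have := congrArg (fun y ↦ (L y).symm (S y)) hfx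
    simp only [hS] at this
    rw [FiberBundle.extend_apply_self, LinearIsometryEquiv.symm_apply_apply] at this
    exact this
  have hfin : (L x).symm (bundleCurvature A x u v (L x σ)) =
      (L (f y₀)).symm (A (fun y ↦ A S y (v' y)) (f y₀) (u' (f y₀)))
      - (L (f y₀)).symm (A (fun y ↦ A S y (u' y)) (f y₀) (v' (f y₀))) := by
    have e := congrArg (fun y ↦ (L y).symm (A (fun y ↦ A S y (v' y)) y (u' y))
      - (L y).symm (A (fun y ↦ A S y (u' y)) y (v' y))) hfx
    refine Eq.trans ?_ e.symm
    have hux : u' x = u := FiberBundle.extend_apply_self ..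
    have hvx : v' x = v := FiberBundle.extend_apply_self ..
    simp only [hux, hvx]
    rw [← map_sub]
    congr 1
    change A (fun y ↦ A S y (v' y)) x u - A (fun y ↦ A S y (u' y)) x v
      - A S x (VectorField.mlieBracket (𝓡 4) u' v' x) = _
    rw [mlieBracket_extend, map_zero, sub_zero]
  rw [← LinearIsometryEquiv.symm_apply_eq, hfin, second u' v' a b ha hb, second v' u' b a hb ha,
    (hd b).2, (hd a).2, hsymm, hτy]
  simp only [h, hτy, pullCurv, map_add, add_apply, sub_apply, ContinuousLinearMap.comp_apply]
  abel

/-- The derivative of the pull-back `α ∘ dh` of a 1-form `α`; its second term is symmetric in `u` and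
`v`. -/
theorem fderiv_comp_comp {W : Type*} [NormedAddCommGroup W] [NormedSpace ℝ W] {F G : Type*}
    [NormedAddCommGroup F] [NormedSpace ℝ F] [NormedAddCommGroup G] [NormedSpace ℝ G]
    {α : F → F →L[ℝ] G} {h : W → F} {w : W} (hα : DifferentiableAt ℝ α (h w))
    (hh : ContDiffAt ℝ ∞ h w) (u v : W) :
    fderiv ℝ (fun w ↦ (α (h w)).comp (fderiv ℝ h w)) w u v =
      fderiv ℝ α (h w) (fderiv ℝ h w u) (fderiv ℝ h w v)
        + α (h w) (fderiv ℝ (fderiv ℝ h) w u v) := by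
  have h1 : DifferentiableAt ℝ h w := hh.differentiableAt (by simp)
  have h2 : DifferentiableAt ℝ (fderiv ℝ h) w :=
    (hh.fderiv_right (m := ∞) (by simp)).differentiableAt (by simp)
  have h3 : HasFDerivAt (fun w ↦ α (h w)) ((fderiv ℝ α (h w)).comp (fderiv ℝ h w)) w :=
    hα.hasFDerivAt.comp w h1.hasFDerivAt
  rw [(h3.clm_comp h2.hasFDerivAt).fderiv]
  simp [add_comm]

/-- The curvature of `A` is given by the forms `dα + α ∧ α`. -/
theorem bundleCurvature_mfderiv [T2Space X] (A : CovariantDerivative (𝓡 4) E3 E)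
    [A.ContMDiffCovariantDerivative ∞] (hL : IsSmoothFrame L U) (hU : IsOpen U)
    {W : Type*} [NormedAddCommGroup W] [NormedSpace ℝ W] [FiniteDimensional ℝ W] {f : W → X}
    {V : Set W} (hV : IsOpen V) (hf : ContMDiffOn 𝓘(ℝ, W) (𝓡 4) ∞ f V) {w : W} (hw : w ∈ V)
    (hwU : f w ∈ U) (u v : W) (σ : E3) :
    bundleCurvature A (f w) (mfderiv 𝓘(ℝ, W) (𝓡 4) f w u) (mfderiv 𝓘(ℝ, W) (𝓡 4) f w v)
      (L (f w) σ) = L (f w) (pullCurv A L f w u v σ) := by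
  set x := f w with hx
  set φ := extChartAt (𝓡 4) x with hφ
  set h : W → E4 := fun w ↦ φ (f w) with hh
  have hfw := hf.contMDiffAt (hV.mem_nhds hw)
  have hxs : x ∈ (chartAt E4 x).source := mem_chart_source E4 x
  have hV' : V ∩ f ⁻¹' φ.source ∈ 𝓝 w := (hf.continuousOn.isOpen_inter_preimage hV
    (isOpen_extChartAt_source x)).mem_nhds ⟨hw, mem_extChartAt_source x⟩
  have hhs {z : W} (hz : z ∈ V ∩ f ⁻¹' φ.source) : ContDiffAt ℝ ∞ h z :=
    ((contMDiffAt_extChartAt' (n := ∞) (by rw [← extChartAt_source (I := 𝓡 4)]; exact hz.2)).comp z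
      (hf.contMDiffAt (hV.mem_nhds hz.1))).contDiffAt
  have hwV' : w ∈ V ∩ f ⁻¹' φ.source := ⟨hw, mem_extChartAt_source x⟩
  have hd (u : W) : mfderiv (𝓡 4) 𝓘(ℝ, E4) φ x (mfderiv 𝓘(ℝ, W) (𝓡 4) f w u) = fderiv ℝ h w u := by
    let D : W →L[ℝ] TangentSpace (𝓡 4) (f w) := mfderiv 𝓘(ℝ, W) (𝓡 4) f w
    let D' : TangentSpace (𝓡 4) (f w) →L[ℝ] E4 := mfderiv (𝓡 4) 𝓘(ℝ, E4) φ x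
    have : HasFDerivAt h (D'.comp D) w :=
      ((mdifferentiableAt_extChartAt hxs).hasMFDerivAt.comp w
        (hfw.mdifferentiableAt (by simp)).hasMFDerivAt).hasFDerivAt
    rw [this.fderiv]
    rfl
  have hα : ContDiffOn ℝ ∞ (pullMat A L φ.symm) (φ.target ∩ φ.symm ⁻¹' U) :=
    hL.contDiffOn_pullMat A hU
      ((contMDiffOn_extChartAt_symm (n := ∞) x).continuousOn.isOpen_inter_preimage
        (isOpen_extChartAt_target x) hU) ((contMDiffOn_extChartAt_symm x).mono Set.inter_subset_left)
      fun _ hz ↦ hz.2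
  have hαd : DifferentiableAt ℝ (pullMat A L φ.symm) (h w) := by
    refine hα.differentiableAt_of_mem (((contMDiffOn_extChartAt_symm (n := ∞)
      x).continuousOn.isOpen_inter_preimage (isOpen_extChartAt_target x) hU).mem_nhds
      ⟨mem_extChartAt_target x, ?_⟩)
    rw [Set.mem_preimage, extChartAt_to_inv]
    exact hwU
  have hpull : pullMat A L f =ᶠ[𝓝 w] fun w ↦ (pullMat A L φ.symm (h w)).comp (fderiv ℝ h w) := by
    filter_upwards [eventually_mem_nhds_iff.mpr hV'] with z hz
    have hz' := mem_of_mem_nhds hz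
    rw [← pullMat_comp]
    · refine pullMat_congr A L ?_
      filter_upwards [hz] with y hy
      exact (φ.left_inv hy.2).symm
    · exact ((contMDiffOn_extChartAt_symm (n := ∞) x).contMDiffAt
        ((isOpen_extChartAt_target x).mem_nhds (φ.map_source hz'.2))).mdifferentiableAt (by simp)
    · exact (hhs hz').differentiableAt (by simp)
  have hsymm : fderiv ℝ (fderiv ℝ h) w u v = fderiv ℝ (fderiv ℝ h) w v u :=
    ((hhs hwV').isSymmSndFDerivAt (by
      rw [minSmoothness_of_isRCLikeNormedField]
      exact WithTop.coe_le_coe.mpr (le_top : (2 : ℕ∞) ≤ ⊤))).eq u v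
  rw [bundleCurvature_chart A hL hU hwU (fun z hz ↦ extend_eq_mfderiv x _ hz)
    (fun z hz ↦ extend_eq_mfderiv x _ hz), ← hφ, hd, hd]
  congr 1
  simp only [pullCurv]
  rw [hpull.fderiv_eq, hpull.eq_of_nhds, fderiv_comp_comp hαd (hhs hwV'),
    fderiv_comp_comp hαd (hhs hwV'), hsymm]
  simp only [ContinuousLinearMap.comp_apply, add_apply, sub_apply, h]
  abel

/-! ### The curvature as a 2-form with values in `ℝ³` -/

theorem IsSmoothFrame.inner_pullMat (A : CovariantDerivative (𝓡 4) E3 E)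
    (hA : A.IsMetricCompatible) (hL : IsSmoothFrame L U) (hU : IsOpen U)
    {W : Type*} [NormedAddCommGroup W] [NormedSpace ℝ W] {f : W → X} {w : W} (hw : f w ∈ U)
    (u : W) (b c : E3) : inner ℝ (pullMat A L f w u b) c = -inner ℝ b (pullMat A L f w u c) :=
  hL.inner_connMat A hA hU hw _ b c

/-- The curvature matrix of a metric connection is skew. -/
theorem IsSmoothFrame.inner_pullCurv [T2Space X] (A : CovariantDerivative (𝓡 4) E3 E)
    [A.ContMDiffCovariantDerivative ∞] (hA : A.IsMetricCompatible) (hL : IsSmoothFrame L U)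
    (hU : IsOpen U) {W : Type*} [NormedAddCommGroup W] [NormedSpace ℝ W] [FiniteDimensional ℝ W]
    {f : W → X} {V : Set W} (hV : IsOpen V) (hf : ContMDiffOn 𝓘(ℝ, W) (𝓡 4) ∞ f V)
    (hfU : Set.MapsTo f V U) {w : W} (hw : w ∈ V) (u v : W) (b c : E3) :
    inner ℝ (pullCurv A L f w u v b) c = -inner ℝ b (pullCurv A L f w u v c) := by
  have hd := (hL.contDiffOn_pullMat A hU hV hf hfU).differentiableAt_of_mem (hV.mem_nhds hw)
  have d1 (v : W) : DifferentiableAt ℝ (fun w ↦ pullMat A L f w v) w :=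
    hd.clm_apply (differentiableAt_const v)
  have d2 (v : W) (b : E3) : DifferentiableAt ℝ (fun w ↦ pullMat A L f w v b) w :=
    (d1 v).clm_apply (differentiableAt_const b)
  have h1 (u v : W) (b : E3) : fderiv ℝ (fun w ↦ pullMat A L f w v b) w u =
      fderiv ℝ (pullMat A L f) w u v b := by
    rw [fderiv_clm_apply (d1 v) (differentiableAt_const b),
      fderiv_clm_apply hd (differentiableAt_const v)]
    simp
  have key (u v : W) : inner ℝ (fderiv ℝ (pullMat A L f) w u v b) c
      = -inner ℝ b (fderiv ℝ (pullMat A L f) w u v c) := by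
    have h2 : fderiv ℝ (fun w ↦ (inner ℝ (pullMat A L f w v b) c : ℝ)
        + inner ℝ b (pullMat A L f w v c)) w u = 0 := by
      have : (fun w ↦ (inner ℝ (pullMat A L f w v b) c : ℝ) + inner ℝ b (pullMat A L f w v c))
          =ᶠ[𝓝 w] fun _ ↦ 0 := by
        filter_upwards [hV.mem_nhds hw] with z hz
        rw [hL.inner_pullMat A hA hU (hfU hz)]
        ring
      rw [this.fderiv_eq]
      simp
    rw [fderiv_fun_add ((d2 v b).inner ℝ (differentiableAt_const c))
      ((differentiableAt_const b).inner ℝ (d2 v c)), add_apply,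
      fderiv_inner_apply ℝ (d2 v b) (differentiableAt_const c),
      fderiv_inner_apply ℝ (differentiableAt_const b) (d2 v c),
      h1, h1] at h2
    simp at h2
    linarith
  have hs := fun u b c ↦ hL.inner_pullMat A hA hU (hfU hw) u b c
  simp only [pullCurv, add_apply, sub_apply, ContinuousLinearMap.comp_apply, inner_add_left,
    inner_sub_left, inner_add_right, inner_sub_right, key, hs]
  ring

theorem pullCurv_swap (A : CovariantDerivative (𝓡 4) E3 E) (L : ∀ x, E3 ≃ₗᵢ[ℝ] E x)
    {W : Type*} [NormedAddCommGroup W] [NormedSpace ℝ W] (f : W → X) (w u v : W) :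
    pullCurv A L f w v u = -pullCurv A L f w u v := by
  rw [pullCurv, pullCurv]
  abel

theorem pullCurv_add_left (A : CovariantDerivative (𝓡 4) E3 E) (L : ∀ x, E3 ≃ₗᵢ[ℝ] E x)
    {W : Type*} [NormedAddCommGroup W] [NormedSpace ℝ W] (f : W → X) (w u u' v : W) :
    pullCurv A L f w (u + u') v = pullCurv A L f w u v + pullCurv A L f w u' v := by
  rw [pullCurv, pullCurv, pullCurv, ContinuousLinearMap.map_add, ContinuousLinearMap.map_add,
    ContinuousLinearMap.map_add, add_apply, ContinuousLinearMap.add_comp,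
    ContinuousLinearMap.comp_add]
  abel

theorem pullCurv_smul_left (A : CovariantDerivative (𝓡 4) E3 E) (L : ∀ x, E3 ≃ₗᵢ[ℝ] E x)
    {W : Type*} [NormedAddCommGroup W] [NormedSpace ℝ W] (f : W → X) (w : W) (c : ℝ) (u v : W) :
    pullCurv A L f w (c • u) v = c • pullCurv A L f w u v := by
  rw [pullCurv, pullCurv, ContinuousLinearMap.map_smul, ContinuousLinearMap.map_smul,
    ContinuousLinearMap.map_smul, smul_apply, ContinuousLinearMap.smul_comp,
    ContinuousLinearMap.comp_smul, smul_sub, smul_add, smul_sub]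

theorem crossE_eq_crossOf (p s : E3) :
    crossOf (by simp) (EuclideanSpace.basisFun (Fin 3) ℝ).toBasis.orientation p s = crossE p s := by
  obtain ⟨ε, -, h1, h2⟩ := exists_cross_sign (T := E3) (by simp)
    (EuclideanSpace.basisFun (Fin 3) ℝ).toBasis.orientation (LinearIsometryEquiv.refl ℝ E3)
  have := h2 p s
  rw [h1, one_smul] at this
  · exact this
  · congr 1

/-- An isometry of a fibre with `ℝ³` extends to a local smooth orthonormal frame, whose
orientation is constant. -/
theorem IsBundleOrientation.exists_frame_through (ho : IsBundleOrientation o) (x : X)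
    (ℓ : E3 ≃ₗᵢ[ℝ] E x) : ∃ U : Set X, IsOpen U ∧ x ∈ U ∧ ∃ L : ∀ x, E3 ≃ₗᵢ[ℝ] E x,
      IsSmoothFrame L U ∧ L x = ℓ ∧ ∃ ε : ℝ, ε * ε = 1 ∧
        ∀ y ∈ U, ∀ p s, cross o (L y p) (L y s) = ε • L y (crossE p s) := by
  obtain ⟨U, hU, hx, L, hL, hp⟩ := ho.exists_isPositiveFrame x
  let g : E3 ≃ₗᵢ[ℝ] E3 := ℓ.trans (L x).symm
  obtain ⟨ε, hε, -, h⟩ := exists_cross_sign (T := E3) (by simp)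
    (EuclideanSpace.basisFun (Fin 3) ℝ).toBasis.orientation g
  refine ⟨U, hU, hx, fun y ↦ g.trans (L y), fun u ↦ hL (g u), ?_, ε, hε, fun y hy p s ↦ ?_⟩
  · ext u; simp [g]
  · have := h p s
    rw [crossE_eq_crossOf] at this
    simp [hp y hy, this]

/-- The curvature at `x`, as a 2-form with values in `ℝ³ ≅ so(3)`. -/
theorem exists_curvature_vector [T2Space X] (ho : IsBundleOrientation o)
    (A : CovariantDerivative (𝓡 4) E3 E) [A.ContMDiffCovariantDerivative ∞]
    (hA : A.IsMetricCompatible) (x : X) (ℓ : E3 ≃ₗᵢ[ℝ] E x) :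
    ∃ β : TangentSpace (𝓡 4) x →ₗ[ℝ] TangentSpace (𝓡 4) x →ₗ[ℝ] E3, (∀ u v, β u v = -β v u) ∧
      (∀ u v σ, bundleCurvature A x u v (ℓ σ) = ℓ (crossE (β u v) σ)) ∧
      ∀ k u v, curvatureComponent A x ℓ k u v = β u v k := by
  obtain ⟨U, hU, hx, L, hL, rfl, -⟩ := ho.exists_frame_through x ℓ
  set φ := extChartAt (𝓡 4) x
  let a : TangentSpace (𝓡 4) x →L[ℝ] E4 := mfderiv (𝓡 4) 𝓘(ℝ, E4) φ x
  have hR (u v : TangentSpace (𝓡 4) x) (σ : E3) : bundleCurvature A x u v (L x σ) =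
      L x (pullCurv A L φ.symm (φ x) (a u) (a v) σ) :=
    bundleCurvature_chart A hL hU hx (fun z hz ↦ extend_eq_mfderiv x u hz)
      (fun z hz ↦ extend_eq_mfderiv x v hz) σ
  have hf : ContMDiffOn 𝓘(ℝ, E4) (𝓡 4) ∞ φ.symm φ.target := contMDiffOn_extChartAt_symm x
  have hV : IsOpen (φ.target ∩ φ.symm ⁻¹' U) :=
    hf.continuousOn.isOpen_inter_preimage (isOpen_extChartAt_target x) hU
  have hxV : φ x ∈ φ.target ∩ φ.symm ⁻¹' U := ⟨mem_extChartAt_target x, by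
    rw [Set.mem_preimage, extChartAt_to_inv]; exact hx⟩
  have hskew (u v : E4) := fun b c ↦ hL.inner_pullCurv A hA hU hV (hf.mono Set.inter_subset_left)
    (fun _ hz ↦ hz.2) hxV u v b c
  let β (u v : TangentSpace (𝓡 4) x) : E3 :=
    WithLp.toLp 2 fun k ↦ curvatureComponent A x (L x) k u v
  have hβ (u v : TangentSpace (𝓡 4) x) (σ : E3) :
      bundleCurvature A x u v (L x σ) = L x (crossE (β u v) σ) := by
    obtain ⟨f, hf, hf'⟩ := eq_crossE_of_skew _ (hskew (a u) (a v))
    have : f = β u v := by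
      ext k
      rw [hf k]
      simp only [β, curvatureComponent, hR, LinearIsometryEquiv.inner_map_map]
    rw [hR, hf', this]
  have hk (k : Fin 3) (u v : TangentSpace (𝓡 4) x) : β u v k =
      inner ℝ (pullCurv A L φ.symm (φ x) (a u) (a v) (EuclideanSpace.single (k + 1) 1))
        (EuclideanSpace.single (k + 2) 1) := by
    simp only [β, curvatureComponent, hR, LinearIsometryEquiv.inner_map_map]
  refine ⟨LinearMap.mk₂ ℝ β ?_ ?_ ?_ ?_, fun u v ↦ ?_, hβ, fun k u v ↦ rfl⟩
  · intro u u' v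
    ext k
    rw [PiLp.add_apply, hk, hk, hk, ← inner_add_left, a.map_add, pullCurv_add_left, add_apply]
  · intro c u v
    ext k
    rw [PiLp.smul_apply, hk, hk, smul_eq_mul, ← real_inner_smul_left, a.map_smul,
      pullCurv_smul_left, smul_apply]
  · intro u v v'
    ext k
    rw [PiLp.add_apply, hk, hk, hk, ← inner_add_left, a.map_add, pullCurv_swap, pullCurv_add_left,
      pullCurv_swap A L _ _ (a v), pullCurv_swap A L _ _ (a v'), neg_add, add_apply]
  · intro c u v
    ext k
    rw [PiLp.smul_apply, hk, hk, smul_eq_mul, ← real_inner_smul_left, a.map_smul,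
      pullCurv_swap, pullCurv_smul_left, pullCurv_swap A L _ _ (a v), neg_apply, neg_apply, smul_neg,
      smul_apply]
  · ext k
    simp only [LinearMap.mk₂_apply]
    rw [PiLp.neg_apply, hk, hk, ← inner_neg_left, pullCurv_swap, neg_apply]

/-- For a definite connection all the 2-forms `⟪F, p⟫` are non-degenerate. If `F(u, ·)` takes values in
`p^⊥`, then its kernel has dimension at least two and so contains a vector independent of `u`. -/
theorem curvature_nondegenerate [T2Space X] (A : CovariantDerivative (𝓡 4) E3 E)
    (hdef : IsDefinite A) {x : X} {ℓ : E3 ≃ₗᵢ[ℝ] E x}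
    {β : TangentSpace (𝓡 4) x →ₗ[ℝ] TangentSpace (𝓡 4) x →ₗ[ℝ] E3}
    (hβ : ∀ u v σ, bundleCurvature A x u v (ℓ σ) = ℓ (crossE (β u v) σ)) {p : E3} (hp : p ≠ 0)
    {u : TangentSpace (𝓡 4) x} (hu : ∀ v, inner ℝ (β u v) p = (0 : ℝ)) : u = 0 := by
  by_contra hu0
  have : FiniteDimensional ℝ (TangentSpace (𝓡 4) x) := inferInstanceAs (FiniteDimensional ℝ E4)
  have hT : Module.finrank ℝ (TangentSpace (𝓡 4) x) = 4 :=
    (finrank_euclideanSpace_fin : Module.finrank ℝ E4 = 4)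
  have hr : LinearMap.range (β u) ≤ (Submodule.span ℝ {p})ᗮ := by
    rintro _ ⟨v, rfl⟩
    rw [Submodule.mem_orthogonal_singleton_iff_inner_left]
    exact hu v
  have : Fact (Module.finrank ℝ E3 = 2 + 1) := ⟨by simp⟩
  have h1 := Submodule.finrank_mono hr
  rw [Submodule.finrank_orthogonal_span_singleton (n := 2) hp] at h1
  have h2 := LinearMap.finrank_range_add_finrank_ker (β u)
  have h3 : ¬ LinearMap.ker (β u) ≤ Submodule.span ℝ {u} := fun h ↦ by
    have := Submodule.finrank_mono h
    rw [finrank_span_singleton hu0] at this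
    omega
  obtain ⟨v, hv, hvu⟩ := SetLike.not_le_iff_exists.mp h3
  obtain ⟨σ, hσ⟩ := hdef x u v ((LinearIndependent.pair_iff' hu0).mpr fun a ha ↦
    hvu (ha ▸ Submodule.smul_mem _ a (Submodule.mem_span_singleton_self u)))
  apply hσ
  obtain ⟨τ, rfl⟩ := ℓ.surjective σ
  rw [hβ, LinearMap.mem_ker.mp hv]
  have : crossE 0 τ = 0 := by apply ext_E3 <;> simp
  rw [this, map_zero]

/-! ### The curvature form of the induced connection -/

section CurvatureForm

variable {W : Type} [NormedAddCommGroup W] [NormedSpace ℝ W] [FiniteDimensional ℝ W]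
  {ψ : W → FramePoint E} {V : Set W}

/-- The components of the point of the sphere in a frame. -/
noncomputable abbrev posIn (L : ∀ x, E3 ≃ₗᵢ[ℝ] E x) (ψ : W → FramePoint E) (w : W) : E3 :=
  (L (ψ w).pt).symm (ψ w).pos

/-- The components of the unit tangent vector in a frame. -/
noncomputable abbrev vecIn (L : ∀ x, E3 ≃ₗᵢ[ℝ] E x) (ψ : W → FramePoint E) (w : W) : E3 :=
  (L (ψ w).pt).symm (ψ w).vec

/-- The covariant derivative of the point of the sphere, in a frame. -/
noncomputable def covPos (A : CovariantDerivative (𝓡 4) E3 E) (L : ∀ x, E3 ≃ₗᵢ[ℝ] E x)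
    (ψ : W → FramePoint E) (w : W) : W →ₗ[ℝ] E3 where
  toFun u := fderiv ℝ (posIn L ψ) w u + pullMat A L (fun w ↦ (ψ w).pt) w u (posIn L ψ w)
  map_add' u v := by
    rw [ContinuousLinearMap.map_add, ContinuousLinearMap.map_add, add_apply]
    abel
  map_smul' c u := by
    rw [ContinuousLinearMap.map_smul, ContinuousLinearMap.map_smul, smul_apply, RingHom.id_apply,
      smul_add]

theorem inner_crossE_crossE_of_orthonormal {f p s : E3} (hs : ‖s‖ = 1) (h : inner ℝ p s = 0) :
    inner ℝ (crossE f s) (crossE p s) = (inner ℝ f p : ℝ) := by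
  rw [inner_crossE_crossE, real_inner_self_eq_norm_sq, hs, real_inner_comm p s, h]
  ring

/-- The curvature form of the induced connection: the area form of the fibre on the vertical parts,
minus the component of the curvature of `A` in the direction of the point of the sphere. -/
theorem curvatureForm_inducedConnection [T2Space X] (A : CovariantDerivative (𝓡 4) E3 E)
    [A.ContMDiffCovariantDerivative ∞] (hA : A.IsMetricCompatible) (hL : IsSmoothFrame L U)
    (hU : IsOpen U) (hp : IsPositiveFrame o L U) (hψ : IsUnitFamily ψ V) {w : W} (hw : w ∈ V)
    (hwU : (ψ w).pt ∈ U)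
    {β : TangentSpace (𝓡 4) (ψ w).pt →ₗ[ℝ] TangentSpace (𝓡 4) (ψ w).pt →ₗ[ℝ] E3}
    (hβ : ∀ u v σ, bundleCurvature A (ψ w).pt u v (L (ψ w).pt σ) =
      L (ψ w).pt (crossE (β u v) σ)) (u v : W) :
    curvatureForm (inducedConnection o A) ψ w u v = (1 / (2 * Real.pi)) *
      (inner ℝ (vecIn L ψ w) (covPos A L ψ w u)
          * inner ℝ (crossE (posIn L ψ w) (vecIn L ψ w)) (covPos A L ψ w v)
        - inner ℝ (vecIn L ψ w) (covPos A L ψ w v)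
          * inner ℝ (crossE (posIn L ψ w) (vecIn L ψ w)) (covPos A L ψ w u)
        - inner ℝ (β (mfderiv 𝓘(ℝ, W) (𝓡 4) (fun w ↦ (ψ w).pt) w u)
            (mfderiv 𝓘(ℝ, W) (𝓡 4) (fun w ↦ (ψ w).pt) w v)) (posIn L ψ w)) := by
  have hV := hψ.isOpen_inter hU
  have hw' : w ∈ V ∩ (fun w ↦ (ψ w).pt) ⁻¹' U := ⟨hw, hwU⟩
  have hn (w : W) (hw : w ∈ V) : ‖posIn L ψ w‖ = 1 ∧ ‖vecIn L ψ w‖ = 1 ∧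
      inner ℝ (posIn L ψ w) (vecIn L ψ w) = 0 := by
    simpa using hψ.2.1 w hw
  have hd := fderiv_connForm_sub hV (hψ.contDiffOn_pos hL hU) (hψ.contDiffOn_vec hL hU)
    (contDiffOn_crossE (hψ.contDiffOn_pos hL hU) (hψ.contDiffOn_vec hL hU))
    (hL.contDiffOn_pullMat A hU hV (hψ.contMDiffOn_pt.mono Set.inter_subset_left)
      fun _ hw ↦ hw.2)
    (fun w hw u b c ↦ hL.inner_pullMat A hA hU (f := fun w ↦ (ψ w).pt) hw.2 u b c)
    (fun w hw ↦ (hn w hw.1).1) (fun w hw ↦ (hn w hw.1).2.1) (fun w hw ↦ (hn w hw.1).2.2)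
    (fun _ _ ↦ rfl) (hψ.contDiffOn_form A hL hU hp)
    (fun w hw u ↦ hψ.form_eq A hL hU hp hw u) hw' u v
  have hc := bundleCurvature_mfderiv A hL hU hψ.1 hψ.contMDiffOn_pt hw hwU u v (vecIn L ψ w)
  rw [hβ] at hc
  have hc' := (L (ψ w).pt).injective hc
  rw [curvatureForm, hd]
  have e : inner ℝ (fderiv ℝ (pullMat A L fun w ↦ (ψ w).pt) w u v (vecIn L ψ w)
      - fderiv ℝ (pullMat A L fun w ↦ (ψ w).pt) w v u (vecIn L ψ w)
      + pullMat A L (fun w ↦ (ψ w).pt) w u (pullMat A L (fun w ↦ (ψ w).pt) w v (vecIn L ψ w))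
      - pullMat A L (fun w ↦ (ψ w).pt) w v (pullMat A L (fun w ↦ (ψ w).pt) w u (vecIn L ψ w)))
      (crossE (posIn L ψ w) (vecIn L ψ w)) =
      inner ℝ (β (mfderiv 𝓘(ℝ, W) (𝓡 4) (fun w ↦ (ψ w).pt) w u)
            (mfderiv 𝓘(ℝ, W) (𝓡 4) (fun w ↦ (ψ w).pt) w v)) (posIn L ψ w) := by
    rw [← inner_crossE_crossE_of_orthonormal (hn w hw).2.1 (hn w hw).2.2, hc']
    rfl
  rw [e]
  simp only [covPos, LinearMap.coe_mk, AddHom.coe_mk]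
  ring

/-- The base component `dx` and the two vertical components `m`, `n` of a tangent vector of `Z` are
coordinates on the tangent space, in which `2π ω` is the sum of `m ∧ n` and of a non-degenerate form
in `dx`. -/
theorem isNondegenerate_inducedConnection [T2Space X] (ho : IsBundleOrientation o)
    (A : CovariantDerivative (𝓡 4) E3 E) [A.ContMDiffCovariantDerivative ∞]
    (hA : A.IsMetricCompatible) (hdef : IsDefinite A) :
    IsNondegenerate (inducedConnection o A) := by
  intro W _ _ _ ψ V hW hψ w hw hinj u hu
  obtain ⟨U, hU, hxU, L, hL, hp⟩ := ho.exists_isPositiveFrame (ψ w).pt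
  obtain ⟨β, -, hβ, -⟩ := exists_curvature_vector ho A hA (ψ w).pt (L (ψ w).pt)
  have hF := curvatureForm_inducedConnection A hA hL hU hp hψ hw hxU hβ
  have hw' : w ∈ V ∩ (fun w ↦ (ψ w).pt) ⁻¹' U := ⟨hw, hxU⟩
  have hVn := (hψ.isOpen_inter hU).mem_nhds hw'
  have hpd := (hψ.contDiffOn_pos hL hU).differentiableAt_of_mem hVn
  have hxd : MDifferentiableAt 𝓘(ℝ, W) (𝓡 4) (fun w ↦ (ψ w).pt) w :=
    (hψ.contMDiffOn_pt.contMDiffAt (hψ.1.mem_nhds hw)).mdifferentiableAt (by simp)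
  have hn (w : W) (hw : w ∈ V) : ‖posIn L ψ w‖ = 1 ∧ ‖vecIn L ψ w‖ = 1 ∧
      inner ℝ (posIn L ψ w) (vecIn L ψ w) = 0 := by
    simpa using hψ.2.1 w hw
  obtain ⟨hp1, hs1, hps⟩ := hn w hw
  let dx : W →L[ℝ] E4 := mfderiv 𝓘(ℝ, W) (𝓡 4) (fun w ↦ (ψ w).pt) w
  let m : W →ₗ[ℝ] ℝ := (innerₗ E3 (vecIn L ψ w)).comp (covPos A L ψ w)
  let n : W →ₗ[ℝ] ℝ := (innerₗ E3 (crossE (posIn L ψ w) (vecIn L ψ w))).comp (covPos A L ψ w)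
  let T : W →ₗ[ℝ] E4 × ℝ × ℝ := (dx : W →ₗ[ℝ] E4).prod (m.prod n)
  have hTinj : Function.Injective T := by
    rw [← LinearMap.ker_eq_bot, LinearMap.ker_eq_bot']
    intro v hv
    have hdx : dx v = 0 := congrArg Prod.fst hv
    have hm : inner ℝ (vecIn L ψ w) (covPos A L ψ w v) = (0 : ℝ) :=
      congrArg (fun z ↦ z.2.1) hv
    have hnn : inner ℝ (crossE (posIn L ψ w) (vecIn L ψ w)) (covPos A L ψ w v) = (0 : ℝ) :=
      congrArg (fun z ↦ z.2.2) hv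
    have hpp : inner ℝ (posIn L ψ w) (covPos A L ψ w v) = (0 : ℝ) := by
      have := inner_covDeriv_add hpd hpd (c := 1) (by
        filter_upwards [hψ.1.mem_nhds hw] with z hz
        rw [real_inner_self_eq_norm_sq, (hn z hz).1]; norm_num)
        (pullMat A L (fun w ↦ (ψ w).pt) w v)
        (hL.inner_pullMat A hA hU (f := fun w ↦ (ψ w).pt) hxU v) v
      rw [real_inner_comm] at this
      change inner ℝ (posIn L ψ w) (covPos A L ψ w v) + inner ℝ (posIn L ψ w) (covPos A L ψ w v) = 0
        at this
      linarith
    have hD : covPos A L ψ w v = 0 := by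
      have := inner_eq_of_orthonormal hp1 hs1 hps (covPos A L ψ w v) (covPos A L ψ w v)
      rw [real_inner_comm, real_inner_comm (vecIn L ψ w), hm,
        real_inner_comm (posIn L ψ w), hpp, real_inner_comm (crossE _ _), hnn] at this
      simpa using this
    have hα : pullMat A L (fun w ↦ (ψ w).pt) w v = 0 := by
      change connMat A L _ (dx v) = 0
      rw [hdx]
      exact ContinuousLinearMap.map_zero _
    have hDp : fderiv ℝ (posIn L ψ) w v = 0 := by
      have : fderiv ℝ (posIn L ψ) w v + pullMat A L (fun w ↦ (ψ w).pt) w v (posIn L ψ w) = 0 := hD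
      rwa [hα, zero_apply, add_zero] at this
    -- the map to `Z` factors through the base point and the components in the frame
    apply hinj
    let M : W →L[ℝ] E4 × E3 := mfderiv 𝓘(ℝ, W) ((𝓡 4).prod 𝓘(ℝ, E3))
      (fun w' ↦ (⟨(ψ w').pt, (ψ w').pos⟩ : TotalSpace E3 E)) w
    change M v = M 0
    rw [M.map_zero]
    change (mfderiv 𝓘(ℝ, W) ((𝓡 4).prod 𝓘(ℝ, E3))
      (fun w' ↦ (⟨(ψ w').pt, (ψ w').pos⟩ : TotalSpace E3 E)) w v : E4 × E3) = 0
    let G : X × E3 → TotalSpace E3 E := fun z ↦ ⟨z.1, L z.1 z.2⟩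
    have hG : MDifferentiableAt ((𝓡 4).prod 𝓘(ℝ, E3)) ((𝓡 4).prod 𝓘(ℝ, E3)) G
        ((ψ w).pt, posIn L ψ w) :=
      (hL.contMDiffAt_comp hU (f := Prod.fst) (σ := Prod.snd) contMDiffAt_fst hxU
        contMDiffAt_snd).mdifferentiableAt (by simp)
    have hpair := hxd.hasMFDerivAt.prodMk hpd.hasFDerivAt.hasMFDerivAt
    have hcomp := HasMFDerivAt.comp w (I := 𝓘(ℝ, W)) hG.hasMFDerivAt hpair
    have heq : (fun w' ↦ (⟨(ψ w').pt, (ψ w').pos⟩ : TotalSpace E3 E)) =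
        G ∘ fun w ↦ ((ψ w).pt, posIn L ψ w) := by
      funext w'
      simp [G, posIn]
    rw [heq, hcomp.mfderiv]
    have h0 : ((mfderiv 𝓘(ℝ, W) (𝓡 4) (fun w ↦ (ψ w).pt) w v, fderiv ℝ (posIn L ψ) w v) :
        E4 × E3) = 0 := Prod.ext hdx hDp
    let D : E4 × E3 →L[ℝ] E4 × E3 := mfderiv ((𝓡 4).prod 𝓘(ℝ, E3)) ((𝓡 4).prod 𝓘(ℝ, E3)) G
      ((ψ w).pt, posIn L ψ w)
    exact (congrArg D h0).trans D.map_zero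
  have hTs : Function.Surjective T := by
    refine (LinearMap.injective_iff_surjective_of_finrank_eq_finrank ?_).mp hTinj
    rw [hW]
    simp
  let β' : E4 →ₗ[ℝ] E4 →ₗ[ℝ] E3 := β
  have hF' (v : W) : m u * n v - m v * n u - inner ℝ (β' (dx u) (dx v)) (posIn L ψ w) = 0 := by
    have := hu v
    rw [hF] at this
    exact (mul_eq_zero.mp this).resolve_left (by positivity)
  have hmu : m u = 0 := by
    obtain ⟨v, hv⟩ := hTs (0, 0, 1)
    have h1 : dx v = 0 := congrArg Prod.fst hv
    have h2 : m v = 0 := congrArg (fun z ↦ z.2.1) hv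
    have h3 : n v = 1 := congrArg (fun z ↦ z.2.2) hv
    have := hF' v
    rw [h1, h2, h3, LinearMap.map_zero, inner_zero_left] at this
    linarith
  have hnu : n u = 0 := by
    obtain ⟨v, hv⟩ := hTs (0, 1, 0)
    have h1 : dx v = 0 := congrArg Prod.fst hv
    have h2 : m v = 1 := congrArg (fun z ↦ z.2.1) hv
    have h3 : n v = 0 := congrArg (fun z ↦ z.2.2) hv
    have := hF' v
    rw [h1, h2, h3, LinearMap.map_zero, inner_zero_left] at this
    linarith
  have hdu : dx u = 0 := by
    refine curvature_nondegenerate A hdef hβ (p := posIn L ψ w) (u := dx u) ?_ fun e ↦ ?_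
    · intro h; rw [h, norm_zero] at hp1; exact zero_ne_one hp1
    · obtain ⟨v, hv⟩ := hTs (e, 0, 0)
      have h1 : dx v = e := congrArg Prod.fst hv
      have := hF' v
      rw [h1, hmu, hnu] at this
      change inner ℝ (β' (dx u) e) (posIn L ψ w) = 0
      linarith
  apply hTinj
  rw [map_zero]
  exact Prod.ext hdu (Prod.ext hmu hnu)

end CurvatureForm

/-! ### The Gram-Schmidt process -/

/-- The first vector of the Gram-Schmidt process in `ℝ³`. -/
noncomputable def gsPos (u : E3) : E3 := ‖u‖⁻¹ • u

/-- The component of `a` orthogonal to `u`. -/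
noncomputable def gsRej (u a : E3) : E3 := a - (inner ℝ (gsPos u) a : ℝ) • gsPos u

/-- The second vector of the Gram-Schmidt process in `ℝ³`. -/
noncomputable def gsVec (u a : E3) : E3 := ‖gsRej u a‖⁻¹ • gsRej u a

theorem orthonormalize_map (x : X) (ℓ : E3 ≃ₗᵢ[ℝ] E x) (u a : E3) :
    orthonormalize x (ℓ u) (ℓ a) = ⟨x, ℓ (gsPos u), ℓ (gsVec u a)⟩ := by
  have h1 : ‖ℓ u‖⁻¹ • ℓ u = ℓ (gsPos u) := by
    rw [ℓ.norm_map, gsPos, map_smul]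
  have h2 : ℓ a - (inner ℝ (ℓ (gsPos u)) (ℓ a) : ℝ) • ℓ (gsPos u) = ℓ (gsRej u a) := by
    rw [ℓ.inner_map_map, gsRej, map_sub, map_smul]
  rw [orthonormalize]
  congr 1
  simp only [h1, h2]
  rw [ℓ.norm_map, gsVec, map_smul]

theorem norm_gsPos {u : E3} (hu : u ≠ 0) : ‖gsPos u‖ = 1 := by
  rw [gsPos, norm_smul, norm_inv, norm_norm, inv_mul_cancel₀ (norm_ne_zero_iff.mpr hu)]

theorem inner_gsPos_gsVec {u : E3} (hu : u ≠ 0) (a : E3) :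
    inner ℝ (gsPos u) (gsVec u a) = (0 : ℝ) := by
  rw [gsVec, gsRej, real_inner_smul_right, inner_sub_right, real_inner_smul_right,
    real_inner_self_eq_norm_sq, norm_gsPos hu]
  ring

theorem norm_gsVec {u a : E3} (h : gsRej u a ≠ 0) : ‖gsVec u a‖ = 1 := by
  rw [gsVec, norm_smul, norm_inv, norm_norm, inv_mul_cancel₀ (norm_ne_zero_iff.mpr h)]

theorem gsPos_of_norm_eq_one {p : E3} (hp : ‖p‖ = 1) : gsPos p = p := by
  rw [gsPos, hp, inv_one, one_smul]

theorem gsRej_of_orthonormal {p s : E3} (hp : ‖p‖ = 1) (h : inner ℝ p s = (0 : ℝ)) :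
    gsRej p s = s := by
  rw [gsRej, gsPos_of_norm_eq_one hp, h, zero_smul, sub_zero]

theorem gsVec_of_orthonormal {p s : E3} (hp : ‖p‖ = 1) (hs : ‖s‖ = 1)
    (h : inner ℝ p s = (0 : ℝ)) : gsVec p s = s := by
  rw [gsVec, gsRej_of_orthonormal hp h, hs, inv_one, one_smul]

theorem contDiffAt_gsPos {u : E3} (hu : u ≠ 0) : ContDiffAt ℝ ∞ gsPos u :=
  ((contDiffAt_norm ℝ hu).inv (norm_ne_zero_iff.mpr hu)).smul contDiffAt_id

theorem contDiffAt_gsRej {u : E3} (hu : u ≠ 0) (a : E3) :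
    ContDiffAt ℝ ∞ (fun z : E3 × E3 ↦ gsRej z.1 z.2) (u, a) := by
  have h1 : ContDiffAt ℝ ∞ (fun z : E3 × E3 ↦ gsPos z.1) (u, a) :=
    ContDiffAt.comp (u, a) (f := Prod.fst) (contDiffAt_gsPos hu) contDiffAt_fst
  exact contDiffAt_snd.sub ((h1.inner ℝ contDiffAt_snd).smul h1)

theorem contDiffAt_gsVec {u a : E3} (hu : u ≠ 0) (h : gsRej u a ≠ 0) :
    ContDiffAt ℝ ∞ (fun z : E3 × E3 ↦ gsVec z.1 z.2) (u, a) :=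
  (((contDiffAt_gsRej hu a).norm ℝ h).inv (norm_ne_zero_iff.mpr h)).smul (contDiffAt_gsRej hu a)

/-- The derivative of normalization is the orthogonal projection onto the tangent plane. -/
theorem fderiv_gsPos {p : E3} (hp : ‖p‖ = 1) (a : E3) :
    fderiv ℝ gsPos p a = a - (inner ℝ p a : ℝ) • p := by
  have hp0 : p ≠ 0 := by rintro rfl; simp at hp
  have hN : HasFDerivAt (fun u : E3 ↦ ‖u‖) (fderiv ℝ (fun u : E3 ↦ ‖u‖) p) p :=
    ((contDiffAt_norm ℝ hp0).differentiableAt (n := 1) one_ne_zero).hasFDerivAt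
  have hN' : fderiv ℝ (fun u : E3 ↦ ‖u‖) p a = inner ℝ p a := by
    have h1 := (hN.pow 2).unique (hasStrictFDerivAt_norm_sq p).hasFDerivAt
    have h2 := congrArg (fun T : E3 →L[ℝ] ℝ ↦ T a) h1
    simpa [hp] using h2
  have h1 : HasFDerivAt (fun u : E3 ↦ ‖u‖⁻¹) _ p :=
    (hasDerivAt_inv (norm_ne_zero_iff.mpr hp0)).comp_hasFDerivAt p hN
  have h2 : HasFDerivAt gsPos _ p := h1.smul (hasFDerivAt_id p)
  rw [h2.fderiv]
  simp [hN', hp, sub_eq_add_neg]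

/-- To first order, the Gram-Schmidt process does not change the component of the second vector
in the direction orthogonal to both vectors. -/
theorem inner_deriv_gsVec {u a : ℝ → E3} {u' a' q : E3} (hu : HasDerivAt u u' 0)
    (ha : HasDerivAt a a' 0) (hp : ‖u 0‖ = 1) (hs : ‖a 0‖ = 1) (h : inner ℝ (u 0) (a 0) = (0 : ℝ))
    (hq : inner ℝ q (u 0) = (0 : ℝ)) (hq' : inner ℝ q (a 0) = (0 : ℝ)) :
    DifferentiableAt ℝ (fun t ↦ gsVec (u t) (a t)) 0 ∧
      inner ℝ q (deriv (fun t ↦ gsVec (u t) (a t)) 0) = (inner ℝ q a' : ℝ) := by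
  have hu0 : u 0 ≠ 0 := by intro h0; rw [h0] at hp; simp at hp
  have hr : gsRej (u 0) (a 0) ≠ 0 := by
    rw [gsRej_of_orthonormal hp h]; intro h0; rw [h0] at hs; simp at hs
  have hua : HasDerivAt (fun t ↦ (u t, a t)) (u', a') 0 := hu.prodMk ha
  have hd : DifferentiableAt ℝ (fun t ↦ gsVec (u t) (a t)) 0 :=
    ((contDiffAt_gsVec hu0 hr).differentiableAt (by simp)).comp 0 (f := fun t ↦ (u t, a t))
      hua.differentiableAt
  have hP : DifferentiableAt ℝ (fun t ↦ gsPos (u t)) 0 :=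
    ((contDiffAt_gsPos hu0).differentiableAt (by simp)).comp 0 hu.differentiableAt
  have hR : DifferentiableAt ℝ (fun t ↦ gsRej (u t) (a t)) 0 :=
    ((contDiffAt_gsRej hu0 _).differentiableAt (by simp)).comp 0 (f := fun t ↦ (u t, a t))
      hua.differentiableAt
  have hN : DifferentiableAt ℝ (fun t ↦ ‖gsRej (u t) (a t)‖⁻¹) 0 :=
    (hR.norm ℝ hr).inv (norm_ne_zero_iff.mpr hr)
  refine ⟨hd, ?_⟩
  have hc : HasDerivAt (fun t ↦ (inner ℝ q (a t) : ℝ)) (inner ℝ q a') 0 := by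
    simpa using (hasDerivAt_const (0 : ℝ) q).inner ℝ ha
  have h1 := (hP.inner ℝ ha.differentiableAt).hasDerivAt
  have h2 := ((differentiableAt_const q).inner ℝ hP).hasDerivAt
  have h3 := hN.hasDerivAt.mul (hc.sub (h1.mul h2))
  have h4 : HasDerivAt (fun t ↦ (inner ℝ q (gsVec (u t) (a t)) : ℝ))
      (inner ℝ q (deriv (fun t ↦ gsVec (u t) (a t)) 0)) 0 := by
    simpa using (hasDerivAt_const (0 : ℝ) q).inner ℝ hd.hasDerivAt
  have h5 : (fun t ↦ (inner ℝ q (gsVec (u t) (a t)) : ℝ)) = fun t ↦ ‖gsRej (u t) (a t)‖⁻¹ *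
      (inner ℝ q (a t) - inner ℝ (gsPos (u t)) (a t) * inner ℝ q (gsPos (u t))) := by
    funext t
    rw [gsVec, real_inner_smul_right]
    congr 1
    rw [gsRej, inner_sub_right, real_inner_smul_right]
  rw [h5] at h4
  rw [h4.unique h3]
  simp [gsRej_of_orthonormal hp h, gsPos_of_norm_eq_one hp, hs, h, hq, hq']

theorem exists_orthonormal_extension {p : E3} (hp : ‖p‖ = 1) : ∃ a b : E3, ‖a‖ = 1 ∧ ‖b‖ = 1 ∧
    inner ℝ p a = (0 : ℝ) ∧ inner ℝ p b = (0 : ℝ) ∧ inner ℝ a b = (0 : ℝ) := by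
  have : Fact (Module.finrank ℝ E3 = 2 + 1) := ⟨by simp⟩
  have hp0 : p ≠ 0 := by rintro rfl; simp at hp
  have hf := Submodule.finrank_orthogonal_span_singleton (𝕜 := ℝ) (n := 2) hp0
  obtain ⟨z, hz⟩ : ∃ z : (Submodule.span ℝ {p})ᗮ, z ≠ 0 := by
    by_contra! h
    have : Subsingleton (Submodule.span ℝ {p})ᗮ := ⟨fun a b ↦ (h a).trans (h b).symm⟩
    rw [Module.finrank_zero_of_subsingleton] at hf
    omega
  have hz' : (z : E3) ≠ 0 := fun h ↦ hz (Subtype.ext h)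
  have hpz : inner ℝ p (gsPos z) = (0 : ℝ) := by
    rw [gsPos, real_inner_smul_right,
      Submodule.mem_orthogonal_singleton_iff_inner_right.mp z.2, mul_zero]
  refine ⟨gsPos z, crossE p (gsPos z), norm_gsPos hz', norm_crossE hp (norm_gsPos hz') hpz, hpz,
    ?_, ?_⟩
  · rw [real_inner_comm]; exact inner_crossE_left _ _
  · rw [real_inner_comm]; exact inner_crossE_right _ _

/-! ### The value of the induced connection on the lift of a vector field -/

theorem pullMat_apply_eq_zero (A : CovariantDerivative (𝓡 4) E3 E) (L : ∀ x, E3 ≃ₗᵢ[ℝ] E x)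
    {W : Type*} [NormedAddCommGroup W] [NormedSpace ℝ W] {f : W → X} {w u : W}
    (h : (mfderiv 𝓘(ℝ, W) (𝓡 4) f w u : E4) = 0) : pullMat A L f w u = 0 := by
  let C : E4 →L[ℝ] E3 →L[ℝ] E3 := connMat A L (f w)
  exact (congrArg C h).trans C.map_zero

/-- The induced connection takes the value `f_v` on the lift of `v`. -/
theorem pairing_lift (ho : IsBundleOrientation o) (A : CovariantDerivative (𝓡 4) E3 E)
    (v : LieGpi E) (x : X) {p : E x} (hp : ‖p‖ = 1) :
    pairing (inducedConnection o A) (lift o v) x p = fibreHamiltonian o x (v.field x) p := by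
  obtain ⟨U, hU, hx, L, hL, hpos⟩ := ho.exists_isPositiveFrame x
  set ℓ := L x with hℓ
  set f := fibreHamiltonian o x (v.field x) p with hf
  have hex : ∃ s : E x, ‖s‖ = 1 ∧ inner ℝ p s = (0 : ℝ) := by
    obtain ⟨a, -, ha, -, hpa, -⟩ := exists_orthonormal_extension (p := ℓ.symm p) (by simpa)
    refine ⟨ℓ a, by simpa, ?_⟩
    rw [← ℓ.inner_map_map, ℓ.apply_symm_apply] at hpa
    exact hpa
  obtain ⟨hs, hps⟩ := Classical.epsilon_spec hex
  rw [pairing]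
  set s : E x := Classical.epsilon fun s ↦ ‖s‖ = 1 ∧ inner ℝ p s = (0 : ℝ) with hsdef
  obtain ⟨p', rfl⟩ := ℓ.surjective p
  obtain ⟨s', hs'⟩ := ℓ.surjective s
  obtain ⟨v', hv'⟩ := ℓ.surjective (v.field x (ℓ p'))
  rw [← hs', ℓ.norm_map] at hs
  rw [← hs', ℓ.inner_map_map] at hps
  rw [ℓ.norm_map] at hp
  have hc : cross o (ℓ p') s = ℓ (crossE p' s') := by rw [← hs']; exact hpos x hx _ _
  set a' : E3 := -(inner ℝ s' v' : ℝ) • p' + f • crossE p' s' with ha'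
  have hψ : (fun t : ℝ ↦ orthonormalize x (ℓ p' + t • (lift o v ⟨x, ℓ p', s⟩).1)
      (s + t • (lift o v ⟨x, ℓ p', s⟩).2)) =
      fun t ↦ ⟨x, ℓ (gsPos (p' + t • v')), ℓ (gsVec (p' + t • v') (s' + t • a'))⟩ := by
    funext t
    rw [← orthonormalize_map]
    simp only [lift]
    rw [hc, ← hv', ← hs', ℓ.inner_map_map, ← hf]
    simp [ha']
  simp only [hψ]
  have hu : HasDerivAt (fun t : ℝ ↦ p' + t • v') v' 0 := by
    simpa using ((hasDerivAt_id (0 : ℝ)).smul_const v').const_add p'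
  have ha : HasDerivAt (fun t : ℝ ↦ s' + t • a') a' 0 := by
    simpa using ((hasDerivAt_id (0 : ℝ)).smul_const a').const_add s'
  have hq : inner ℝ (crossE p' s') p' = (0 : ℝ) := inner_crossE_left _ _
  have hq' : inner ℝ (crossE p' s') s' = (0 : ℝ) := inner_crossE_right _ _
  obtain ⟨hd, hi⟩ := inner_deriv_gsVec hu ha (by simpa) (by simpa) (by simpa) (by simpa)
    (q := crossE p' s') (by simpa)
  have hform := inducedConnection_form (o := o) A hL hU hpos
    (ψ := fun t ↦ ⟨x, ℓ (gsPos (p' + t • v')), ℓ (gsVec (p' + t • v') (s' + t • a'))⟩)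
    (w := (0 : ℝ)) hx mdifferentiableAt_const (by simpa [← hℓ] using hd) 1
  rw [hform]
  have h0 : pullMat A L (fun _ : ℝ ↦ x) 0 1 = 0 := by
    refine pullMat_apply_eq_zero A L ?_
    rw [mfderiv_const]
    rfl
  simp only [← hℓ, ℓ.symm_apply_apply, h0, zero_apply, add_zero, zero_smul,
    gsPos_of_norm_eq_one hp, gsVec_of_orthonormal hp hs hps]
  rw [fderiv_apply_one_eq_deriv, hi, ha', inner_add_right, real_inner_smul_right,
    real_inner_smul_right, hq, real_inner_self_eq_norm_sq, norm_crossE hp hs hps]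
  ring

/-! ### The volume density of the induced connection -/

theorem crossE_left_injective {f g : E3} (h : ∀ s, crossE f s = crossE g s) : f = g := by
  have h0 := h (EuclideanSpace.single 0 1)
  have h1 := h (EuclideanSpace.single 1 1)
  apply ext_E3
  · have := congrArg (fun z : E3 ↦ z 2) h1
    simpa using this
  · have := congrArg (fun z : E3 ↦ z 2) h0
    simpa using this
  · have := congrArg (fun z : E3 ↦ z 1) h0
    simpa using this

/-- Two isometries of a fibre with `ℝ³` identify the curvature with vectors which correspond to
each other up to a sign. -/
theorem exists_sign_curvature_vector {x : X} {A : CovariantDerivative (𝓡 4) E3 E}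
    {ℓ ℓ' : E3 ≃ₗᵢ[ℝ] E x} {β β' : TangentSpace (𝓡 4) x →ₗ[ℝ] TangentSpace (𝓡 4) x →ₗ[ℝ] E3}
    (hβ : ∀ u v σ, bundleCurvature A x u v (ℓ σ) = ℓ (crossE (β u v) σ))
    (hβ' : ∀ u v σ, bundleCurvature A x u v (ℓ' σ) = ℓ' (crossE (β' u v) σ)) :
    ∃ ε : ℝ, ε * ε = 1 ∧ ∀ u v, β' u v = ε • ℓ'.symm (ℓ (β u v)) := by
  let g : E3 ≃ₗᵢ[ℝ] E3 := ℓ.trans ℓ'.symm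
  obtain ⟨ε, hε, -, h⟩ := exists_cross_sign (T := E3) (by simp)
    (EuclideanSpace.basisFun (Fin 3) ℝ).toBasis.orientation g
  refine ⟨ε, hε, fun u v ↦ crossE_left_injective fun s ↦ ?_⟩
  obtain ⟨s, rfl⟩ := g.surjective s
  apply ℓ'.injective
  rw [← hβ']
  have e1 : ℓ' (g s) = ℓ s := by simp [g]
  have h' := h (β u v) s
  rw [crossE_eq_crossOf] at h'
  have e2 : crossE (ε • ℓ'.symm (ℓ (β u v))) (g s) = ε • crossE (g (β u v)) (g s) := by
    change crossE (ε • g (β u v)) (g s) = _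
    apply ext_E3 <;> simp <;> ring
  rw [e1, hβ, e2, h', smul_smul, hε, one_smul]
  simp [g]

theorem wedge_smul_smul {T : Type*} (c d : ℝ) (α β : T → T → ℝ) (t : Fin 4 → T) :
    wedge (fun u v ↦ c * α u v) (fun u v ↦ d * β u v) t = c * d * wedge α β t := by
  simp only [wedge, Finset.mul_sum]
  exact Finset.sum_congr rfl fun _ _ ↦ by ring

variable {φ : OpenPartialHomeomorph X E4}

/-- The coordinate vector fields of the chart `φ`. -/
noncomputable def coordFrame (φ : OpenPartialHomeomorph X E4) (y : E4) (i : Fin 4) :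
    TangentSpace (𝓡 4) (φ.symm y) :=
  mfderiv (𝓡 4) (𝓡 4) φ.symm y (EuclideanSpace.single i 1)

/-- The family of unit vectors of the vertical bundle given by a chart, a frame and a vector. -/
noncomputable def chartFamily (φ : OpenPartialHomeomorph X E4) (L : ∀ x, E3 ≃ₗᵢ[ℝ] E x) (a : E3)
    (w : E4 × E3) : FramePoint E :=
  orthonormalize (φ.symm w.1) (L (φ.symm w.1) w.2) (L (φ.symm w.1) a)

theorem chartFamily_eq (φ : OpenPartialHomeomorph X E4) (L : ∀ x, E3 ≃ₗᵢ[ℝ] E x) (a : E3)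
    (w : E4 × E3) : chartFamily φ L a w =
      ⟨φ.symm w.1, L (φ.symm w.1) (gsPos w.2), L (φ.symm w.1) (gsVec w.2 a)⟩ :=
  orthonormalize_map _ _ _ _

theorem posIn_chartFamily (φ : OpenPartialHomeomorph X E4) (L L' : ∀ x, E3 ≃ₗᵢ[ℝ] E x) (a : E3)
    (w : E4 × E3) : posIn L' (chartFamily φ L a) w =
      (L' (φ.symm w.1)).symm (L (φ.symm w.1) (gsPos w.2)) :=
  congrArg (fun z : FramePoint E ↦ (L' z.pt).symm z.pos) (chartFamily_eq φ L a w)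

theorem vecIn_chartFamily (φ : OpenPartialHomeomorph X E4) (L L' : ∀ x, E3 ≃ₗᵢ[ℝ] E x) (a : E3)
    (w : E4 × E3) : vecIn L' (chartFamily φ L a) w =
      (L' (φ.symm w.1)).symm (L (φ.symm w.1) (gsVec w.2 a)) :=
  congrArg (fun z : FramePoint E ↦ (L' z.pt).symm z.vec) (chartFamily_eq φ L a w)

theorem contMDiffAt_symm_fst (hφ : φ ∈ IsManifold.maximalAtlas (𝓡 4) ∞ X) {w : E4 × E3}
    (hw : w.1 ∈ φ.target) :
    ContMDiffAt 𝓘(ℝ, E4 × E3) (𝓡 4) ∞ (fun w : E4 × E3 ↦ φ.symm w.1) w :=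
  ((contMDiffOn_symm_of_mem_maximalAtlas hφ).contMDiffAt (φ.open_target.mem_nhds hw)).comp w
    (f := Prod.fst) contDiff_fst.contMDiff.contMDiffAt

/-- The Gram-Schmidt process in a frame gives a unit family, away from the points where it breaks down. -/
theorem isUnitFamily_chartFamily (hφ : φ ∈ IsManifold.maximalAtlas (𝓡 4) ∞ X)
    (hL : IsSmoothFrame L φ.source) (a : E3) :
    IsUnitFamily (chartFamily φ L a) {w | w.1 ∈ φ.target ∧ w.2 ≠ 0 ∧ gsRej w.2 a ≠ 0} := by
  have hψ : chartFamily φ L a = fun w ↦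
      ⟨φ.symm w.1, L (φ.symm w.1) (gsPos w.2), L (φ.symm w.1) (gsVec w.2 a)⟩ :=
    funext (chartFamily_eq φ L a)
  refine ⟨?_, ?_, ?_, ?_⟩
  · rw [isOpen_iff_mem_nhds]
    rintro w ⟨h1, h2, h3⟩
    have c1 : ContinuousAt (fun w : E4 × E3 ↦ gsRej w.2 a) w :=
      (contDiffAt_gsRej h2 a).continuousAt.comp (f := fun w : E4 × E3 ↦ (w.2, a)) (by fun_prop)
    filter_upwards [continuousAt_fst.eventually (φ.open_target.mem_nhds h1),
      continuousAt_snd.eventually_ne h2, c1.eventually_ne h3] with z z1 z2 z3 using ⟨z1, z2, z3⟩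
  · rintro w ⟨h1, h2, h3⟩
    rw [chartFamily_eq]
    simp only [LinearIsometryEquiv.norm_map, LinearIsometryEquiv.inner_map_map]
    exact ⟨norm_gsPos h2, norm_gsVec h3, inner_gsPos_gsVec h2 a⟩
  · rintro w ⟨h1, h2, h3⟩
    rw [hψ]
    refine (hL.contMDiffAt_comp φ.open_source (f := fun w : E4 × E3 ↦ φ.symm w.1)
      (σ := fun w ↦ gsPos w.2) (contMDiffAt_symm_fst hφ h1) (φ.map_target h1) ?_).contMDiffWithinAt
    exact ((contDiffAt_gsPos h2).comp w contDiffAt_snd).contMDiffAt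
  · rintro w ⟨h1, h2, h3⟩
    rw [hψ]
    refine (hL.contMDiffAt_comp φ.open_source (f := fun w : E4 × E3 ↦ φ.symm w.1)
      (σ := fun w ↦ gsVec w.2 a) (contMDiffAt_symm_fst hφ h1) (φ.map_target h1)
      ?_).contMDiffWithinAt
    exact ((contDiffAt_gsVec h2 h3).comp w (f := fun w : E4 × E3 ↦ (w.2, a))
      (contDiffAt_snd.prodMk contDiffAt_const)).contMDiffAt

theorem mfderiv_symm_fst (hφ : φ ∈ IsManifold.maximalAtlas (𝓡 4) ∞ X) {y : E4} (hy : y ∈ φ.target)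
    (p : E3) (u : E4 × E3) :
    (mfderiv 𝓘(ℝ, E4 × E3) (𝓡 4) (fun w : E4 × E3 ↦ φ.symm w.1) (y, p) u : E4) =
      mfderiv (𝓡 4) (𝓡 4) φ.symm y u.1 := by
  have h1 : MDifferentiableAt (𝓡 4) (𝓡 4) φ.symm y :=
    ((contMDiffOn_symm_of_mem_maximalAtlas hφ).contMDiffAt
      (φ.open_target.mem_nhds hy)).mdifferentiableAt (by simp)
  have h2 : HasMFDerivAt 𝓘(ℝ, E4 × E3) (𝓡 4) (Prod.fst : E4 × E3 → E4) (y, p)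
      (ContinuousLinearMap.fst ℝ E4 E3) := hasFDerivAt_fst.hasMFDerivAt
  have h3 := h1.hasMFDerivAt.comp (y, p) (f := Prod.fst) h2
  exact congrArg (fun T : E4 × E3 →L[ℝ] E4 ↦ T u) h3.mfderiv

/-- The density of `ω³` for the induced connection. The frame `ℓ` in which the curvature is expressed
is arbitrary, as another one changes `β` only by a rotation and a sign. -/
theorem density_inducedConnection [T2Space X] (ho : IsBundleOrientation o)
    (A : CovariantDerivative (𝓡 4) E3 E) [A.ContMDiffCovariantDerivative ∞]
    (hA : A.IsMetricCompatible) (hφ : φ ∈ IsManifold.maximalAtlas (𝓡 4) ∞ X)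
    (hL : IsSmoothFrame L φ.source) {y : E4} (hy : y ∈ φ.target) {p : E3} (hp : ‖p‖ = 1)
    {ℓ : E3 ≃ₗᵢ[ℝ] E (φ.symm y)}
    {β : TangentSpace (𝓡 4) (φ.symm y) →ₗ[ℝ] TangentSpace (𝓡 4) (φ.symm y) →ₗ[ℝ] E3}
    (hβ : ∀ u v σ, bundleCurvature A (φ.symm y) u v (ℓ σ) = ℓ (crossE (β u v) σ)) :
    density (inducedConnection o A) φ L y p = 3 * (1 / (2 * Real.pi)) ^ 3 *
      |wedge (fun u v ↦ inner ℝ (β u v) (ℓ.symm (L (φ.symm y) p)))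
        (fun u v ↦ inner ℝ (β u v) (ℓ.symm (L (φ.symm y) p))) (coordFrame φ y)| := by
  rw [density]
  have hex : ∃ c : E3 × E3, ‖c.1‖ = 1 ∧ ‖c.2‖ = 1 ∧
    inner ℝ p c.1 = (0 : ℝ) ∧ inner ℝ p c.2 = (0 : ℝ) ∧ inner ℝ c.1 c.2 = (0 : ℝ) := by
    obtain ⟨a, b, h⟩ := exists_orthonormal_extension hp
    exact ⟨(a, b), h⟩
  have hab := Classical.epsilon_spec hex
  set ab : E3 × E3 := Classical.epsilon fun c : E3 × E3 ↦ ‖c.1‖ = 1 ∧ ‖c.2‖ = 1 ∧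
    inner ℝ p c.1 = (0 : ℝ) ∧ inner ℝ p c.2 = (0 : ℝ) ∧ inner ℝ c.1 c.2 = (0 : ℝ) with habdef
  obtain ⟨ha1, hb1, hpa, hpb, hab0⟩ := hab
  set a := ab.1
  set b := ab.2
  change |cube (curvatureForm (inducedConnection o A) (chartFamily φ L a) (y, p)) _| = _
  obtain ⟨U, hU, hx, L', hL', hpos⟩ := ho.exists_isPositiveFrame (φ.symm y)
  let x := φ.symm y
  obtain ⟨β', hβa', hβ', -⟩ := exists_curvature_vector ho A hA x (L' x)
  obtain ⟨ε, hε, hββ'⟩ := exists_sign_curvature_vector hβ hβ'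
  have hp0 : p ≠ 0 := by rintro rfl; simp at hp
  have hrej : gsRej p a = a := gsRej_of_orthonormal hp hpa
  have ha0 : a ≠ 0 := by intro h; rw [h] at ha1; simp at ha1
  have hψ := isUnitFamily_chartFamily hφ hL a
  have hw : ((y, p) : E4 × E3) ∈ {w : E4 × E3 | w.1 ∈ φ.target ∧ w.2 ≠ 0 ∧ gsRej w.2 a ≠ 0} :=
    ⟨hy, hp0, by rw [hrej]; exact ha0⟩
  set ψ := chartFamily φ L a with hψdef
  have hcf := curvatureForm_inducedConnection A hA hL' hU hpos hψ hw (by exact hx) hβ'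
  let g : E3 ≃ₗᵢ[ℝ] E3 := (L x).trans (L' x).symm
  have hposw : posIn L' ψ (y, p) = g p := by
    rw [hψdef, posIn_chartFamily, gsPos_of_norm_eq_one hp]
    rfl
  have hvecw : vecIn L' ψ (y, p) = g a := by
    rw [hψdef, vecIn_chartFamily, gsVec_of_orthonormal hp ha1 hpa]
    rfl
  let dx : E4 × E3 →L[ℝ] TangentSpace (𝓡 4) x :=
    mfderiv 𝓘(ℝ, E4 × E3) (𝓡 4) (fun w ↦ (ψ w).pt) (y, p)
  have hdx (u : E4 × E3) : dx u = mfderiv (𝓡 4) (𝓡 4) φ.symm y u.1 := mfderiv_symm_fst hφ hy p u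
  -- the derivative in vertical directions
  have hvert (c : E3) (hc : inner ℝ p c = (0 : ℝ)) : covPos A L' ψ (y, p) (0, c) = g c := by
    have h0 : pullMat A L' (fun w ↦ (ψ w).pt) (y, p) (0, c) = 0 :=
      pullMat_apply_eq_zero A L' ((hdx (0, c)).trans (ContinuousLinearMap.map_zero _))
    have hd : DifferentiableAt ℝ (posIn L' ψ) (y, p) :=
      (hψ.contDiffOn_pos hL' hU).differentiableAt_of_mem ((hψ.isOpen_inter hU).mem_nhds ⟨hw, hx⟩)
    have h1 : HasFDerivAt (fun z : E3 ↦ posIn L' ψ (y, z))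
        ((fderiv ℝ (posIn L' ψ) (y, p)).comp (ContinuousLinearMap.inr ℝ E4 E3)) p :=
      HasFDerivAt.comp p (f := fun z : E3 ↦ ((y, z) : E4 × E3)) hd.hasFDerivAt
        (hasFDerivAt_prodMk_right y p)
    have h2 : (fun z : E3 ↦ posIn L' ψ (y, z)) = fun z ↦ g (gsPos z) := by
      funext z
      rw [hψdef, posIn_chartFamily]
      rfl
    have h3 : HasFDerivAt (fun z ↦ g (gsPos z))
        ((g.toContinuousLinearEquiv : E3 →L[ℝ] E3).comp (fderiv ℝ gsPos p)) p :=
      (g.toContinuousLinearEquiv : E3 →L[ℝ] E3).hasFDerivAt.comp p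
        ((contDiffAt_gsPos hp0).differentiableAt (by simp)).hasFDerivAt
    rw [h2] at h1
    have h4 := congrArg (fun T : E3 →L[ℝ] E3 ↦ T c) (h1.unique h3)
    simp only [ContinuousLinearMap.comp_apply, fderiv_gsPos hp, hc, zero_smul, sub_zero] at h4
    change fderiv ℝ (posIn L' ψ) (y, p) (0, c)
      + pullMat A L' (fun w ↦ (ψ w).pt) (y, p) (0, c) (posIn L' ψ (y, p)) = g c
    rw [h0, zero_apply, add_zero]
    exact h4
  rw [cube_sub (T := E4 × E3) _ (fun u v ↦ inner ℝ (β' (dx u) (dx v)) (g p))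
    (fun u ↦ inner ℝ (g a) (covPos A L' ψ (y, p) u))
    (fun u ↦ inner ℝ (crossE (g p) (g a)) (covPos A L' ψ (y, p) u)) (1 / (2 * Real.pi))]
  rotate_left
  · intro u v
    rw [hcf, hposw, hvecw]
    rfl
  · intro u v
    rw [hβa', inner_neg_left]
  · intro u
    have : dx ((0, a) : E4 × E3) = 0 := (hdx (0, a)).trans (ContinuousLinearMap.map_zero _)
    rw [this, map_zero, inner_zero_left]
  · intro u
    have : dx ((0, b) : E4 × E3) = 0 := (hdx (0, b)).trans (ContinuousLinearMap.map_zero _)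
    rw [this, map_zero, inner_zero_left]
  have hga : inner ℝ (g a) (g a) = (1 : ℝ) := by
    rw [real_inner_self_eq_norm_sq, g.norm_map, ha1]; norm_num
  have hgb : inner ℝ (g a) (g b) = (0 : ℝ) := by rw [g.inner_map_map, hab0]
  have hgpa : inner ℝ (g p) (g a) = (0 : ℝ) := by rw [g.inner_map_map, hpa]
  have hgpb : inner ℝ (g p) (g b) = (0 : ℝ) := by rw [g.inner_map_map, hpb]
  have hn : |(inner ℝ (crossE (g p) (g a)) (g b) : ℝ)| = 1 := by
    have := inner_eq_of_orthonormal (p := g p) (s := g a) (by simpa) (by simpa) hgpa (g b) (g b)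
    rw [real_inner_self_eq_norm_sq, g.norm_map, hb1, real_inner_comm, hgpb,
      real_inner_comm (g a) (g b), hgb, real_inner_comm (crossE (g p) (g a)) (g b)] at this
    rw [← abs_one, ← sq_eq_sq_iff_abs_eq_abs]
    linarith
  have hw4 : wedge (fun u v ↦ (inner ℝ (β' (dx u) (dx v)) (g p) : ℝ))
      (fun u v ↦ inner ℝ (β' (dx u) (dx v)) (g p)) ![(EuclideanSpace.single 0 1, 0),
      (EuclideanSpace.single 1 1, 0), (EuclideanSpace.single 2 1, 0),
      (EuclideanSpace.single 3 1, 0)] =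
      wedge (fun u v ↦ inner ℝ (β u v) (ℓ.symm (L x p)))
        (fun u v ↦ inner ℝ (β u v) (ℓ.symm (L x p))) (coordFrame φ y) := by
    have e1 : wedge (fun u v ↦ (inner ℝ (β' (dx u) (dx v)) (g p) : ℝ))
      (fun u v ↦ inner ℝ (β' (dx u) (dx v)) (g p)) ![(EuclideanSpace.single 0 1, 0),
      (EuclideanSpace.single 1 1, 0), (EuclideanSpace.single 2 1, 0),
      (EuclideanSpace.single 3 1, 0)] =
      wedge (fun u v ↦ (inner ℝ (β' u v) (g p) : ℝ)) (fun u v ↦ inner ℝ (β' u v) (g p))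
        (coordFrame φ y) := by
      have : coordFrame φ y = fun i ↦ dx ((![(EuclideanSpace.single 0 1, 0),
        (EuclideanSpace.single 1 1, 0), (EuclideanSpace.single 2 1, 0),
        (EuclideanSpace.single 3 1, 0)] : Fin 4 → E4 × E3) i) := by
        funext i
        rw [hdx]
        fin_cases i <;> rfl
      rw [this]
      rfl
    rw [e1]
    have e2 (u v : TangentSpace (𝓡 4) x) : (inner ℝ (β' u v) (g p) : ℝ) =
        ε * inner ℝ (β u v) (ℓ.symm (L x p)) := by
      rw [hββ', real_inner_smul_left]
      congr 1
      change inner ℝ ((L' x).symm (ℓ (β u v))) ((L' x).symm (L x p)) = _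
      rw [LinearIsometryEquiv.inner_map_map, ← ℓ.inner_map_map (β u v), ℓ.apply_symm_apply]
    simp only [e2]
    rw [wedge_smul_smul, hε, one_mul]
  rw [hvert a hpa, hvert b hpb, hw4, hga, hgb, inner_crossE_right]
  rw [one_mul, zero_mul, sub_zero, abs_mul, abs_mul, hn, mul_one, abs_of_nonneg (by positivity)]

/-! ### Perfect connections are zeros of the moment map -/

/-- The 4-form `⟪F, a⟫ ∧ ⟪F, b⟫`, as a bilinear form in `a` and `b`. -/
noncomputable def curvWedge {T : Type*} (β : T → T → E3) (t : Fin 4 → T) : E3 →ₗ[ℝ] E3 →ₗ[ℝ] ℝ :=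
  LinearMap.mk₂ ℝ (fun a b ↦ wedge (fun u v ↦ inner ℝ (β u v) a) (fun u v ↦ inner ℝ (β u v) b) t)
    (fun a a' b ↦ by
      simp only [wedge, inner_add_right, mul_add, add_mul, Finset.sum_add_distrib])
    (fun c a b ↦ by
      simp only [wedge, smul_eq_mul, Finset.mul_sum, real_inner_smul_right]
      exact Finset.sum_congr rfl fun _ _ ↦ by ring)
    (fun a b b' ↦ by
      simp only [wedge, inner_add_right, mul_add, Finset.sum_add_distrib])
    (fun c a b ↦ by
      simp only [wedge, smul_eq_mul, Finset.mul_sum, real_inner_smul_right]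
      exact Finset.sum_congr rfl fun _ _ ↦ by ring)

theorem curvWedge_single {T : Type*} (β : T → T → E3) (t : Fin 4 → T) (i j : Fin 3) :
    curvWedge β t (EuclideanSpace.single i 1) (EuclideanSpace.single j 1) =
      wedge (fun u v ↦ β u v i) (fun u v ↦ β u v j) t := by
  simp [curvWedge, EuclideanSpace.inner_single_right]

theorem fibreHamiltonian_integral (x : X) (v : E x → E x) (ℓ : E3 ≃ₗᵢ[ℝ] E x) :
    ∫ p : Metric.sphere (0 : E3) 1, fibreHamiltonian o x v (ℓ p)
      ∂(MeasureTheory.volume : MeasureTheory.Measure E3).toSphere = 0 := by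
  rw [fibreHamiltonian]
  split_ifs with h
  · exact h.choose_spec.2 ℓ
  · simp

/-- For a perfect connection the density is constant on each fibre, and the Hamiltonians have mean value
zero. -/
theorem momentMapPi_eq_zero_of_isPerfect [T2Space X] (ho : IsBundleOrientation o)
    (A : CovariantDerivative (𝓡 4) E3 E) [A.ContMDiffCovariantDerivative ∞]
    (hA : A.IsMetricCompatible) (hP : IsPerfect A) :
    momentMapPi o (inducedConnection o A) = 0 := by
  funext v
  rw [Pi.zero_apply, momentMapPi, momentMap, integralZ]
  split_ifs with hC
  swap
  · rw [mul_zero]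
  set C := hC.some
  refine mul_eq_zero_of_right _ (Finset.sum_eq_zero fun i _ ↦ ?_)
  refine MeasureTheory.setIntegral_eq_zero_of_forall_eq_zero fun y hy ↦ ?_
  set x := (C.chart i).symm y with hx
  set ℓ := C.frame i x with hℓ
  obtain ⟨β, -, hβ, hcc⟩ := exists_curvature_vector ho A hA x ℓ
  set t := coordFrame (C.chart i) y
  -- the density is constant on the fibre
  have hB : curvWedge (fun u v ↦ β u v) t = ((1 / 3) * ∑ k, wedge (curvatureComponent A x ℓ k)
      (curvatureComponent A x ℓ k) t) • innerₗ E3 := by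
    refine (EuclideanSpace.basisFun (Fin 3) ℝ).toBasis.ext fun j ↦
      (EuclideanSpace.basisFun (Fin 3) ℝ).toBasis.ext fun k ↦ ?_
    have h1 := hP x ℓ j k t
    have h2 : wedge (fun u v ↦ β u v j) (fun u v ↦ β u v k) t =
        wedge (curvatureComponent A x ℓ j) (curvatureComponent A x ℓ k) t := by
      congr 1 <;> (funext u v; exact (hcc _ u v).symm)
    simp only [OrthonormalBasis.coe_toBasis, EuclideanSpace.basisFun_apply]
    rw [curvWedge_single, h2, h1]
    by_cases hjk : j = k
    · subst hjk; simp
    · simp [hjk, EuclideanSpace.inner_single_left]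
  have hconst (p : Metric.sphere (0 : E3) 1) :
      C.rho i x * pairing (inducedConnection o A) (lift o v) x (ℓ p) *
        density (inducedConnection o A) (C.chart i) (C.frame i) y p =
      (C.rho i x * (3 * (1 / (2 * Real.pi)) ^ 3 * |(1 / 3) * ∑ k, wedge
        (curvatureComponent A x ℓ k) (curvatureComponent A x ℓ k) t|)) *
        fibreHamiltonian o x (v.field x) (ℓ p) := by
    have hp : ‖(p : E3)‖ = 1 := by simp
    have hQ : wedge (fun u v ↦ (inner ℝ (β u v) (p : E3) : ℝ))
        (fun u v ↦ inner ℝ (β u v) (p : E3)) t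
        = curvWedge (fun u v ↦ β u v) t p p := rfl
    have hpℓ : ℓ.symm (C.frame i ((C.chart i).symm y) p) = p := ℓ.symm_apply_apply p
    rw [pairing_lift ho A v x (by simp), density_inducedConnection ho A hA
      (C.chart_mem i) (C.frame_smooth i) hy hp hβ, hpℓ, hQ, hB]
    simp only [LinearMap.smul_apply, innerₗ_apply_apply, smul_eq_mul,
      real_inner_self_eq_norm_sq, hp, one_pow, mul_one]
    ring
  rw [MeasureTheory.integral_congr_ae (Eventually.of_forall hconst),
    MeasureTheory.integral_const_mul, fibreHamiltonian_integral, mul_zero]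

/-! ### Existence of trivializing covers -/

theorem nonempty_trivializingCover [T2Space X] [CompactSpace X] (ho : IsBundleOrientation o) :
    Nonempty (TrivializingCover E) := by
  choose U hU hx L hL hp using fun x ↦ ho.exists_isPositiveFrame x
  let e (x : X) : OpenPartialHomeomorph X E4 := (chartAt E4 x).restr (U x)
  have hes (x : X) : (e x).source = (chartAt E4 x).source ∩ U x := by
    simp [e, (hU x).interior_eq]
  obtain ⟨t, ht⟩ := CompactSpace.elim_nhds_subcover (fun x ↦ (e x).source) fun x ↦
    (e x).open_source.mem_nhds (by rw [hes]; exact ⟨mem_chart_source E4 x, hx x⟩)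
  let c : Fin t.card → X := fun i ↦ t.equivFin.symm i
  obtain ⟨f, hf⟩ := SmoothPartitionOfUnity.exists_isSubordinate (𝓡 4) (s := Set.univ) isClosed_univ
    (fun i ↦ (e (c i)).source) (fun i ↦ (e (c i)).open_source) (by
      intro x _
      have : x ∈ ⋃ x ∈ t, (e x).source := by rw [ht]; trivial
      simp only [Set.mem_iUnion] at this ⊢
      obtain ⟨z, hz, hxz⟩ := this
      exact ⟨t.equivFin ⟨z, hz⟩, by simpa [c] using hxz⟩)
  exact ⟨{ n := t.card
           chart := fun i ↦ e (c i)
           chart_mem := fun i ↦ restr_mem_maximalAtlas (contDiffGroupoid ∞ (𝓡 4))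
             (IsManifold.chart_mem_maximalAtlas _) (hU _)
           frame := fun i ↦ L (c i)
           frame_smooth := fun i ↦ (hL (c i)).mono (by rw [hes]; exact Set.inter_subset_right)
           rho := f
           subordinate := hf }⟩

end Frame

/-! ### Integrals over the unit sphere -/

section Sphere

open MeasureTheory Filter Topology
open scoped Pointwise

/-- The area measure of the sphere is invariant under linear isometries. -/
theorem integral_sphere_comp (g : E3 ≃ₗᵢ[ℝ] E3) (F : E3 → ℝ) :
    ∫ p : Metric.sphere (0 : E3) 1, F (g p) ∂(volume : Measure E3).toSphere =
      ∫ p : Metric.sphere (0 : E3) 1, F p ∂(volume : Measure E3).toSphere := by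
  let G : Metric.sphere (0 : E3) 1 → Metric.sphere (0 : E3) 1 := fun p ↦ ⟨g p, by simp⟩
  have hGc : Continuous G := by fun_prop
  have hGi : Function.Injective G := fun p q h ↦
    Subtype.ext (g.injective (congrArg (fun z : Metric.sphere (0 : E3) 1 ↦ (z : E3)) h))
  have hm : MeasurePreserving G (volume : Measure E3).toSphere (volume : Measure E3).toSphere := by
    refine ⟨hGc.measurable, Measure.ext fun s hs ↦ ?_⟩
    rw [Measure.map_apply hGc.measurable hs, Measure.toSphere_apply' _ hs,
      Measure.toSphere_apply' _ (hGc.measurable hs)]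
    congr 1
    rw [← (g.measurePreserving).measure_preimage_equiv (f := g.toHomeomorph.toMeasurableEquiv)
      (Set.Ioo (0 : ℝ) 1 • (Subtype.val '' s : Set E3))]
    congr 1
    ext z
    simp only [Set.mem_smul, Set.mem_image, Set.mem_preimage]
    constructor
    · rintro ⟨r, hr, _, ⟨p, hp, rfl⟩, rfl⟩
      exact ⟨r, hr, _, ⟨G p, hp, rfl⟩, (map_smul g r (p : E3)).symm⟩
    · rintro ⟨r, hr, _, ⟨p, hp, rfl⟩, h⟩
      have h' : r • (p : E3) = g z := h
      refine ⟨r, hr, _, ⟨⟨g.symm p, by simp⟩, ?_, rfl⟩, ?_⟩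
      · simpa [G] using hp
      · apply g.injective
        simp [← h']
  exact hm.integral_comp (hGc.isClosedEmbedding hGi).measurableEmbedding (fun p ↦ F p)

end Sphere

section SphereIntegral

open MeasureTheory Filter Topology

/-- The reflection of `ℝ³` in a coordinate plane. -/
noncomputable def coordReflection (k : Fin 3) : E3 ≃ₗᵢ[ℝ] E3 :=
  LinearIsometryEquiv.piLpCongrRight 2 fun i ↦
    if i = k then LinearIsometryEquiv.neg ℝ else LinearIsometryEquiv.refl ℝ ℝ

theorem coordReflection_apply (k i : Fin 3) (p : E3) : coordReflection k p i = if i = k then -p i else p i := by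
  simp only [coordReflection, LinearIsometryEquiv.piLpCongrRight_apply]
  split_ifs <;> simp

/-- The integral over the sphere of a function which is odd in one coordinate vanishes. -/
theorem integral_sphere_eq_zero_of_odd (k : Fin 3) {F : E3 → ℝ} (hF : ∀ p, F (coordReflection k p) = -F p) :
    ∫ p : Metric.sphere (0 : E3) 1, F p ∂(volume : Measure E3).toSphere = 0 := by
  have h := integral_sphere_comp (coordReflection k) F
  simp only [hF, integral_neg] at h
  linarith

theorem integrable_sphere {F : E3 → ℝ} (hF : Continuous F) :
    Integrable (fun p : Metric.sphere (0 : E3) 1 ↦ F p) (volume : Measure E3).toSphere :=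
  (hF.comp continuous_subtype_val).integrable_of_hasCompactSupport
    (HasCompactSupport.of_compactSpace _)

/-- The integral of `p₀² p₁²` over the unit sphere. -/
noncomputable def sphereMoment : ℝ :=
  ∫ p : Metric.sphere (0 : E3) 1, (p : E3) 0 ^ 2 * (p : E3) 1 ^ 2 ∂(volume : Measure E3).toSphere

theorem sphereMoment_pos : 0 < sphereMoment := by
  have hc : Continuous fun p : Metric.sphere (0 : E3) 1 ↦ (p : E3) 0 ^ 2 * (p : E3) 1 ^ 2 := by
    fun_prop
  let u : E3 := !₂[1, 1, 0]
  have hu : u ≠ 0 := fun h ↦ by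
    have := congrArg (fun z : E3 ↦ z 0) h
    simp [u] at this
  refine hc.integral_pos_of_hasCompactSupport_nonneg_nonzero (HasCompactSupport.of_compactSpace _)
    (fun p ↦ by positivity) (x := ⟨gsPos u, by simpa using norm_gsPos hu⟩) ?_
  simp [gsPos, u, hu]

/-- A quadratic form without zeros on the sphere has constant sign. -/
theorem abs_quadratic_eq (B : E3 →ₗ[ℝ] E3 →ₗ[ℝ] ℝ) (hB : ∀ p : E3, ‖p‖ = 1 → B p p ≠ 0) {e p : E3}
    (he : ‖e‖ = 1) (hp : ‖p‖ = 1) : |B p p| = B e e / |B e e| * B p p := by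
  have hc : Continuous fun p : E3 ↦ B p p := by
    have : (fun p : E3 ↦ B p p) = fun p ↦ ∑ i : Fin 3, ∑ j : Fin 3, p i * (p j *
        B (EuclideanSpace.single i 1) (EuclideanSpace.single j 1)) := by
      funext p
      rw [map_eq_sum_single B p, LinearMap.sum_apply]
      refine Finset.sum_congr rfl fun i _ ↦ ?_
      rw [LinearMap.smul_apply, map_eq_sum_single (B _) p, smul_eq_mul, Finset.mul_sum]
      simp
    rw [this]
    fun_prop
  have hs : IsPreconnected (Metric.sphere (0 : E3) 1) := by
    refine isPreconnected_sphere ?_ 0 1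
    rw [← Module.finrank_eq_rank]
    simp
  have key (a b : E3) (ha : ‖a‖ = 1) (hb : ‖b‖ = 1) (h1 : B a a < 0) (h2 : 0 < B b b) : False := by
    obtain ⟨z, hz, hz0⟩ := hs.intermediate_value (a := a) (b := b) (by simpa) (by simpa)
      hc.continuousOn ⟨h1.le, h2.le⟩
    exact hB z (by simpa using hz) hz0
  rcases lt_or_gt_of_ne (hB e he) with h1 | h1 <;> rcases lt_or_gt_of_ne (hB p hp) with h2 | h2
  · rw [abs_of_neg h1, abs_of_neg h2, div_neg, div_self h1.ne]; ring
  · exact (key e p he hp h1 h2).elim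
  · exact (key p e hp he h2 h1).elim
  · rw [abs_of_pos h1, abs_of_pos h2, div_self h1.ne']; ring

/-- The integral of `p₀ p₁ |B(p, p)|` over the sphere detects the off-diagonal entry of `B`: every
other monomial of `p₀ p₁ B(p, p)` is odd in some coordinate. -/
theorem integral_mul_abs_quadratic (B : E3 →ₗ[ℝ] E3 →ₗ[ℝ] ℝ) (hsymm : ∀ a b, B a b = B b a)
    (hB : ∀ p : E3, ‖p‖ = 1 → B p p ≠ 0) :
    ∫ p : Metric.sphere (0 : E3) 1, (p : E3) 0 * (p : E3) 1 * |B p p|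
        ∂(volume : Measure E3).toSphere =
      2 * sphereMoment * (B (EuclideanSpace.single 0 1) (EuclideanSpace.single 1 1) *
        (B (EuclideanSpace.single 0 1) (EuclideanSpace.single 0 1) /
          |B (EuclideanSpace.single 0 1) (EuclideanSpace.single 0 1)|)) := by
  set e : Fin 3 → E3 := fun i ↦ EuclideanSpace.single i 1 with he
  set s : ℝ := B (e 0) (e 0) / |B (e 0) (e 0)| with hs
  let R₁ : E3 → ℝ := fun p ↦
    p 0 * p 1 * (B (e 0) (e 0) * p 0 ^ 2 + B (e 1) (e 1) * p 1 ^ 2 + B (e 2) (e 2) * p 2 ^ 2)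
  let R₂ : E3 → ℝ := fun p ↦ p 0 * p 1 * p 2 * (2 * B (e 0) (e 2) * p 0 + 2 * B (e 1) (e 2) * p 1)
  have hexp (p : Metric.sphere (0 : E3) 1) : (p : E3) 0 * (p : E3) 1 * |B p p| =
      s * (2 * B (e 0) (e 1)) * ((p : E3) 0 ^ 2 * (p : E3) 1 ^ 2) + (s * R₁ p + s * R₂ p) := by
    rw [abs_quadratic_eq B hB (e := e 0) (by simp [e]) (by simp), ← hs]
    have h1 : B (p : E3) p =
        ∑ i : Fin 3, ∑ j : Fin 3, (p : E3) i * ((p : E3) j * B (e i) (e j)) := by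
      rw [map_eq_sum_single B (p : E3), LinearMap.sum_apply]
      refine Finset.sum_congr rfl fun i _ ↦ ?_
      rw [LinearMap.smul_apply, map_eq_sum_single (B _) (p : E3), smul_eq_mul, Finset.mul_sum]
      simp [e]
    rw [h1]
    simp only [Fin.sum_univ_three, R₁, R₂, hsymm (e 1) (e 0), hsymm (e 2) (e 0), hsymm (e 2) (e 1)]
    ring
  have c0 : Continuous fun p : E3 ↦ s * (2 * B (e 0) (e 1)) * (p 0 ^ 2 * p 1 ^ 2) := by fun_prop
  have c1 : Continuous fun p : E3 ↦ s * R₁ p := by fun_prop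
  have c2 : Continuous fun p : E3 ↦ s * R₂ p := by fun_prop
  have o1 := integral_sphere_eq_zero_of_odd 0 (F := R₁) fun p ↦ by
    simp only [R₁, coordReflection_apply]; simp
  have o2 := integral_sphere_eq_zero_of_odd 2 (F := R₂) fun p ↦ by
    simp only [R₂, coordReflection_apply]; simp
  have c12 : Continuous fun p : E3 ↦ s * R₁ p + s * R₂ p := c1.add c2
  rw [integral_congr_ae (Eventually.of_forall hexp),
    integral_add (integrable_sphere c0) (integrable_sphere c12),
    integral_add (integrable_sphere c1) (integrable_sphere c2), integral_const_mul,
    integral_const_mul, integral_const_mul, o1, o2, sphereMoment]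
  ring

theorem integral_mul_coord_eq_zero :
    ∫ p : Metric.sphere (0 : E3) 1, (p : E3) 0 * (p : E3) 1 ∂(volume : Measure E3).toSphere = 0 :=
  integral_sphere_eq_zero_of_odd 0 (F := fun p ↦ p 0 * p 1) fun p ↦ by
    simp only [coordReflection_apply]; simp

end SphereIntegral

/-! ### Uniqueness of fibrewise Hamiltonians -/

section Hamiltonian

open MeasureTheory Filter Topology

variable {X : Type*} [TopologicalSpace X] [ChartedSpace E4 X]
  {E : X → Type*} [TopologicalSpace (TotalSpace E3 E)]
  [∀ x, NormedAddCommGroup (E x)] [∀ x, InnerProductSpace ℝ (E x)]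
  [FiberBundle E3 E] [VectorBundle ℝ E3 E] {o : ∀ x, Orientation ℝ (E x) (Fin 3)}

/-- The radial extension of the difference of two Hamiltonians has derivative zero on the connected set
`E x ∖ {0}`, so that it is constant, and the constant is zero as both have mean value zero. -/
theorem IsFibreHamiltonian.eq_of_norm_eq_one {x : X} (ℓ : E3 ≃ₗᵢ[ℝ] E x) {v : E x → E x}
    {f f' : E x → ℝ} (hf : IsFibreHamiltonian o x v f) (hf' : IsFibreHamiltonian o x v f') {p : E x}
    (hp : ‖p‖ = 1) : f p = f' p := by
  have hfr : Module.finrank ℝ (E x) = 3 := (VectorBundle.finrank_eq ℝ E3 E x).trans (by simp)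
  have : FiniteDimensional ℝ (E x) := .of_finrank_pos (by omega)
  -- the difference, extended radially
  let D : E x → ℝ := fun y ↦ f (‖y‖⁻¹ • y) - f' (‖y‖⁻¹ • y)
  have hDs (c : ℝ) (hc : 0 < c) (y : E x) : D (c • y) = D y := by
    have : ‖c • y‖⁻¹ • c • y = ‖y‖⁻¹ • y := by
      rw [norm_smul, Real.norm_of_nonneg hc.le, smul_smul]
      congr 1
      field_simp
    simp only [D, this]
  have h1 (y : E x) (hy : ‖y‖ = 1) : HasFDerivAt D (0 : E x →L[ℝ] ℝ) y := by
    obtain ⟨d, hd⟩ := hf.1 y hy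
    obtain ⟨d', hd'⟩ := hf'.1 y hy
    have hDd : DifferentiableAt ℝ D y := d.sub d'
    have : fderiv ℝ D y = 0 := by
      ext t
      have hperp (t : E x) (ht : inner ℝ y t = (0 : ℝ)) : fderiv ℝ D y t = 0 := by
        have : fderiv ℝ D y = _ := fderiv_fun_sub d d'
        rw [this, sub_apply, hd t ht, hd' t ht, sub_self]
      have hrad : fderiv ℝ D y y = 0 := by
        have e1 : HasDerivAt (fun r : ℝ ↦ D (r • y)) (fderiv ℝ D y y) 1 := by
          have hl : HasDerivAt (fun r : ℝ ↦ r • y) y 1 := by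
            simpa using (hasDerivAt_id (1 : ℝ)).smul_const y
          have hD1 : HasFDerivAt D (fderiv ℝ D y) ((1 : ℝ) • y) := by
            rw [one_smul]; exact hDd.hasFDerivAt
          exact hD1.comp_hasDerivAt 1 hl
        have e2 : (fun r : ℝ ↦ D (r • y)) =ᶠ[𝓝 1] fun _ ↦ D y := by
          filter_upwards [lt_mem_nhds (zero_lt_one (α := ℝ))] with r hr using hDs r hr y
        exact (e1.congr_of_eventuallyEq e2.symm).unique (hasDerivAt_const _ _)
      have ht : t = (t - (inner ℝ y t : ℝ) • y) + (inner ℝ y t : ℝ) • y := by abel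
      rw [ht, map_add, map_smul, hrad, hperp, smul_zero, add_zero, zero_apply]
      rw [inner_sub_right, real_inner_smul_right, real_inner_self_eq_norm_sq, hy]
      ring
    rw [← this]
    exact hDd.hasFDerivAt
  have h2 (y : E x) (hy : y ≠ 0) : HasFDerivAt D (0 : E x →L[ℝ] ℝ) y := by
    have hn : 0 < ‖y‖⁻¹ := inv_pos.mpr (norm_pos_iff.mpr hy)
    have e1 : D = fun z ↦ D (‖y‖⁻¹ • z) := funext fun z ↦ (hDs _ hn z).symm
    rw [e1]
    have := (h1 (‖y‖⁻¹ • y) (by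
      rw [norm_smul, norm_inv, norm_norm, inv_mul_cancel₀ (norm_ne_zero_iff.mpr hy)])).comp y
      ((hasFDerivAt_id y).const_smul ‖y‖⁻¹)
    rw [ContinuousLinearMap.zero_comp] at this
    exact this
  have hconn : IsPreconnected ({0}ᶜ : Set (E x)) := by
    refine (isConnected_compl_singleton_of_one_lt_rank ?_ 0).isPreconnected
    rw [← Module.finrank_eq_rank, hfr]
    norm_num
  have hconst (y : E x) (hy : ‖y‖ = 1) : f y - f' y = D p := by
    have hy0 : y ≠ 0 := by intro h; rw [h, norm_zero] at hy; exact zero_ne_one hy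
    have hp0 : p ≠ 0 := by intro h; rw [h, norm_zero] at hp; exact zero_ne_one hp
    have := isOpen_compl_singleton.is_const_of_fderiv_eq_zero hconn
      (fun z hz ↦ (h2 z hz).differentiableAt.differentiableWithinAt)
      (fun z hz ↦ (h2 z hz).fderiv) hy0 hp0
    rw [← this]
    simp only [D, hy, inv_one, one_smul]
  have hcont {f : E x → ℝ} (hf : IsFibreHamiltonian o x v f) :
      Integrable (fun q : Metric.sphere (0 : E3) 1 ↦ f (ℓ q)) (volume : Measure E3).toSphere := by
    refine Continuous.integrable_of_hasCompactSupport ?_ (HasCompactSupport.of_compactSpace _)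
    rw [continuous_iff_continuousAt]
    intro q
    have hq : ‖ℓ (q : E3)‖ = 1 := by simp
    have h3 := (hf.1 _ hq).1.continuousAt
    have h4 : ContinuousAt (fun q : Metric.sphere (0 : E3) 1 ↦ f (‖ℓ (q : E3)‖⁻¹ • ℓ (q : E3))) q :=
      h3.comp (f := fun q : Metric.sphere (0 : E3) 1 ↦ ℓ (q : E3)) (by fun_prop)
    simpa using h4
  have hint : ∫ q : Metric.sphere (0 : E3) 1, (f (ℓ q) - f' (ℓ q))
      ∂(volume : Measure E3).toSphere = 0 := by
    rw [integral_sub (hcont hf) (hcont hf'), hf.2 ℓ, hf'.2 ℓ, sub_zero]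
  have hne : (volume : Measure E3).toSphere.real Set.univ ≠ 0 := by
    rw [measureReal_def, ENNReal.toReal_ne_zero]
    refine ⟨?_, measure_ne_top _ _⟩
    rw [Ne, Measure.measure_univ_eq_zero]
    exact Measure.toSphere_ne_zero _
  have hDp : D p = 0 := by
    rw [integral_congr_ae (g := fun _ ↦ D p) (Eventually.of_forall fun q ↦ hconst _ (by simp)),
      integral_const, smul_eq_mul] at hint
    exact (mul_eq_zero.mp hint).resolve_left hne
  have := hconst p hp
  rw [hDp] at this
  linarith

theorem fibreHamiltonian_eq {x : X} (ℓ : E3 ≃ₗᵢ[ℝ] E x) {v : E x → E x} {f : E x → ℝ}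
    (hf : IsFibreHamiltonian o x v f) {p : E x} (hp : ‖p‖ = 1) :
    fibreHamiltonian o x v p = f p := by
  have h : ∃ f, IsFibreHamiltonian o x v f := ⟨f, hf⟩
  rw [fibreHamiltonian, dif_pos h]
  exact h.choose_spec.eq_of_norm_eq_one ℓ hf hp

end Hamiltonian

section Frame

open Filter Topology

variable {X : Type*} [TopologicalSpace X] [ChartedSpace E4 X] [IsManifold (𝓡 4) ∞ X]
  {E : X → Type*} [TopologicalSpace (TotalSpace E3 E)]
  [∀ x, NormedAddCommGroup (E x)] [∀ x, InnerProductSpace ℝ (E x)]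
  [FiberBundle E3 E] [VectorBundle ℝ E3 E]
  [ContMDiffVectorBundle ∞ E3 E (𝓡 4)] [IsContMDiffRiemannianBundle (𝓡 4) ∞ E3 E]
  {L : ∀ x, E3 ≃ₗᵢ[ℝ] E x} {U : Set X}

variable {o : ∀ x, Orientation ℝ (E x) (Fin 3)}

/-! ### Test fields -/

/-- The vector field on `ℝ³` which restricts on the unit sphere to the Hamiltonian vector field of
`p₀ p₁`. -/
noncomputable def hamVec (p : E3) : E3 := !₂[p 0 * p 2, -(p 1 * p 2), p 1 ^ 2 - p 0 ^ 2]

theorem inner_hamVec (p : E3) : inner ℝ p (hamVec p) = (0 : ℝ) := by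
  rw [inner_E3]
  simp [hamVec]
  ring

theorem contDiff_hamVec : ContDiff ℝ ∞ hamVec := by
  rw [contDiff_euclidean]
  intro i
  fin_cases i <;> simp [hamVec] <;> fun_prop

/-- `hamVec` is divergence free on the unit sphere. -/
theorem trace_fderiv_hamVec {p : E3} (hp : ‖p‖ = 1) :
    LinearMap.trace ℝ E3 (fderiv ℝ (fun y ↦ hamVec (gsPos y)) p : E3 →ₗ[ℝ] E3) = 0 := by
  have hp0 : p ≠ 0 := by rintro rfl; simp at hp
  have hg := gsPos_of_norm_eq_one hp
  have h1 : fderiv ℝ (fun y ↦ hamVec (gsPos y)) p =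
      (fderiv ℝ hamVec p).comp (fderiv ℝ gsPos p) := by
    have := fderiv_comp p (g := hamVec) (f := gsPos)
      (contDiff_hamVec.differentiable (by simp) _)
      ((contDiffAt_gsPos hp0).differentiableAt (by simp))
    rw [hg] at this
    exact this
  have hc (i : Fin 3) : HasFDerivAt (fun y : E3 ↦ y i) (EuclideanSpace.proj i : E3 →L[ℝ] ℝ) p :=
    (EuclideanSpace.proj i : E3 →L[ℝ] ℝ).hasFDerivAt
  have h2 (i : Fin 3) (a : E3) : fderiv ℝ hamVec p a i = fderiv ℝ (fun y ↦ hamVec y i) p a := by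
    have := ((EuclideanSpace.proj i : E3 →L[ℝ] ℝ).hasFDerivAt (x := hamVec p)).comp p
      (contDiff_hamVec.differentiable (by simp) p).hasFDerivAt
    have h3 : fderiv ℝ (fun y ↦ hamVec y i) p = _ := this.fderiv
    rw [h3]
    rfl
  have d0 (a : E3) : fderiv ℝ hamVec p a 0 = p 0 * a 2 + p 2 * a 0 := by
    rw [h2]
    have : fderiv ℝ (fun y ↦ hamVec y 0) p = _ := ((hc 0).mul (hc 2)).fderiv
    rw [this]
    simp
  have d1 (a : E3) : fderiv ℝ hamVec p a 1 = -(p 1 * a 2 + p 2 * a 1) := by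
    rw [h2]
    have : fderiv ℝ (fun y ↦ hamVec y 1) p = _ := ((hc 1).mul (hc 2)).neg.fderiv
    rw [this]
    simp
  have d2 (a : E3) : fderiv ℝ hamVec p a 2 = 2 * p 1 * a 1 - 2 * p 0 * a 0 := by
    rw [h2]
    have : fderiv ℝ (fun y ↦ hamVec y 2) p = _ := (((hc 1).pow 2).sub ((hc 0).pow 2)).fderiv
    rw [this]
    simp
  rw [h1, LinearMap.trace_eq_sum_inner _ (EuclideanSpace.basisFun (Fin 3) ℝ), Fin.sum_univ_three]
  simp only [EuclideanSpace.basisFun_apply, EuclideanSpace.inner_single_left,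
    ContinuousLinearMap.coe_coe, ContinuousLinearMap.comp_apply, d0, d1, d2, fderiv_gsPos hp,
    EuclideanSpace.inner_single_right]
  simp
  ring

theorem trace_fderiv_radial_hamVec {x : X} (ℓ : E3 ≃ₗᵢ[ℝ] E x) (c : ℝ) {P : E x}
    (hP : ‖P‖ = 1) : LinearMap.trace ℝ (E x)
      (fderiv ℝ (fun y : E x ↦ c • ℓ (hamVec (ℓ.symm (‖y‖⁻¹ • y)))) P : E x →ₗ[ℝ] E x) = 0 := by
  have hp : ‖ℓ.symm P‖ = 1 := by simpa
  have hp0 : ℓ.symm P ≠ 0 := by intro h; rw [h] at hp; simp at hp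
  have e1 : (fun y : E x ↦ c • ℓ (hamVec (ℓ.symm (‖y‖⁻¹ • y)))) =
      fun y ↦ c • ℓ (hamVec (gsPos (ℓ.symm y))) := by
    funext y
    rw [map_smul, gsPos, ℓ.symm.norm_map]
  have hd : DifferentiableAt ℝ (fun y ↦ hamVec (gsPos y)) (ℓ.symm P) :=
    (contDiff_hamVec.differentiable (by simp) _).comp _
      ((contDiffAt_gsPos hp0).differentiableAt (by simp))
  let e : E3 ≃L[ℝ] E x := ℓ.toContinuousLinearEquiv
  have h2 : HasFDerivAt (fun y ↦ c • ℓ (hamVec (gsPos (ℓ.symm y))))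
      (c • (e : E3 →L[ℝ] E x).comp ((fderiv ℝ (fun y ↦ hamVec (gsPos y)) (ℓ.symm P)).comp
        (e.symm : E x →L[ℝ] E3))) P :=
    ((e : E3 →L[ℝ] E x).hasFDerivAt.comp P
      (hd.hasFDerivAt.comp P (e.symm : E x →L[ℝ] E3).hasFDerivAt)).const_smul c
  rw [e1, h2.fderiv]
  have h3 := LinearMap.trace_conj' (fderiv ℝ (fun y ↦ hamVec (gsPos y)) (ℓ.symm P) : E3 →ₗ[ℝ] E3)
    ℓ.toLinearEquiv
  rw [trace_fderiv_hamVec hp] at h3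
  have h4 : ((c • (e : E3 →L[ℝ] E x).comp ((fderiv ℝ (fun y ↦ hamVec (gsPos y)) (ℓ.symm P)).comp
        (e.symm : E x →L[ℝ] E3)) : E x →L[ℝ] E x) : E x →ₗ[ℝ] E x) = c • ℓ.toLinearEquiv.conj
        (fderiv ℝ (fun y ↦ hamVec (gsPos y)) (ℓ.symm P) : E3 →ₗ[ℝ] E3) := rfl
  rw [h4, map_smul, h3, smul_zero]

/-- The fibrewise Hamiltonian vector field of `χ p₀ p₁`, where `p₀, p₁, p₂` are the coordinates of
`p` in the frame `L` and `χ` is supported in the domain of `L`. -/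
noncomputable def testField (hL : IsSmoothFrame L U) (hU : IsOpen U) {χ : X → ℝ}
    (hχ : ContMDiff (𝓡 4) 𝓘(ℝ, ℝ) ∞ χ) (hs : tsupport χ ⊆ U) : LieGpi E where
  field x P := χ x • L x (hamVec ((L x).symm P))
  tangent x P _ := by
    have h := (L x).inner_map_map ((L x).symm P) (hamVec ((L x).symm P))
    rw [(L x).apply_symm_apply, inner_hamVec] at h
    rw [real_inner_smul_right, h, mul_zero]
  smooth := by
    intro z _
    refine ContMDiffAt.contMDiffWithinAt ?_
    have hproj : ContMDiffAt ((𝓡 4).prod 𝓘(ℝ, E3)) (𝓡 4) ∞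
        (TotalSpace.proj : TotalSpace E3 E → X) z :=
      contMDiffAt_proj E
    by_cases hz : z.1 ∈ U
    · have h1 := hL.contMDiffAt_symm hU (f := (TotalSpace.proj : TotalSpace E3 E → X))
        (s := fun z ↦ z.2) (IM := (𝓡 4).prod 𝓘(ℝ, E3)) (m := z) hz contMDiffAt_id
      have h2 := hL.contMDiffAt_comp hU (f := (TotalSpace.proj : TotalSpace E3 E → X))
        (IM := (𝓡 4).prod 𝓘(ℝ, E3)) (m := z) (σ := fun z ↦ χ z.1 • hamVec ((L z.1).symm z.2))
        hproj hz (contMDiffAt_fun_smul (hχ.contMDiffAt.comp z hproj)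
          (contDiff_hamVec.contMDiff.contMDiffAt.comp z h1))
      simpa only [map_smul] using h2
    · have h0 := ((contMDiff_zeroSection ℝ E (n := ∞) (IB := 𝓡 4)
        (F := E3)).contMDiffAt (x := z.1)).comp z hproj
      refine h0.congr_of_eventuallyEq ?_
      have hc : ∀ᶠ w : TotalSpace E3 E in 𝓝 z, w.1 ∈ (tsupport χ)ᶜ :=
        hproj.continuousAt.eventually
          ((isClosed_tsupport χ).isOpen_compl.mem_nhds fun h ↦ hz (hs h))
      filter_upwards [hc] with w hw
      rw [image_eq_zero_of_notMem_tsupport hw]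
      simp [Bundle.zeroSection]
  divFree x P hP := trace_fderiv_radial_hamVec (L x) (χ x) hP

theorem isFibreHamiltonian_testField (hL : IsSmoothFrame L U) (hU : IsOpen U) {χ : X → ℝ}
    (hχ : ContMDiff (𝓡 4) 𝓘(ℝ, ℝ) ∞ χ) (hs : tsupport χ ⊆ U) {ε : ℝ}
    (hε : ∀ y ∈ U, ∀ p s, cross o (L y p) (L y s) = ε • L y (crossE p s)) (x : X) :
    IsFibreHamiltonian o x ((testField hL hU hχ hs).field x)
      fun P ↦ ε * χ x * ((L x).symm P 0 * (L x).symm P 1) := by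
  set ℓ := L x
  refine ⟨fun P hP ↦ ?_, fun ℓ' ↦ ?_⟩
  · have hp : ‖ℓ.symm P‖ = 1 := by simpa
    have hp0 : ℓ.symm P ≠ 0 := by intro h; rw [h] at hp; simp at hp
    have e1 : (fun y : E x ↦ ε * χ x * (ℓ.symm (‖y‖⁻¹ • y) 0 * ℓ.symm (‖y‖⁻¹ • y) 1)) =
        fun y ↦ ε * χ x * (gsPos (ℓ.symm y) 0 * gsPos (ℓ.symm y) 1) := by
      funext y
      rw [map_smul, gsPos, ℓ.symm.norm_map]
    set p := ℓ.symm P with hpdef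
    let e : E3 ≃L[ℝ] E x := ℓ.toContinuousLinearEquiv
    have hg : HasFDerivAt (fun y : E x ↦ gsPos (ℓ.symm y))
        ((fderiv ℝ gsPos p).comp (e.symm : E x →L[ℝ] E3)) P :=
      ((contDiffAt_gsPos hp0).differentiableAt (by simp)).hasFDerivAt.comp P
        (e.symm : E x →L[ℝ] E3).hasFDerivAt
    have hc (i : Fin 3) := ((EuclideanSpace.proj i : E3 →L[ℝ] ℝ).hasFDerivAt
      (x := gsPos (ℓ.symm P))).comp P hg
    have hd := ((hc 0).mul (hc 1)).const_mul (ε * χ x)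
    rw [e1]
    refine ⟨hd.differentiableAt, fun t ht ↦ ?_⟩
    have hf : fderiv ℝ (fun y ↦ ε * χ x * (gsPos (ℓ.symm y) 0 * gsPos (ℓ.symm y) 1)) P = _ :=
      hd.fderiv
    have hpt : inner ℝ p (ℓ.symm t) = (0 : ℝ) := by rw [hpdef, ℓ.symm.inner_map_map, ht]
    have hdg : fderiv ℝ gsPos p (ℓ.symm t) = ℓ.symm t := by
      rw [fderiv_gsPos hp, hpt, zero_smul, sub_zero]
    have hL1 : fderiv ℝ (fun y ↦ ε * χ x * (gsPos (ℓ.symm y) 0 * gsPos (ℓ.symm y) 1)) P t =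
        ε * χ x * (p 0 * ℓ.symm t 1 + p 1 * ℓ.symm t 0) := by
      have hdg' : fderiv ℝ gsPos p (e.symm t) = ℓ.symm t := hdg
      rw [hf]
      simp only [smul_apply, add_apply, ContinuousLinearMap.comp_apply,
        ContinuousLinearEquiv.coe_coe, hdg', smul_eq_mul, Function.comp_apply, gsPos_of_norm_eq_one hp, ← hpdef, PiLp.proj_apply]
    rw [hL1]
    by_cases hx : x ∈ U
    · have hcr : cross o P ((testField hL hU hχ hs).field x P) =
          ε • ℓ (crossE p (χ x • hamVec p)) := by
        have := hε x hx p (χ x • hamVec p)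
        rw [← this]
        change cross o P (χ x • ℓ (hamVec p)) = cross o (ℓ p) (ℓ (χ x • hamVec p))
        rw [map_smul, hpdef, ℓ.apply_symm_apply]
      have h1 := hp
      rw [← sq_eq_sq₀ (norm_nonneg _) zero_le_one, ← real_inner_self_eq_norm_sq, inner_E3] at h1
      have h2 := hpt
      rw [inner_E3] at h2
      rw [hcr, real_inner_smul_left, LinearIsometryEquiv.inner_map_eq_flip, inner_E3]
      simp [hamVec]
      linear_combination (-(ε * χ x * (ℓ.symm t 0 * p 1 + ℓ.symm t 1 * p 0))) * h1 
        + 2 * ε * χ x * p 0 * p 1 * h2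
    · have h0 : χ x = 0 := image_eq_zero_of_notMem_tsupport fun h ↦ hx (hs h)
      have hf0 : (testField hL hU hχ hs).field x P = 0 := by
        change χ x • _ = _
        rw [h0, zero_smul]
      rw [hf0, h0, cross, inner_crossOf]
      simp only [mul_zero, zero_mul]
      exact (AlternatingMap.map_coord_zero _ 1 rfl).symm
  · simp only [MeasureTheory.integral_const_mul]
    have h1 := integral_sphere_comp (ℓ'.trans ℓ.symm) fun p ↦ p 0 * p 1
    rw [integral_mul_coord_eq_zero] at h1
    have h2 := congrArg (fun z ↦ ε * χ x * z) h1
    simpa using h2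

/-! ### The intersection form of the curvature components -/

theorem wedge_comm {T : Type*} (α β : T → T → ℝ) (hα : ∀ u v, α u v = -α v u)
    (hβ : ∀ u v, β u v = -β v u) (t : Fin 4 → T) : wedge α β t = wedge β α t := by
  have ht : t = ![t 0, t 1, t 2, t 3] := by ext i; fin_cases i <;> rfl
  rw [ht, wedge_eq α β hα hβ, wedge_eq β α hβ hα]
  ring

theorem curvWedge_comm {T : Type*} {β : T → T → E3} (hβ : ∀ u v, β u v = -β v u) (t : Fin 4 → T)
    (a b : E3) : curvWedge β t a b = curvWedge β t b a :=
  wedge_comm (fun u v ↦ inner ℝ (β u v) a) (fun u v ↦ inner ℝ (β u v) b)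
    (fun u v ↦ by rw [hβ, inner_neg_left]) (fun u v ↦ by rw [hβ, inner_neg_left]) t

theorem curvWedge_eq_det_mul {T : Type*} [AddCommGroup T] [Module ℝ T] (β : T →ₗ[ℝ] T →ₗ[ℝ] E3)
    (b : Module.Basis (Fin 4) ℝ T) (t : Fin 4 → T) (p q : E3) :
    curvWedge (fun u v ↦ β u v) t p q = b.det t * curvWedge (fun u v ↦ β u v) b p q :=
  wedge_eq_det_mul (β.compr₂ ((innerₗ E3).flip p)) (β.compr₂ ((innerₗ E3).flip q)) b t

/-- The standard basis of a tangent space. -/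
noncomputable def tangentBasis (x : X) : Module.Basis (Fin 4) ℝ (TangentSpace (𝓡 4) x) :=
  (EuclideanSpace.basisFun (Fin 4) ℝ).toBasis

theorem curvWedge_self_ne_zero [T2Space X] (A : CovariantDerivative (𝓡 4) E3 E)
    (hdef : IsDefinite A) {x : X} {ℓ : E3 ≃ₗᵢ[ℝ] E x}
    {β : TangentSpace (𝓡 4) x →ₗ[ℝ] TangentSpace (𝓡 4) x →ₗ[ℝ] E3}
    (hβa : ∀ u v, β u v = -β v u)
    (hβ : ∀ u v σ, bundleCurvature A x u v (ℓ σ) = ℓ (crossE (β u v) σ)) {p : E3} (hp : p ≠ 0) :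
    curvWedge (fun u v ↦ β u v) (tangentBasis x) p p ≠ 0 := by
  intro h
  obtain ⟨u, hu, hu'⟩ := exists_ne_zero_of_wedge_self_eq_zero (β.compr₂ ((innerₗ E3).flip p))
    (fun u v ↦ by
      simp only [LinearMap.compr₂_apply, LinearMap.flip_apply, innerₗ_apply_apply]
      rw [hβa, inner_neg_left]) (tangentBasis x) h
  exact hu (curvature_nondegenerate A hdef hβ hp hu')

variable {φ : OpenPartialHomeomorph X E4}

theorem det_coordFrame_ne_zero (hφ : φ ∈ IsManifold.maximalAtlas (𝓡 4) ∞ X) {y : E4}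
    (hy : y ∈ φ.target) : (tangentBasis (φ.symm y)).det (coordFrame φ y) ≠ 0 := by
  have h1 : MDifferentiableAt (𝓡 4) (𝓡 4) φ.symm y :=
    ((contMDiffOn_symm_of_mem_maximalAtlas hφ).contMDiffAt
      (φ.open_target.mem_nhds hy)).mdifferentiableAt (by simp)
  have h2 : MDifferentiableAt (𝓡 4) (𝓡 4) φ (φ.symm y) :=
    ((contMDiffOn_of_mem_maximalAtlas hφ).contMDiffAt
      (φ.open_source.mem_nhds (φ.map_target hy))).mdifferentiableAt (by simp)
  let D : E4 →L[ℝ] E4 := mfderiv (𝓡 4) (𝓡 4) φ.symm y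
  let D' : E4 →L[ℝ] E4 := mfderiv (𝓡 4) (𝓡 4) φ (φ.symm y)
  have h3 : D'.comp D = ContinuousLinearMap.id ℝ E4 := by
    have e1 : HasFDerivAt (fun z ↦ φ (φ.symm z)) (D'.comp D) y :=
      (h2.hasMFDerivAt.comp y h1.hasMFDerivAt).hasFDerivAt
    refine e1.unique ((hasFDerivAt_id y).congr_of_eventuallyEq ?_)
    filter_upwards [φ.open_target.mem_nhds hy] with z hz using φ.right_inv hz
  let b : Module.Basis (Fin 4) ℝ E4 := (EuclideanSpace.basisFun (Fin 4) ℝ).toBasis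
  have h4 : b.det (D ∘ b) = LinearMap.det (D : E4 →ₗ[ℝ] E4) * b.det b :=
    b.det_comp (D : E4 →ₗ[ℝ] E4) b
  rw [b.det_self, mul_one] at h4
  have h5 : (tangentBasis (φ.symm y)).det (coordFrame φ y) = b.det (D ∘ b) := by
    refine congrArg b.det (funext fun i ↦ ?_)
    simp only [b, Function.comp_apply, OrthonormalBasis.coe_toBasis, EuclideanSpace.basisFun_apply]
    rfl
  rw [h5, h4]
  intro h
  have h6 : LinearMap.det ((D' : E4 →ₗ[ℝ] E4) ∘ₗ (D : E4 →ₗ[ℝ] E4)) = 1 := by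
    have : (D' : E4 →ₗ[ℝ] E4) ∘ₗ (D : E4 →ₗ[ℝ] E4) = LinearMap.id := by
      ext1 z
      exact congrArg (fun T : E4 →L[ℝ] E4 ↦ T z) h3
    rw [this, LinearMap.det_id]
  rw [LinearMap.det_comp, h, mul_zero] at h6
  exact zero_ne_one h6

/-- The 4-form `F_a ∧ F_b` at `x`, on four tangent vectors. -/
noncomputable def compWedge (A : CovariantDerivative (𝓡 4) E3 E) (L : ∀ x, E3 ≃ₗᵢ[ℝ] E x)
    (a b : Fin 3) (x : X) (t : Fin 4 → TangentSpace (𝓡 4) x) : ℝ :=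
  wedge (curvatureComponent A x (L x) a) (curvatureComponent A x (L x) b) t

theorem compWedge_eq_curvWedge {A : CovariantDerivative (𝓡 4) E3 E} {x : X}
    {β : TangentSpace (𝓡 4) x →ₗ[ℝ] TangentSpace (𝓡 4) x →ₗ[ℝ] E3}
    (hcc : ∀ k u v, curvatureComponent A x (L x) k u v = β u v k) (a b : Fin 3)
    (t : Fin 4 → TangentSpace (𝓡 4) x) : compWedge A L a b x t =
      curvWedge (fun u v ↦ β u v) t (EuclideanSpace.single a 1) (EuclideanSpace.single b 1) := by
  rw [curvWedge_single, compWedge]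
  congr 1 <;> (funext u v; exact hcc _ u v)

theorem compWedge_eq_det_mul [T2Space X] (ho : IsBundleOrientation o)
    (A : CovariantDerivative (𝓡 4) E3 E) [A.ContMDiffCovariantDerivative ∞]
    (hA : A.IsMetricCompatible) (a b : Fin 3) (x : X) (t : Fin 4 → TangentSpace (𝓡 4) x) :
    compWedge A L a b x t = (tangentBasis x).det t * compWedge A L a b x (tangentBasis x) := by
  obtain ⟨β, -, -, hcc⟩ := exists_curvature_vector ho A hA x (L x)
  rw [compWedge_eq_curvWedge hcc, compWedge_eq_curvWedge hcc, curvWedge_eq_det_mul]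

theorem compWedge_self_ne_zero [T2Space X] (ho : IsBundleOrientation o)
    (A : CovariantDerivative (𝓡 4) E3 E) [A.ContMDiffCovariantDerivative ∞]
    (hA : A.IsMetricCompatible) (hdef : IsDefinite A) (a : Fin 3) (x : X) :
    compWedge A L a a x (tangentBasis x) ≠ 0 := by
  obtain ⟨β, hβa, hβ, hcc⟩ := exists_curvature_vector ho A hA x (L x)
  rw [compWedge_eq_curvWedge hcc]
  exact curvWedge_self_ne_zero A hdef hβa hβ (by simp)

set_option synthInstance.maxHeartbeats 200000 in
theorem continuousOn_compWedge [T2Space X] (A : CovariantDerivative (𝓡 4) E3 E)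
    [A.ContMDiffCovariantDerivative ∞] (hL : IsSmoothFrame L U) (hU : IsOpen U)
    (hφ : φ ∈ IsManifold.maximalAtlas (𝓡 4) ∞ X) (a b : Fin 3) :
    ContinuousOn (fun y ↦ compWedge A L a b (φ.symm y) (coordFrame φ y))
      (φ.target ∩ φ.symm ⁻¹' U) := by
  have hf : ContMDiffOn (𝓡 4) (𝓡 4) ∞ φ.symm φ.target := contMDiffOn_symm_of_mem_maximalAtlas hφ
  have hV : IsOpen (φ.target ∩ φ.symm ⁻¹' U) :=
    hf.continuousOn.isOpen_inter_preimage φ.open_target hU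
  have hα : ContDiffOn ℝ ∞ (pullMat A L φ.symm) (φ.target ∩ φ.symm ⁻¹' U) :=
    hL.contDiffOn_pullMat A hU hV (hf.mono Set.inter_subset_left) fun _ hz ↦ hz.2
  have hα' := hα.continuousOn_fderiv_of_isOpen hV (by simp)
  have hcurv (u v : E4) (σ : E3) : ContinuousOn (fun y ↦ pullCurv A L φ.symm y u v σ)
      (φ.target ∩ φ.symm ⁻¹' U) := by
    have c0 := hα.continuousOn
    have c1 (u : E4) : ContinuousOn (fun y ↦ pullMat A L φ.symm y u) (φ.target ∩ φ.symm ⁻¹' U) :=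
      c0.clm_apply continuousOn_const
    have c2 (u v : E4) : ContinuousOn (fun y ↦ fderiv ℝ (pullMat A L φ.symm) y u v)
      (φ.target ∩ φ.symm ⁻¹' U) :=
      (hα'.clm_apply continuousOn_const).clm_apply continuousOn_const
    refine ContinuousOn.clm_apply ?_ continuousOn_const
    exact (((c2 u v).sub (c2 v u)).add ((c1 u).clm_comp (c1 v))).sub ((c1 v).clm_comp (c1 u))
  have hcc (k : Fin 3) (i j : Fin 4) : ContinuousOn (fun y ↦
      curvatureComponent A (φ.symm y) (L (φ.symm y)) k (coordFrame φ y i) (coordFrame φ y j))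
      (φ.target ∩ φ.symm ⁻¹' U) := by
    have h1 : ContinuousOn (fun y ↦ (inner ℝ (pullCurv A L φ.symm y (EuclideanSpace.single i 1)
      (EuclideanSpace.single j 1) (EuclideanSpace.single (k + 1) 1))
      (EuclideanSpace.single (k + 2) 1) : ℝ)) (φ.target ∩ φ.symm ⁻¹' U) :=
      (hcurv _ _ _).inner continuousOn_const
    refine h1.congr fun y hy ↦ ?_
    have h2 := bundleCurvature_mfderiv A hL hU hV (hf.mono Set.inter_subset_left) hy hy.2
      (EuclideanSpace.single i 1) (EuclideanSpace.single j 1) (EuclideanSpace.single (k + 1) 1)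
    exact (congrArg (fun z ↦ (inner ℝ z (L (φ.symm y) (EuclideanSpace.single (k + 2) 1)) : ℝ))
      h2).trans ((L (φ.symm y)).inner_map_map _ _)
  simp only [compWedge, wedge]
  refine continuousOn_const.mul (continuousOn_finsetSum _ fun σ _ ↦ continuousOn_const.mul ?_)
  exact (hcc a _ _).mul (hcc b _ _)

open MeasureTheory

/-! ### Zeros of the moment map are perfect -/

/-- The contribution of a fibre to the moment map, evaluated on a test field. -/
theorem integral_pairing_testField [T2Space X] (ho : IsBundleOrientation o)
    (A : CovariantDerivative (𝓡 4) E3 E) [A.ContMDiffCovariantDerivative ∞]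
    (hA : A.IsMetricCompatible) (hdef : IsDefinite A) (hL : IsSmoothFrame L U) (hU : IsOpen U)
    {χ : X → ℝ} (hχ : ContMDiff (𝓡 4) 𝓘(ℝ, ℝ) ∞ χ) (hs : tsupport χ ⊆ U) {ε : ℝ}
    (hε : ∀ y ∈ U, ∀ p s, cross o (L y p) (L y s) = ε • L y (crossE p s))
    (hφ : φ ∈ IsManifold.maximalAtlas (𝓡 4) ∞ X) {F : ∀ x, E3 ≃ₗᵢ[ℝ] E x}
    (hF : IsSmoothFrame F φ.source) {y : E4} (hy : y ∈ φ.target) (r : ℝ) :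
    ∫ p : Metric.sphere (0 : E3) 1, r *
        pairing (inducedConnection o A) (lift o (testField hL hU hχ hs)) (φ.symm y)
          (F (φ.symm y) p) *
        density (inducedConnection o A) φ F y p ∂(volume : Measure E3).toSphere =
      ε * (3 * (1 / (2 * Real.pi)) ^ 3) * (2 * sphereMoment) * (r * χ (φ.symm y) *
        (compWedge A L 0 1 (φ.symm y) (coordFrame φ y) *
          (compWedge A L 0 0 (φ.symm y) (coordFrame φ y) /
            |compWedge A L 0 0 (φ.symm y) (coordFrame φ y)|))) := by
  let x := φ.symm y
  obtain ⟨β, hβa, hβ, hcc⟩ := exists_curvature_vector ho A hA x (L x)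
  let t : Fin 4 → TangentSpace (𝓡 4) x := coordFrame φ y
  let B := curvWedge (fun u v ↦ β u v) t
  let g : E3 ≃ₗᵢ[ℝ] E3 := (F x).trans (L x).symm
  have hB (p : E3) (hp : ‖p‖ = 1) : B p p ≠ 0 := by
    have h1 : B p p = (tangentBasis x).det t * curvWedge (fun u v ↦ β u v) (tangentBasis x) p p :=
      curvWedge_eq_det_mul β (tangentBasis x) t p p
    rw [h1]
    refine mul_ne_zero (det_coordFrame_ne_zero hφ hy) (curvWedge_self_ne_zero A hdef hβa hβ ?_)
    rintro rfl
    simp at hp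
  have hint (p : Metric.sphere (0 : E3) 1) : r *
        pairing (inducedConnection o A) (lift o (testField hL hU hχ hs)) (φ.symm y)
          (F (φ.symm y) p) * density (inducedConnection o A) φ F y p =
      (ε * (3 * (1 / (2 * Real.pi)) ^ 3) * (r * χ x)) * (g p 0 * g p 1 * |B (g p) (g p)|) := by
    rw [pairing_lift ho A _ _ (by simp), density_inducedConnection ho A hA hφ hF hy (by simp) hβ,
      fibreHamiltonian_eq (F (φ.symm y)) (isFibreHamiltonian_testField hL hU hχ hs hε _) (by simp)]
    change r * (ε * χ x * (g p 0 * g p 1)) * (3 * (1 / (2 * Real.pi)) ^ 3 * |B (g p) (g p)|) = _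
    ring
  rw [integral_congr_ae (Eventually.of_forall hint), integral_const_mul,
    integral_sphere_comp g (fun p ↦ p 0 * p 1 * |B p p|),
    integral_mul_abs_quadratic B (curvWedge_comm hβa t) hB]
  rw [compWedge_eq_curvWedge hcc, compWedge_eq_curvWedge hcc]
  ring

/-- If `F₀ ∧ F₁ ≠ 0` at a point, then near this point the sign of `F₀ ∧ F₁` relative to the orientation
given by `F₀ ∧ F₀` is constant, and a test field concentrated there has non-zero moment. -/
theorem compWedge_eq_zero_of_momentMapPi_eq_zero [T2Space X] [CompactSpace X]
    (ho : IsBundleOrientation o)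
    (A : CovariantDerivative (𝓡 4) E3 E) [A.ContMDiffCovariantDerivative ∞]
    (hA : A.IsMetricCompatible) (hdef : IsDefinite A)
    (hm : momentMapPi o (inducedConnection o A) = 0) {x₀ : X} (hL : IsSmoothFrame L U)
    (hU : IsOpen U) (hx₀ : x₀ ∈ U) {ε : ℝ} (hε1 : ε * ε = 1)
    (hε : ∀ y ∈ U, ∀ p s, cross o (L y p) (L y s) = ε • L y (crossE p s)) :
    compWedge A L 0 1 x₀ (tangentBasis x₀) = 0 := by
  by_contra h01
  have h00 := compWedge_self_ne_zero (L := L) ho A hA hdef 0 x₀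
  -- the form `F₀ ∧ F₁` in the orientation defined by `F₀ ∧ F₀`, up to a positive factor
  let s (x : X) : ℝ := compWedge A L 0 1 x (tangentBasis x) * compWedge A L 0 0 x (tangentBasis x)
  have hs0 : s x₀ ≠ 0 := mul_ne_zero h01 h00
  have hdet (φ : OpenPartialHomeomorph X E4) (y : E4) :
      compWedge A L 0 1 (φ.symm y) (coordFrame φ y) * compWedge A L 0 0 (φ.symm y) (coordFrame φ y)
        = (tangentBasis (φ.symm y)).det (coordFrame φ y) ^ 2 * s (φ.symm y) := by
    rw [compWedge_eq_det_mul ho A hA 0 1, compWedge_eq_det_mul ho A hA 0 0]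
    simp only [s]
    ring
  have hVopen {φ : OpenPartialHomeomorph X E4} : IsOpen (φ.target ∩ φ.symm ⁻¹' U) :=
    φ.symm.isOpen_inter_preimage hU
  have hsign : ∀ᶠ x in 𝓝 x₀, 0 < s x * s x₀ := by
    let φ := chartAt E4 x₀
    have hφ : φ ∈ IsManifold.maximalAtlas (𝓡 4) ∞ X := IsManifold.chart_mem_maximalAtlas x₀
    have hxs : x₀ ∈ φ.source := mem_chart_source E4 x₀
    have hc := ((continuousOn_compWedge A hL hU hφ 0 1).mul
      (continuousOn_compWedge A hL hU hφ 0 0)).continuousAt (hVopen.mem_nhds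
        ⟨φ.map_source hxs, by rw [Set.mem_preimage, φ.left_inv hxs]; exact hx₀⟩)
    have hpos : 0 < (compWedge A L 0 1 (φ.symm (φ x₀)) (coordFrame φ (φ x₀)) *
        compWedge A L 0 0 (φ.symm (φ x₀)) (coordFrame φ (φ x₀))) * s x₀ := by
      rw [hdet, φ.left_inv hxs, mul_assoc]
      exact mul_pos (sq_pos_of_ne_zero (det_coordFrame_ne_zero hφ (φ.map_source hxs)))
        (mul_self_pos.mpr hs0)
    have hev : ∀ᶠ y in 𝓝 (φ x₀), 0 < (compWedge A L 0 1 (φ.symm y) (coordFrame φ y) *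
        compWedge A L 0 0 (φ.symm y) (coordFrame φ y)) * s x₀ :=
      (hc.mul_const (s x₀)).eventually (lt_mem_nhds hpos)
    filter_upwards [(φ.continuousAt hxs).eventually hev, φ.open_source.mem_nhds hxs] with x hx hx'
    rw [hdet, φ.left_inv hx', mul_assoc] at hx
    exact pos_of_mul_pos_right hx (sq_nonneg _)
  obtain ⟨f, -, hf⟩ := (SmoothBumpFunction.nhds_basis_tsupport (I := 𝓡 4) x₀).mem_iff.mp
    (inter_mem (hU.mem_nhds hx₀) hsign)
  have hfU : tsupport f ⊆ U := fun x hx ↦ (hf hx).1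
  have hfs (x : X) (hx : x ∈ tsupport f) : 0 < s x * s x₀ := (hf hx).2
  have hmv := congrFun hm (testField hL hU f.contMDiff hfU)
  have hC : Nonempty (TrivializingCover E) := nonempty_trivializingCover ho
  rw [Pi.zero_apply, momentMapPi, momentMap, integralZ, dif_pos hC] at hmv
  set C := hC.some
  have hmv' := (mul_eq_zero.mp hmv).resolve_left (by positivity)
  let J (i : Fin C.n) (y : E4) : ℝ :=
    C.rho i ((C.chart i).symm y) * f ((C.chart i).symm y) *
      (compWedge A L 0 1 ((C.chart i).symm y) (coordFrame (C.chart i) y) *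
        (compWedge A L 0 0 ((C.chart i).symm y) (coordFrame (C.chart i) y) /
          |compWedge A L 0 0 ((C.chart i).symm y) (coordFrame (C.chart i) y)|)) * s x₀
  have hJ0 (i) (y : E4) (h : (C.chart i).symm y ∉ tsupport f) : J i y = 0 := by
    simp only [J]
    rw [image_eq_zero_of_notMem_tsupport h]
    ring
  have hne (i) (y : E4) (hy : y ∈ (C.chart i).target) :
      compWedge A L 0 0 ((C.chart i).symm y) (coordFrame (C.chart i) y) ≠ 0 := by
    rw [compWedge_eq_det_mul ho A hA 0 0]
    exact mul_ne_zero (det_coordFrame_ne_zero (C.chart_mem i) hy)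
      (compWedge_self_ne_zero ho A hA hdef 0 _)
  have hpos (i) (y : E4) (hy : y ∈ (C.chart i).target)
      (h : (C.chart i).symm y ∈ tsupport f) :
      0 < compWedge A L 0 1 ((C.chart i).symm y) (coordFrame (C.chart i) y) *
        (compWedge A L 0 0 ((C.chart i).symm y) (coordFrame (C.chart i) y) /
          |compWedge A L 0 0 ((C.chart i).symm y) (coordFrame (C.chart i) y)|) * s x₀ := by
    rw [← mul_div_assoc, hdet, div_mul_eq_mul_div, mul_assoc]
    have h1 := det_coordFrame_ne_zero (C.chart_mem i) hy
    have h2 := hfs _ h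
    have h3 := hne i y hy
    positivity
  have hJnn (i) (y : E4) (hy : y ∈ (C.chart i).target) : 0 ≤ J i y := by
    by_cases h : (C.chart i).symm y ∈ tsupport f
    · simp only [J]
      rw [mul_assoc]
      exact mul_nonneg (mul_nonneg (C.rho.nonneg i _) f.nonneg) (hpos i y hy h).le
    · exact (hJ0 i y h).ge
  have hsum : ∑ i, ∫ y in (C.chart i).target, J i y = 0 := by
    have hK : ε * (3 * (1 / (2 * Real.pi)) ^ 3) * (2 * sphereMoment) ≠ 0 := by
      have h1 : ε ≠ 0 := by rintro rfl; simp at hε1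
      have h2 := sphereMoment_pos.ne'
      have := Real.pi_pos.ne'
      positivity
    have h1 (i) : ∫ y in (C.chart i).target, J i y = (∫ y in (C.chart i).target,
        ∫ p : Metric.sphere (0 : E3) 1, C.rho i ((C.chart i).symm y) *
          pairing (inducedConnection o A) (lift o (testField hL hU f.contMDiff hfU))
            ((C.chart i).symm y) (C.frame i ((C.chart i).symm y) p) *
          density (inducedConnection o A) (C.chart i) (C.frame i) y p
          ∂(volume : Measure E3).toSphere) *
        ((ε * (3 * (1 / (2 * Real.pi)) ^ 3) * (2 * sphereMoment))⁻¹ * s x₀) := by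
      rw [← integral_mul_const]
      refine setIntegral_congr_fun (C.chart i).open_target.measurableSet fun y hy ↦ ?_
      simp only [J]
      rw [integral_pairing_testField ho A hA hdef hL hU f.contMDiff hfU hε (C.chart_mem i)
        (C.frame_smooth i) hy]
      have hcancel (k a b : ℝ) (hk : k ≠ 0) : a * b = k * a * (k⁻¹ * b) := by field_simp
      exact hcancel _ _ _ hK
    simp only [h1]
    rw [← Finset.sum_mul, hmv', zero_mul]
  -- a chart of the cover in which the integrand is positive at the given point
  obtain ⟨i, hi⟩ : ∃ i, C.rho i x₀ ≠ 0 := by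
    by_contra! h
    have := C.rho.sum_eq_one (Set.mem_univ x₀)
    simp [h] at this
  set φ := C.chart i with hφdef
  have hφ : φ ∈ IsManifold.maximalAtlas (𝓡 4) ∞ X := C.chart_mem i
  have hxs : x₀ ∈ φ.source := C.subordinate i (subset_tsupport _ hi)
  have hzero : ∫ y in φ.target, J i y = 0 :=
    (Finset.sum_eq_zero_iff_of_nonneg fun i _ ↦ setIntegral_nonneg
      (C.chart i).open_target.measurableSet (hJnn i)).mp hsum i (Finset.mem_univ i)
  have hcont : ContinuousOn (J i) (φ.target ∩ φ.symm ⁻¹' U) := by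
    have c0 := continuousOn_compWedge A hL hU hφ 0 0
    have c1 := continuousOn_compWedge A hL hU hφ 0 1
    have cs : ContinuousOn φ.symm (φ.target ∩ φ.symm ⁻¹' U) :=
      φ.continuousOn_symm.mono Set.inter_subset_left
    refine ((((C.rho i).contMDiff.continuous.comp_continuousOn cs).mul
      (f.continuous.comp_continuousOn cs)).mul (c1.mul (c0.div c0.abs fun y hy ↦ ?_))).mul
      continuousOn_const
    exact abs_ne_zero.mpr (hne i y hy.1)
  let K : Set X := tsupport (C.rho i) ∩ tsupport f
  have hKc : IsCompact K := ((isClosed_tsupport _).inter (isClosed_tsupport _)).isCompact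
  have hKs : K ⊆ φ.source := fun x hx ↦ C.subordinate i hx.1
  have hKV : φ '' K ⊆ φ.target ∩ φ.symm ⁻¹' U := by
    rintro _ ⟨x, hx, rfl⟩
    exact ⟨φ.map_source (hKs hx), by rw [Set.mem_preimage, φ.left_inv (hKs hx)]; exact hfU hx.2⟩
  have hint : IntegrableOn (J i) φ.target := by
    have h1 : IntegrableOn (J i) (φ '' K) :=
      (hcont.mono hKV).integrableOn_compact (hKc.image_of_continuousOn (φ.continuousOn.mono hKs))
    refine h1.of_forall_sdiff_eq_zero φ.open_target.measurableSet fun y hy ↦ ?_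
    by_cases h1 : φ.symm y ∈ tsupport f
    · have h2 : φ.symm y ∉ tsupport (C.rho i) := fun h2 ↦
        hy.2 ⟨φ.symm y, ⟨h2, h1⟩, φ.right_inv hy.1⟩
      simp only [J]
      rw [← hφdef, image_eq_zero_of_notMem_tsupport h2]
      ring
    · exact hJ0 i y h1
  have hae := (setIntegral_eq_zero_iff_of_nonneg_ae
    ((ae_restrict_iff' φ.open_target.measurableSet).mpr (Eventually.of_forall (hJnn i)))
      hint).mp hzero
  have hae' : J i =ᵐ[volume.restrict (φ.target ∩ φ.symm ⁻¹' U)] fun _ ↦ 0 :=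
    ae_restrict_of_ae_restrict_of_subset Set.inter_subset_left hae
  have hEq := Measure.eqOn_open_of_ae_eq hae' hVopen hcont continuousOn_const
  have hxV : φ x₀ ∈ φ.target ∩ φ.symm ⁻¹' U :=
    ⟨φ.map_source hxs, by rw [Set.mem_preimage, φ.left_inv hxs]; exact hx₀⟩
  have hfx : f x₀ = 1 := f.eq_one
  have hx₀f : x₀ ∈ tsupport f := subset_tsupport _ (by
    rw [Function.mem_support, hfx]; exact one_ne_zero)
  have h1 := hpos i (φ x₀) hxV.1 (by rw [← hφdef, φ.left_inv hxs]; exact hx₀f)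
  have h2 : J i (φ x₀) = 0 := hEq hxV
  simp only [J] at h2
  rw [mul_assoc] at h2
  refine (mul_ne_zero (mul_ne_zero ?_ ?_) h1.ne') h2
  · rw [← hφdef, φ.left_inv hxs]; exact hi
  · rw [← hφdef, φ.left_inv hxs, hfx]; exact one_ne_zero

theorem isPerfect_of_momentMapPi_eq_zero [T2Space X] [CompactSpace X]
    (ho : IsBundleOrientation o)
    (A : CovariantDerivative (𝓡 4) E3 E) [A.ContMDiffCovariantDerivative ∞]
    (hA : A.IsMetricCompatible) (hdef : IsDefinite A)
    (hm : momentMapPi o (inducedConnection o A) = 0) : IsPerfect A := by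
  intro x ℓ i j t
  obtain ⟨β, hβa, hβ, hcc⟩ := exists_curvature_vector ho A hA x ℓ
  have hw (a b : Fin 3) : wedge (curvatureComponent A x ℓ a) (curvatureComponent A x ℓ b) t =
      curvWedge (fun u v ↦ β u v) t (EuclideanSpace.single a 1) (EuclideanSpace.single b 1) := by
    rw [curvWedge_single]
    congr 1 <;> (funext u v; exact hcc _ u v)
  have key (a b : E3) (ha : ‖a‖ = 1) (hb : ‖b‖ = 1) (hab : inner ℝ a b = (0 : ℝ)) :
      curvWedge (fun u v ↦ β u v) t a b = 0 := by
    -- an isometry whose first two columns are `a` and `b`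
    obtain ⟨g, hg0, hg1⟩ : ∃ g : E3 ≃ₗᵢ[ℝ] E3, g (EuclideanSpace.single 0 1) = a ∧
        g (EuclideanSpace.single 1 1) = b := by
      have ho3 : Orthonormal ℝ ![a, b, crossE a b] := by
        rw [orthonormal_iff_ite]
        have haa : inner ℝ a a = (1 : ℝ) := by rw [real_inner_self_eq_norm_sq, ha, one_pow]
        have hbb : inner ℝ b b = (1 : ℝ) := by rw [real_inner_self_eq_norm_sq, hb, one_pow]
        have hcross : inner ℝ (crossE a b) (crossE a b) = (1 : ℝ) := by
          rw [real_inner_self_eq_norm_sq, norm_crossE ha hb hab, one_pow]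
        have hba : inner ℝ b a = (0 : ℝ) := by rw [real_inner_comm, hab]
        have hac : inner ℝ a (crossE a b) = (0 : ℝ) := by rw [real_inner_comm, inner_crossE_left]
        have hbc : inner ℝ b (crossE a b) = (0 : ℝ) := by rw [real_inner_comm, inner_crossE_right]
        intro k l
        fin_cases k <;> fin_cases l <;> simp only [haa, hbb, hab, hba, hac, hbc, hcross,
          inner_crossE_left, inner_crossE_right, Fin.zero_eta, Fin.mk_one, Fin.reduceFinMk,
          Matrix.cons_val, Fin.isValue, reduceIte, Fin.reduceEq]
      let c : OrthonormalBasis (Fin 3) ℝ E3 := OrthonormalBasis.mk ho3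
        (ho3.linearIndependent.span_eq_top_of_card_eq_finrank (by simp)).ge
      refine ⟨c.repr.symm, ?_, ?_⟩ <;> simp [c]
    obtain ⟨U, hU, hxU, L, hL, hLx, ε, hε1, hε⟩ := ho.exists_frame_through x (g.trans ℓ)
    obtain ⟨β', -, hβ', hcc'⟩ := exists_curvature_vector ho A hA x (L x)
    obtain ⟨δ, hδ, hββ'⟩ := exists_sign_curvature_vector hβ hβ'
    have h0 := compWedge_eq_zero_of_momentMapPi_eq_zero ho A hA hdef hm hL hU hxU hε1 hε
    have h1 := compWedge_eq_det_mul (L := L) ho A hA 0 1 x t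
    rw [h0, mul_zero, compWedge_eq_curvWedge hcc'] at h1
    have h2 (u v : TangentSpace (𝓡 4) x) (e : E3) :
        (inner ℝ (β' u v) e : ℝ) = δ * inner ℝ (β u v) (g e) := by
      rw [hββ', real_inner_smul_left, hLx]
      congr 1
      rw [← (g.trans ℓ).inner_map_map, LinearIsometryEquiv.apply_symm_apply]
      exact ℓ.inner_map_map _ _
    have h3 : curvWedge (fun u v ↦ β' u v) t (EuclideanSpace.single 0 1) (EuclideanSpace.single 1 1)
        = δ * δ * curvWedge (fun u v ↦ β u v) t a b := by
      simp only [curvWedge, LinearMap.mk₂_apply, h2, hg0, hg1]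
      exact wedge_smul_smul δ δ _ _ t
    rw [h3, hδ, one_mul] at h1
    exact h1
  have h := eq_mul_inner_of_orthonormal _ key (EuclideanSpace.single i 1) (EuclideanSpace.single j 1)
  simp only [hw]
  rw [h]
  by_cases hij : i = j
  · subst hij; simp
  · simp [hij, EuclideanSpace.inner_single_left]

end Frame

end DefConn

theorem mainTheorem6
    {X : Type*} [TopologicalSpace X] [T2Space X] [CompactSpace X]
    [ChartedSpace DefConn.E4 X] [IsManifold (𝓡 4) ∞ X]
    {E : X → Type*} [TopologicalSpace (TotalSpace DefConn.E3 E)]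
    [∀ x, NormedAddCommGroup (E x)] [∀ x, InnerProductSpace ℝ (E x)]
    [FiberBundle DefConn.E3 E] [VectorBundle ℝ DefConn.E3 E]
    [ContMDiffVectorBundle ∞ DefConn.E3 E (𝓡 4)] [IsContMDiffRiemannianBundle (𝓡 4) ∞ DefConn.E3 E]
    (o : ∀ x, Orientation ℝ (E x) (Fin 3)) (ho : DefConn.IsBundleOrientation o)
    (A : CovariantDerivative (𝓡 4) DefConn.E3 E) [A.ContMDiffCovariantDerivative ∞]
    (hA : A.IsMetricCompatible) (hdef : DefConn.IsDefinite A) :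
    DefConn.inducedConnection o A ∈ DefConn.symplecticConnections o ∧
      (DefConn.momentMapPi o (DefConn.inducedConnection o A) = 0 ↔ DefConn.IsPerfect A) := by
  exact ⟨⟨DefConn.isUnitaryConnection_inducedConnection ho A hA,
    DefConn.isNondegenerate_inducedConnection ho A hA hdef⟩,
    DefConn.isPerfect_of_momentMapPi_eq_zero ho A hA hdef,
    DefConn.momentMapPi_eq_zero_of_isPerfect ho A hA⟩
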